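/- Let $\kappa\ge e$ and $0<a<1/2$. Let $\mathbb T^2=(\mathbb R/2\pi\mathbb Z)^2$. On $\mathbb T^2$ let $\mathcal L$ be the Fourier multiplier with symbol $|k|/\log^a(\kappa+|k|)$, $k\in\mathbb Z^2$, and let $R^\perp\theta=(R_2\theta,-R_1\theta)$, where $R_j=\partial_j(-\Delta)^{-1/2}$ are the Riesz transforms (with symbol $0$ at $k=0$). Consider the forced logarithmically supercritical SQG equation $$\partial_t\theta+R^\perp\theta\cdot\nabla\theta+\mathcal L\theta=f,\qquad \theta(0,\cdot)=\theta_0, \tag{1}$$ where $f=f(x)$ is real-valued and $\int_{\mathbb T^2} f\,dx=0$. For $\alpha\in(0,1/2)$ and $x\ge 0$ put $$\varphi(x)=\varphi_\alpha(x)=\int_0^x\log^{a\frac{2-\alpha}{1-\alpha}}\bigl(\kappa+(4s)^{-1}\bigr)\,ds .$$ Then there exist constants $c_0>0$ and $X_0\in(0,1)$, depending only on $a$ and the fixed constant $\kappa$, such that the following holds. For every $M>0$ and every $\xi_0\in(0,X_0)$ there exist $\alpha_0\in(0,1/2)$ and $C\ge 0$, depending only on $a,\kappa,M,\xi_0$,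 such that for every $\alpha\in(0,\alpha_0]$, with $$T_*=\frac{4\alpha\,\varphi_\alpha(\xi_0)}{c_0},$$ every mean-zero $f\in C^\infty(\mathbb T^2)$, every $T\ge T_*$ and every real-valued smooth solution $\theta\in C^\infty([0,T]\times\mathbb T^2)$ of (1) on $[0,T]$ with $$\|\theta_0\|_{L^\infty}+\|f\|_{L^\infty}\le M,$$ one has $$|\theta(t)|_{C^\alpha}=\sup_{x\ne y}\frac{|\theta(t,x)-\theta(t,y)|}{|x-y|^\alpha}\le C\qquad\text{for all } t\in[T_*,T].$$ In particular, if $\theta$ is a smooth solution on $[0,\infty)$, the bound holds for all $t\ge T_*$. -/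

import Mathlib

open scoped NNReal ENNReal

noncomputable section

namespace LogSQG

/-- The Euclidean plane. Functions on the torus `𝕋² = (ℝ / 2πℤ)²` are functions on the plane
that are `2π`-periodic in each coordinate. -/
abbrev Plane : Type := EuclideanSpace ℝ (Fin 2)

/-- `2π`-periodicity in each of the two coordinates. -/
def IsPeriodic (g : Plane → ℝ) : Prop :=
  ∀ (i : Fin 2) (x : Plane), g (x + EuclideanSpace.single i (2 * Real.pi)) = g x

/-- The fundamental domain `(0, 2π]²` of the torus. -/
def cell : Set Plane := {x | ∀ i, x i ∈ Set.Ioc (0 : ℝ) (2 * Real.pi)}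

/-- The character `x ↦ exp (i k · x)` of the torus, `k ∈ ℤ²`. -/
def character (k : Fin 2 → ℤ) (x : Plane) : ℂ :=
  Complex.exp (Complex.I * ((∑ i, (k i : ℝ) * x i : ℝ) : ℂ))

/-- The Fourier coefficient `(2π)⁻² ∫_{𝕋²} g(x) exp (-i k · x) dx`. -/
def torusFourierCoeff (g : Plane → ℝ) (k : Fin 2 → ℤ) : ℂ :=
  ((2 * Real.pi) ^ 2 : ℂ)⁻¹ * ∫ x in cell, (g x : ℂ) * character (-k) x

/-- The Euclidean length `|k|` of a frequency. -/
def freqNorm (k : Fin 2 → ℤ) : ℝ := Real.sqrt (∑ i, (k i : ℝ) ^ 2)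

/-- The Fourier multiplier with symbol `m`. All symbols below have polynomial growth, so that for
smooth periodic `g` the series converges absolutely, and they satisfy `m (-k) = conj (m k)`, so
that its sum is real. -/
def multiplier (m : (Fin 2 → ℤ) → ℂ) (g : Plane → ℝ) (x : Plane) : ℝ :=
  (∑' k : Fin 2 → ℤ, m k * torusFourierCoeff g k * character k x).re

/-- The Riesz transform `R_j = ∂_j (-Δ)^{-1/2}`, with symbol `i k_j / |k|` (and `0` at `k = 0`,
which is the value of `0 / 0` here). -/
def riesz (j : Fin 2) (g : Plane → ℝ) : Plane → ℝ :=
  multiplier (fun k => Complex.I * (((k j : ℝ) / freqNorm k : ℝ) : ℂ)) g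

/-- The rotated Riesz transform `R^⊥ g = (R₂ g, -R₁ g)`. -/
def rieszPerp (g : Plane → ℝ) (x : Plane) : Plane := !₂[riesz 1 g x, -riesz 0 g x]

/-- The logarithmically supercritical diffusion operator, with symbol
`|k| / log^a (κ + |k|)`. -/
def diffusion (a κ : ℝ) (g : Plane → ℝ) : Plane → ℝ :=
  multiplier (fun k => ((freqNorm k / Real.log (κ + freqNorm k) ^ a : ℝ) : ℂ)) g

/-- Admissible forcing terms: smooth functions on the torus with mean zero. -/
structure IsForcing (f : Plane → ℝ) : Prop where
  periodic : IsPeriodic f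
  smooth : ContDiff ℝ (⊤ : ℕ∞) f
  mean_zero : ∫ x in cell, f x = 0

/-- `θ` is a smooth solution on `[0,T] × 𝕋²` of
`∂_t θ + R^⊥ θ · ∇θ + 𝓛 θ = f`. The time derivative is one-sided at the endpoints of `[0,T]`, and
`fderiv ℝ (θ t) x u` is `u · ∇θ(t,x)`. -/
structure IsSmoothSolution (a κ : ℝ) (f : Plane → ℝ) (T : ℝ) (θ : ℝ → Plane → ℝ) : Prop where
  periodic : ∀ t ∈ Set.Icc 0 T, IsPeriodic (θ t)
  smooth : ContDiffOn ℝ (⊤ : ℕ∞) (fun p : ℝ × Plane => θ p.1 p.2) (Set.Icc 0 T ×ˢ Set.univ)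
  equation : ∀ t ∈ Set.Icc 0 T, ∀ x : Plane,
    HasDerivWithinAt (fun s => θ s x)
      (f x - fderiv ℝ (θ t) x (rieszPerp (θ t) x) - diffusion a κ (θ t) x) (Set.Icc 0 T) t

/-- The supremum norm. It is applied only to continuous periodic functions, which are bounded. -/
def supNorm (g : Plane → ℝ) : ℝ := ⨆ x, |g x|

/-- `φ(x) = ∫₀ˣ log^{a(2-α)/(1-α)} (κ + (4s)⁻¹) ds`. -/
def phi (a κ α x : ℝ) : ℝ :=
  ∫ s in (0 : ℝ)..x, Real.log (κ + (4 * s)⁻¹) ^ (a * ((2 - α) / (1 - α)))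

/-- `T_* = 4 α φ(ξ₀) / c₀`. -/
def Tstar (a κ c₀ ξ₀ α : ℝ) : ℝ := 4 * α * phi a κ α ξ₀ / c₀

end LogSQG

end

open scoped NNReal ENNReal

noncomputable section

namespace LogSQG

open MeasureTheory Set
open scoped Pointwise

/-! ### Periodic functions on the plane -/

/-! The increments θ(t,x+h) - θ(t,x) are kept below a moving modulus A ρ^α with ρ² = ξ(t)² + |h|².
The scale ξ decreases from ξ₀ + ε at time 0 to ε at time T_*. At time 0 the sup norm of the data
already keeps the increments below the modulus; after T_*, letting ε → 0 leaves a Hölder bound with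
constant A. If the modulus were reached, compactness and periodicity would give a first touching
time (`Barrier.lt_modulus`), and the equation excludes it (`Barrier.not_touch`).

Let Λ be the increment of 𝓛θ at the touching pair. The symbol r / log^a(κ + r) is a Bernstein
function of r, so 𝓛g is an average of g - P_u g over the Poisson semigroup against a Lévy measure
(`lintegral_one_sub_exp_levyMeasure`), whose first moment on (0,u] is at least of order log^{-a}(κ +
1/u) for bounded u (`levyMeasure_moment_lower`). At the touching point z ↦ θ(z+h) - θ(z) is maximal
at x, so its deficit D(u) under P_u is nonnegative, and P_w ≥ (w/u) P_u for w ≤ u gives D(w) ≥ (w/u)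
D(u). Hence Λ dominates D(u)/u up to the logarithm (`Touches.deficit_le_diffusion`). At a large
multiple of ρ the deficit is at least A ρ^α / 2, which bounds Λ from below
(`Touches.dissipation_lower`).

The same deficit controls the velocity. The Riesz transform is the integral over u of ∂_j P_u, and
|∂_j P_u| ≤ 3/(2u) P_u bounds the increment at height u ≤ ρ by D(u)/u; above ρ the modulus itself
gives decay in u. So the velocity increment is at most C Λ ρ log^a(κ + 1/ρ)
(`Touches.abs_riesz_sub_le`). The gradients of θ at both points equal that of the modulus, of size
at most A α ρ^{α-1}, so the transport term is at most C A α ρ^α log^a(κ + 1/ρ) Λ. Since a < 1/2, the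
factor α ρ^α log^a is O(√α) (`transport_bound`), so small α makes transport cost at most Λ/4 even
though A is large.

A is chosen first, from M and ξ₀, so that the forcing costs at most Λ/4; then α₀ is chosen from A.
The length of T_* makes the motion of the scale cost at most Λ/4 (`shrink_bound`). Altogether at
most 3Λ/4 is spent against Λ > 0. -/

/-- The lattice vector `2π n`. -/
def latticeVec (n : Fin 2 → ℤ) : Plane := WithLp.toLp 2 (fun i => 2 * Real.pi * n i)

lemma latticeVec_apply (n : Fin 2 → ℤ) (i : Fin 2) : latticeVec n i = 2 * Real.pi * n i := rfl

lemma periodic_zmultiple {E : Type*} {g : Plane → E} {v : Plane} (h : ∀ x, g (x + v) = g x) (n : ℤ)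
    (x : Plane) : g (x + (n : ℝ) • v) = g x := by
  have h' : Function.Periodic g v := h
  have := h'.zsmul n x
  rwa [← Int.cast_smul_eq_zsmul ℝ] at this

lemma latticeVec_eq (n : Fin 2 → ℤ) : latticeVec n =
    (n 0 : ℝ) • EuclideanSpace.single 0 (2 * Real.pi)
      + (n 1 : ℝ) • EuclideanSpace.single 1 (2 * Real.pi) := by
  ext i
  fin_cases i <;> simp [latticeVec] <;> ring

lemma periodic_latticeVec {E : Type*} {g : Plane → E}
    (h : ∀ (i : Fin 2) (x : Plane), g (x + EuclideanSpace.single i (2 * Real.pi)) = g x)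
    (n : Fin 2 → ℤ) (x : Plane) : g (x + latticeVec n) = g x := by
  rw [latticeVec_eq, ← add_assoc, periodic_zmultiple (h 1), periodic_zmultiple (h 0)]

lemma exists_latticeVec_mem (b : ℝ) (x : Plane) :
    ∃ n, ∀ i, (x + latticeVec n) i ∈ Ico b (b + 2 * Real.pi) := by
  have h (i : Fin 2) := existsUnique_add_zsmul_mem_Ico Real.two_pi_pos (x i) b
  choose n hn _ using h
  refine ⟨n, fun i => ?_⟩
  have := hn i
  simpa [latticeVec, mul_comm] using this

lemma isCompact_box (b c : ℝ) : IsCompact {x : Plane | ∀ i, x i ∈ Icc b c} := by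
  have h : IsCompact (univ.pi fun _ : Fin 2 => Icc b c) := isCompact_univ_pi fun _ => isCompact_Icc
  have h2 := h.image (PiLp.continuous_toLp 2 (fun _ : Fin 2 => ℝ))
  convert! h2 using 1
  ext x
  constructor
  · intro hx
    exact ⟨WithLp.ofLp x, fun i _ => hx i, rfl⟩
  · rintro ⟨y, hy, rfl⟩ i
    exact hy i (mem_univ i)

lemma IsPeriodic.bounded {g : Plane → ℝ} (hp : IsPeriodic g) (hc : Continuous g) :
    ∃ C, ∀ x, |g x| ≤ C := by
  obtain ⟨C, hC⟩ := (isCompact_box 0 (0 + 2 * Real.pi)).exists_bound_of_continuousOn hc.continuousOn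
  refine ⟨C, fun x => ?_⟩
  obtain ⟨n, hn⟩ := exists_latticeVec_mem 0 x
  rw [← periodic_latticeVec hp n x]
  exact hC _ fun i => Ico_subset_Icc_self (hn i)

lemma IsPeriodic.abs_le_supNorm {g : Plane → ℝ} (hp : IsPeriodic g) (hc : Continuous g) (x : Plane) :
    |g x| ≤ supNorm g := by
  obtain ⟨C, hC⟩ := hp.bounded hc
  exact le_ciSup (f := fun x => |g x|) ⟨C, by rintro _ ⟨y, rfl⟩; exact hC y⟩ x

/-- The partial derivative `∂_j g`. -/
def partialDeriv (j : Fin 2) (g : Plane → ℝ) (x : Plane) : ℝ :=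
  fderiv ℝ g x (EuclideanSpace.single j 1)

lemma IsPeriodic.fderiv_eq {g : Plane → ℝ} (hp : IsPeriodic g) (i : Fin 2) (x : Plane) :
    fderiv ℝ g (x + EuclideanSpace.single i (2 * Real.pi)) = fderiv ℝ g x := by
  have : (fun y => g (y + EuclideanSpace.single i (2 * Real.pi))) = g := funext (hp i)
  rw [← fderiv_comp_add_right, this]

lemma IsPeriodic.partialDeriv {g : Plane → ℝ} (hp : IsPeriodic g) (j : Fin 2) :
    IsPeriodic (partialDeriv j g) := fun i x => by
  simp only [LogSQG.partialDeriv, hp.fderiv_eq]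

lemma contDiff_partialDeriv {g : Plane → ℝ} (hs : ContDiff ℝ (⊤ : ℕ∞) g) (j : Fin 2) :
    ContDiff ℝ (⊤ : ℕ∞) (partialDeriv j g) := by
  unfold partialDeriv
  exact (hs.fderiv_right (m := (⊤ : ℕ∞)) (by simp)).clm_apply contDiff_const

/-! ### Characters -/

lemma character_add (k : Fin 2 → ℤ) (x y : Plane) :
    character k (x + y) = character k x * character k y := by
  simp only [character, ← Complex.exp_add, Fin.sum_univ_two, PiLp.add_apply]
  congr 1
  push_cast
  ring

lemma norm_character (k : Fin 2 → ℤ) (x : Plane) : ‖character k x‖ = 1 := by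
  rw [character, mul_comm, Complex.norm_exp_ofReal_mul_I]

lemma continuous_character (k : Fin 2 → ℤ) : Continuous (character k) := by
  unfold character
  fun_prop

lemma character_lattice (k : Fin 2 → ℤ) (i : Fin 2) (x : Plane) :
    character k (x + EuclideanSpace.single i (2 * Real.pi)) = character k x := by
  rw [character_add]
  have : character k (EuclideanSpace.single i (2 * Real.pi)) = 1 := by
    rw [character, Complex.exp_eq_one_iff]
    refine ⟨k i, ?_⟩
    fin_cases i <;> simp <;> ring
  rw [this, mul_one]

lemma hasDerivAt_character (k : Fin 2 → ℤ) (j : Fin 2) (x : Plane) :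
    HasDerivAt (fun τ : ℝ => character k (x + τ • EuclideanSpace.single j 1))
      (Complex.I * k j * character k x) 0 := by
  have h1 : (fun τ : ℝ => character k (x + τ • EuclideanSpace.single j 1)) =
      fun τ : ℝ => character k x * Complex.exp (Complex.I * k j * τ) := by
    funext τ
    rw [character_add]
    congr 1
    rw [character]
    congr 1
    fin_cases j <;> simp <;> ring
  rw [h1]
  have h2 : HasDerivAt (fun τ : ℝ => Complex.I * k j * (τ : ℂ)) (Complex.I * k j) 0 := by
    simpa using (Complex.ofRealCLM.hasDerivAt (x := (0 : ℝ))).const_mul (Complex.I * (k j : ℂ))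
  have h3 := (h2.cexp).const_mul (character k x)
  convert! h3 using 1
  simp
  ring

/-! ### Integrals over the fundamental cell -/

lemma cell_subset : cell ⊆ {x : Plane | ∀ i, x i ∈ Icc 0 (2 * Real.pi)} :=
  fun _ hx i => Ioc_subset_Icc_self (hx i)

lemma volume_cell_lt_top : volume cell < ⊤ :=
  (measure_mono cell_subset).trans_lt (isCompact_box 0 _).measure_lt_top

/-- The plane as a product. -/
lemma measurePreserving_pair :
    MeasurePreserving (fun p : ℝ × ℝ => (!₂[p.1, p.2] : Plane)) volume volume := by
  have h1 := (volume_preserving_finTwoArrow ℝ).symm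
  have h2 := PiLp.volume_preserving_toLp (Fin 2)
  have h3 := h2.comp h1
  convert! h3 using 1

lemma measurableEmbedding_pair :
    MeasurableEmbedding (fun p : ℝ × ℝ => (!₂[p.1, p.2] : Plane)) := by
  have h := ((MeasurableEquiv.finTwoArrow (α := ℝ)).symm.trans
    (MeasurableEquiv.toLp 2 (Fin 2 → ℝ))).measurableEmbedding
  convert! h using 1

lemma integral_cell_eq_prod (F : Plane → ℂ) : ∫ x in cell, F x =
    ∫ p in Ioc (0 : ℝ) (2 * Real.pi) ×ˢ Ioc (0 : ℝ) (2 * Real.pi), F !₂[p.1, p.2] := by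
  rw [← measurePreserving_pair.setIntegral_preimage_emb measurableEmbedding_pair]
  congr 2
  ext p
  simp [cell, Fin.forall_fin_two]

lemma integrableOn_square {F : Plane → ℂ} (hF : Continuous F) :
    IntegrableOn (fun p : ℝ × ℝ => F !₂[p.1, p.2])
      (Ioc (0 : ℝ) (2 * Real.pi) ×ˢ Ioc (0 : ℝ) (2 * Real.pi)) := by
  have hc : Continuous (fun p : ℝ × ℝ => F !₂[p.1, p.2]) := by fun_prop
  exact (hc.continuousOn.integrableOn_compact (isCompact_Icc.prod isCompact_Icc)).mono_set
    (prod_mono Ioc_subset_Icc_self Ioc_subset_Icc_self)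

/-- By Fubini the integral is first taken along lines in direction `e_j`; on each line the integrand
is the derivative of a periodic function. This is the integration by parts behind the decay of
Fourier coefficients. -/
lemma integral_cell_deriv_eq_zero {F F' : Plane → ℂ} (j : Fin 2) (hF' : Continuous F')
    (hper : ∀ (i : Fin 2) (x : Plane), F (x + EuclideanSpace.single i (2 * Real.pi)) = F x)
    (hd : ∀ x, HasDerivAt (fun τ : ℝ => F (x + τ • EuclideanSpace.single j 1)) (F' x) 0) :
    ∫ x in cell, F' x = 0 := by
  have hder (x : Plane) (t : ℝ) :
      HasDerivAt (fun s : ℝ => F (x + s • EuclideanSpace.single j 1))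
        (F' (x + t • EuclideanSpace.single j 1)) t := by
    have h1 := hd (x + t • EuclideanSpace.single j 1)
    have h0 : HasDerivAt (fun s : ℝ => s - t) 1 t := (hasDerivAt_id t).sub_const t
    have h2 := HasDerivAt.scomp t (by simpa using h1) h0
    convert! h2 using 1
    · funext s
      simp only [Function.comp]
      congr 1
      module
    · simp
  have hline (x : Plane) :
      ∫ t in Ioc (0 : ℝ) (2 * Real.pi), F' (x + t • EuclideanSpace.single j 1) = 0 := by
    rw [← intervalIntegral.integral_of_le Real.two_pi_pos.le,
      intervalIntegral.integral_eq_sub_of_hasDerivAt (fun t _ => hder x t)]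
    · have : (2 * Real.pi) • EuclideanSpace.single j (1 : ℝ)
          = (EuclideanSpace.single j (2 * Real.pi) : Plane) := by
        ext i; by_cases h : i = j <;> simp [h]
      rw [this, hper]; simp
    · exact Continuous.intervalIntegrable (by fun_prop) _ _
  rw [integral_cell_eq_prod]
  have hi := integrableOn_square hF'
  fin_cases j
  · rw [Measure.volume_eq_prod, ← Measure.prod_restrict, integral_prod_symm]
    · refine (integral_congr_ae (Filter.Eventually.of_forall fun t => ?_)).trans
        (integral_zero _ _)
      simp only
      rw [← hline !₂[0, t]]
      congr 1
      funext s
      congr 1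
      ext i; fin_cases i <;> simp
    · rwa [Measure.prod_restrict]
  · rw [Measure.volume_eq_prod, ← Measure.prod_restrict, integral_prod]
    · refine (integral_congr_ae (Filter.Eventually.of_forall fun t => ?_)).trans
        (integral_zero _ _)
      simp only
      rw [← hline !₂[t, 0]]
      congr 1
      funext s
      congr 1
      ext i; fin_cases i <;> simp
    · rwa [Measure.prod_restrict]

/-! ### Fourier series of smooth periodic functions -/

lemma norm_torusFourierCoeff_le {g : Plane → ℝ} (hp : IsPeriodic g) (hc : Continuous g) :
    ∃ C, ∀ k, ‖torusFourierCoeff g k‖ ≤ C := by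
  obtain ⟨C, hC⟩ := hp.bounded hc
  refine ⟨‖((2 * Real.pi) ^ 2 : ℂ)⁻¹‖ * (C * volume.real cell), fun k => ?_⟩
  rw [torusFourierCoeff, norm_mul]
  refine mul_le_mul_of_nonneg_left ?_ (norm_nonneg _)
  refine norm_setIntegral_le_of_norm_le_const volume_cell_lt_top fun x _ => ?_
  rw [norm_mul, norm_character, mul_one, Complex.norm_real]
  exact hC x

lemma integrableOn_cell {F : Plane → ℂ} (hF : Continuous F) : IntegrableOn F cell :=
  (hF.continuousOn.integrableOn_compact (isCompact_box 0 _)).mono_set cell_subset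

lemma torusFourierCoeff_partialDeriv {g : Plane → ℝ} (hp : IsPeriodic g)
    (hs : ContDiff ℝ (⊤ : ℕ∞) g) (j : Fin 2) (k : Fin 2 → ℤ) :
    torusFourierCoeff (partialDeriv j g) k = Complex.I * k j * torusFourierCoeff g k := by
  have hcg : Continuous g := hs.continuous
  have hcd : Continuous (partialDeriv j g) := (contDiff_partialDeriv hs j).continuous
  have hck := continuous_character (-k)
  have key := integral_cell_deriv_eq_zero (F := fun x => (g x : ℂ) * character (-k) x)
    (F' := fun x => (partialDeriv j g x : ℂ) * character (-k) x
      + (g x : ℂ) * (Complex.I * ((-k) j : ℤ) * character (-k) x)) j (by fun_prop)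
    (fun i x => by rw [hp, character_lattice]) (fun x => by
      have h1 : HasDerivAt (fun τ : ℝ => g (x + τ • EuclideanSpace.single j 1))
          (partialDeriv j g x) 0 :=
        ((hs.differentiable (by simp)) x).hasFDerivAt.hasLineDerivAt _
      have h2 := h1.ofReal_comp.mul (hasDerivAt_character (-k) j x)
      simpa using! h2)
  rw [integral_add (integrableOn_cell (by fun_prop)) (integrableOn_cell (by fun_prop))] at key
  have h3 : ∫ x in cell, (g x : ℂ) * (Complex.I * ((-k) j : ℤ) * character (-k) x)
      = -(Complex.I * k j) * ∫ x in cell, (g x : ℂ) * character (-k) x := by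
    rw [← integral_const_mul]
    congr 1
    funext x
    simp
    ring
  rw [h3] at key
  rw [torusFourierCoeff, torusFourierCoeff, eq_neg_of_add_eq_zero_left key]
  ring

lemma norm_coeff_mul_pow {g : Plane → ℝ} (hp : IsPeriodic g) (hs : ContDiff ℝ (⊤ : ℕ∞) g)
    (j : Fin 2) (m : ℕ) : ∃ C, ∀ k : Fin 2 → ℤ, ‖torusFourierCoeff g k‖ * |(k j : ℝ)| ^ m ≤ C := by
  induction m generalizing g with
  | zero => simpa using norm_torusFourierCoeff_le hp hs.continuous
  | succ m ih =>
    obtain ⟨C, hC⟩ := ih (hp.partialDeriv j) (contDiff_partialDeriv hs j)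
    refine ⟨C, fun k => ?_⟩
    have := hC k
    rw [torusFourierCoeff_partialDeriv hp hs, norm_mul, norm_mul, Complex.norm_I, one_mul,
      Complex.norm_intCast] at this
    rw [pow_succ]
    linarith

lemma norm_coeff_mul_norm_pow {g : Plane → ℝ} (hp : IsPeriodic g) (hs : ContDiff ℝ (⊤ : ℕ∞) g)
    (m : ℕ) : ∃ C, ∀ k : Fin 2 → ℤ, ‖torusFourierCoeff g k‖ * ‖k‖ ^ m ≤ C := by
  obtain ⟨C₀, h₀⟩ := norm_coeff_mul_pow hp hs 0 m
  obtain ⟨C₁, h₁⟩ := norm_coeff_mul_pow hp hs 1 m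
  refine ⟨max C₀ C₁, fun k => ?_⟩
  obtain ⟨j, hj⟩ : ∃ j, ‖k‖ = ‖k j‖ := by
    obtain ⟨j, hj⟩ := Finite.exists_max fun i => ‖k i‖
    exact ⟨j, le_antisymm ((pi_norm_le_iff_of_nonneg (norm_nonneg _)).2 hj) (norm_le_pi_norm k j)⟩
  rw [hj, Int.norm_eq_abs]
  fin_cases j
  · exact (h₀ k).trans (le_max_left _ _)
  · exact (h₁ k).trans (le_max_right _ _)

/-- The extra factor `‖k‖` absorbs the growth of the diffusion symbol when sums and integrals are
exchanged. -/
lemma summable_norm_mul_coeff {g : Plane → ℝ} (hp : IsPeriodic g) (hs : ContDiff ℝ (⊤ : ℕ∞) g) :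
    Summable fun k : Fin 2 → ℤ => ‖k‖ * ‖torusFourierCoeff g k‖ := by
  -- Decay of order 4 leaves `‖k‖⁻³` after the factor `‖k‖`, which is summable over a lattice of
  -- rank 2.
  obtain ⟨C, hC⟩ := norm_coeff_mul_norm_pow hp hs 4
  refine Summable.of_nonneg_of_le (fun k => by positivity) (fun k => ?_)
    ((EisensteinSeries.summable_one_div_norm_rpow (k := 3) (by norm_num)).mul_left C)
  rcases eq_or_ne k 0 with rfl | hk
  · simp
  · have hpos : 0 < ‖k‖ := norm_pos_iff.2 hk
    rw [Real.rpow_neg hpos.le, show (3 : ℝ) = (3 : ℕ) by norm_num, Real.rpow_natCast,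
      ← div_eq_mul_inv, le_div_iff₀ (by positivity)]
    linarith [hC k]

lemma summable_norm_coeff {g : Plane → ℝ} (hp : IsPeriodic g) (hs : ContDiff ℝ (⊤ : ℕ∞) g) :
    Summable fun k : Fin 2 → ℤ => ‖torusFourierCoeff g k‖ := by
  refine Summable.of_norm_bounded_eventually (summable_norm_mul_coeff hp hs) ?_
  filter_upwards [(Set.finite_singleton (0 : Fin 2 → ℤ)).compl_mem_cofinite] with k hk
  rw [norm_norm]
  refine le_mul_of_one_le_left (norm_nonneg _) ?_
  obtain ⟨i, hi⟩ := Function.ne_iff.1 (show k ≠ 0 from hk)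
  refine le_trans ?_ (norm_le_pi_norm k i)
  rw [Int.norm_eq_abs]
  exact_mod_cast Int.one_le_abs hi

/-- The point of the plane with angular coordinates `x`, measured in full turns. -/
def scaledPoint (x : Fin 2 → ℝ) : Plane := WithLp.toLp 2 (fun i => 2 * Real.pi * x i)

/-- A periodic function as a function on the torus. -/
def torusLift (g : Plane → ℝ) (y : UnitAddTorus (Fin 2)) : ℂ :=
  g (scaledPoint fun i => (AddCircle.equivIoc 1 0 (y i)).1)

lemma torusLift_coe {g : Plane → ℝ} (hp : IsPeriodic g) (x : Fin 2 → ℝ) :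
    torusLift g (fun i => (x i : UnitAddCircle)) = g (scaledPoint x) := by
  have h (i : Fin 2) : ∃ n : ℤ,
      (AddCircle.equivIoc (1 : ℝ) 0 (x i : UnitAddCircle)).1 = x i + n := by
    have h1 : (((AddCircle.equivIoc (1 : ℝ) 0 (x i : UnitAddCircle)).1 : ℝ) : UnitAddCircle) = x i :=
      AddCircle.coe_equivIoc
    have h2 : (((AddCircle.equivIoc (1 : ℝ) 0 (x i : UnitAddCircle)).1 - x i : ℝ) :
        UnitAddCircle) = 0 := by rw [AddCircle.coe_sub, h1, sub_self]
    obtain ⟨n, hn⟩ := (AddCircle.coe_eq_zero_iff _).1 h2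
    refine ⟨n, ?_⟩
    rw [zsmul_one] at hn
    linarith
  choose n hn using h
  rw [torusLift, ← periodic_latticeVec hp n (scaledPoint x)]
  congr 2
  ext i
  simp only [scaledPoint, PiLp.add_apply, latticeVec_apply, hn]
  ring

lemma continuous_torusLift {g : Plane → ℝ} (hp : IsPeriodic g) (hc : Continuous g) :
    Continuous (torusLift g) := by
  have hq : IsOpenQuotientMap
      (Pi.map fun _ : Fin 2 => ((↑) : ℝ → UnitAddCircle)) :=
    IsOpenQuotientMap.piMap fun _ => QuotientAddGroup.isOpenQuotientMap_mk
  rw [hq.isQuotientMap.continuous_iff]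
  have : torusLift g ∘ (Pi.map fun _ : Fin 2 => ((↑) : ℝ → UnitAddCircle))
      = fun x => (g (scaledPoint x) : ℂ) := funext fun x => torusLift_coe hp x
  rw [this]
  unfold scaledPoint
  fun_prop

lemma mFourier_eq_character (k : Fin 2 → ℤ) (x : Fin 2 → ℝ) :
    UnitAddTorus.mFourier k (fun i => (x i : UnitAddCircle)) = character k (scaledPoint x) := by
  simp only [UnitAddTorus.mFourier, ContinuousMap.coe_mk, fourier_coe_apply, Fin.prod_univ_two,
    ← Complex.exp_add, character, scaledPoint, Fin.sum_univ_two]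
  congr 1
  push_cast
  ring

/-- Dilation by `2π` carries the unit cell to `cell`, and its Jacobian is the normalisation
`(2π)⁻²`. -/
lemma mFourierCoeff_torusLift {g : Plane → ℝ} (hp : IsPeriodic g) (k : Fin 2 → ℤ) :
    UnitAddTorus.mFourierCoeff (torusLift g) k = torusFourierCoeff g k := by
  rw [UnitAddTorus.mFourierCoeff_eq_integral _ _ 0]
  have h2pi : (2 * Real.pi) ≠ 0 := Real.two_pi_pos.ne'
  have h1 : ∫ x in {x : Fin 2 → ℝ | ∀ i, x i ∈ Ioc ((0 : Fin 2 → ℝ) i) ((0 : Fin 2 → ℝ) i + 1)},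
      UnitAddTorus.mFourier (-k) (fun i => (x i : UnitAddCircle))
        • torusLift g (fun i => (x i : UnitAddCircle))
      = ∫ x in {x : Plane | ∀ i, x i ∈ Ioc (0 : ℝ) 1},
        (fun y : Plane => (g y : ℂ) * character (-k) y) ((2 * Real.pi) • x) := by
    rw [← (PiLp.volume_preserving_toLp (Fin 2)).setIntegral_preimage_emb
      (MeasurableEquiv.toLp 2 (Fin 2 → ℝ)).measurableEmbedding]
    have hset : {x : Fin 2 → ℝ | ∀ i, x i ∈ Ioc ((0 : Fin 2 → ℝ) i) ((0 : Fin 2 → ℝ) i + 1)}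
      = (WithLp.toLp 2 ⁻¹' {x : Plane | ∀ i, x i ∈ Ioc (0 : ℝ) 1}) := by
      ext x; simp
    rw [hset]
    congr 1
    funext x
    rw [torusLift_coe hp, mFourier_eq_character, smul_eq_mul, mul_comm]
    rfl
  rw [h1]
  refine (Measure.setIntegral_comp_smul volume (fun y : Plane => (g y : ℂ) * character (-k) y)
    _ h2pi).trans ?_
  have h3 : (2 * Real.pi) • {x : Plane | ∀ i, x i ∈ Ioc (0 : ℝ) 1} = cell := by
    ext x
    rw [Set.mem_smul_set_iff_inv_smul_mem₀ h2pi]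
    simp only [mem_ofPred_eq, PiLp.smul_apply, smul_eq_mul, cell, mem_Ioc]
    refine forall_congr' fun i => ?_
    rw [inv_mul_le_iff₀ Real.two_pi_pos, mul_one,
      mul_pos_iff_of_pos_left (inv_pos.2 Real.two_pi_pos)]
  rw [h3, torusFourierCoeff]
  simp only [finrank_euclideanSpace, Fintype.card_fin]
  rw [abs_of_nonneg (by positivity), Complex.real_smul]
  push_cast
  rfl

/-- The Fourier series of a smooth periodic function converges to it pointwise. -/
lemma hasSum_fourier {g : Plane → ℝ} (hp : IsPeriodic g) (hs : ContDiff ℝ (⊤ : ℕ∞) g)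
    (x : Plane) : HasSum (fun k => torusFourierCoeff g k * character k x) (g x : ℂ) := by
  let f : C(UnitAddTorus (Fin 2), ℂ) := ⟨torusLift g, continuous_torusLift hp hs.continuous⟩
  have hf (k : Fin 2 → ℤ) : UnitAddTorus.mFourierCoeff f k = torusFourierCoeff g k :=
    mFourierCoeff_torusLift hp k
  have hsum : Summable (UnitAddTorus.mFourierCoeff f) := by
    refine Summable.of_norm ?_
    simpa only [hf] using summable_norm_coeff hp hs
  have hx : scaledPoint (fun i => x i / (2 * Real.pi)) = x := by
    ext i
    simp only [scaledPoint]
    field_simp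
  have h := UnitAddTorus.hasSum_mFourier_series_apply_of_summable hsum
    (fun i => ((x i / (2 * Real.pi) : ℝ) : UnitAddCircle))
  have hv : f (fun i => ((x i / (2 * Real.pi) : ℝ) : UnitAddCircle)) = g x := by
    have := torusLift_coe hp (fun i => x i / (2 * Real.pi))
    rwa [hx] at this
  rw [hv] at h
  simpa only [hf, smul_eq_mul, mFourier_eq_character _ (fun i => x i / (2 * Real.pi)), hx] using h

/-! ### The Cauchy–Schlömilch substitution -/

/-- The substitution `y = p x - q / x` maps the half-line onto the real line with Jacobian `p + q /
x²`, and turns the Gaussian integral into two pieces that are equal by symmetry. -/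
lemma integral_exp_neg_sq_sub_div {p q : ℝ} (hp : 0 < p) (hq : 0 < q) :
    ∫ x in Ioi (0 : ℝ), Real.exp (-(p * x - q / x) ^ 2) = Real.sqrt Real.pi / (2 * p) := by
  have hder : ∀ x ∈ Ioi (0 : ℝ), HasDerivWithinAt (fun x => p * x - q / x) (p + q / x ^ 2)
      (Ioi 0) x := fun x hx => by
    have hx0 : x ≠ 0 := (mem_Ioi.1 hx).ne'
    have h1 := ((hasDerivAt_id x).const_mul p).sub ((hasDerivAt_inv hx0).const_mul q)
    convert! h1.hasDerivWithinAt using 1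
    field_simp
    ring
  have hinj : InjOn (fun x => p * x - q / x) (Ioi 0) := by
    have hmono : StrictMonoOn (fun x => p * x - q / x) (Ioi 0) := fun x hx y hy hxy => by
      have h1 : q / y < q / x := div_lt_div_of_pos_left hq hx hxy
      have h2 : p * x < p * y := mul_lt_mul_of_pos_left hxy hp
      simp only
      linarith
    exact hmono.injOn
  have himg : (fun x => p * x - q / x) '' Ioi 0 = univ := by
    refine eq_univ_of_forall fun y => ?_
    have hs : |y| < Real.sqrt (y ^ 2 + 4 * p * q) := by
      rw [← Real.sqrt_sq_eq_abs]
      exact Real.sqrt_lt_sqrt (sq_nonneg y) (by nlinarith [mul_pos hp hq])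
    have hsq : Real.sqrt (y ^ 2 + 4 * p * q) ^ 2 = y ^ 2 + 4 * p * q :=
      Real.sq_sqrt (by positivity)
    set s := Real.sqrt (y ^ 2 + 4 * p * q)
    have hpos : 0 < y + s := by linarith [neg_abs_le y]
    -- The positive root of `p x² - y x - q = 0`.
    refine ⟨(y + s) / (2 * p), mem_Ioi.2 (by positivity), ?_⟩
    simp only
    field_simp
    nlinarith
  have hder2 : ∀ x ∈ Ioi (0 : ℝ), HasDerivWithinAt (fun x => q / p / x) (-(q / p / x ^ 2))
      (Ioi 0) x := fun x hx => by
    have hx0 : x ≠ 0 := (mem_Ioi.1 hx).ne'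
    have h1 := (hasDerivAt_inv hx0).const_mul (q / p)
    convert! h1.hasDerivWithinAt using 1
    field_simp
  have hqp : 0 < q / p := div_pos hq hp
  have hinj2 : InjOn (fun x => q / p / x) (Ioi 0) := fun x hx y hy hxy => by
    have hx' := (mem_Ioi.1 hx).ne'
    have hy' := (mem_Ioi.1 hy).ne'
    simp only at hxy
    rw [div_eq_div_iff hx' hy'] at hxy
    exact (mul_left_cancel₀ hqp.ne' hxy).symm
  have himg2 : (fun x => q / p / x) '' Ioi 0 = Ioi 0 := by
    ext y
    constructor
    · rintro ⟨x, hx, rfl⟩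
      exact div_pos hqp hx
    · intro hy
      refine ⟨q / p / y, div_pos hqp hy, ?_⟩
      have := (mem_Ioi.1 hy).ne'
      simp only
      field_simp
  set g : ℝ → ℝ := fun x => Real.exp (-(p * x - q / x) ^ 2) with hg
  have hfull := integral_image_eq_integral_abs_deriv_smul measurableSet_Ioi hder hinj
    (fun y => Real.exp (-1 * y ^ 2))
  have hfullint := (integrableOn_image_iff_integrableOn_abs_deriv_smul measurableSet_Ioi hder hinj
    (fun y => Real.exp (-1 * y ^ 2))).1
      (by rw [himg, integrableOn_univ]; exact integrable_exp_neg_mul_sq one_pos)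
  rw [himg, setIntegral_univ, integral_gaussian, div_one] at hfull
  have hcong : EqOn (fun x => |p + q / x ^ 2| • Real.exp (-1 * (p * x - q / x) ^ 2))
      (fun x => p * g x + q / x ^ 2 * g x) (Ioi 0) := fun x hx => by
    have : 0 < p + q / x ^ 2 := by have := mem_Ioi.1 hx; positivity
    simp only [hg, smul_eq_mul, abs_of_pos this, neg_one_mul]
    ring
  rw [setIntegral_congr_fun measurableSet_Ioi hcong] at hfull
  have hfullint' := hfullint.congr_fun hcong measurableSet_Ioi
  have hgint : IntegrableOn g (Ioi 0) := by
    have hmeas : AEStronglyMeasurable g (volume.restrict (Ioi 0)) := by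
      refine Measurable.aestronglyMeasurable ?_
      simp only [hg]
      fun_prop
    refine Integrable.mono' (hfullint'.const_mul p⁻¹) hmeas ?_
    filter_upwards [ae_restrict_mem measurableSet_Ioi] with x hx
    have h1 : 0 < g x := Real.exp_pos _
    have h2 : 0 ≤ p⁻¹ * (q / x ^ 2 * g x) := by have := mem_Ioi.1 hx; positivity
    rw [Real.norm_of_nonneg h1.le, mul_add, inv_mul_cancel_left₀ hp.ne']
    linarith
  -- The involution `x ↦ q / (p x)` preserves `(p x - q / x)²` and exchanges the two pieces of the
  -- Jacobian.
  have hsub : ∫ x in Ioi (0 : ℝ), g x = ∫ x in Ioi (0 : ℝ), p⁻¹ * (q / x ^ 2 * g x) := by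
    have h := integral_image_eq_integral_abs_deriv_smul measurableSet_Ioi hder2 hinj2 g
    rw [himg2] at h
    rw [h]
    refine setIntegral_congr_fun measurableSet_Ioi fun x hx => ?_
    have hx0 : 0 < x := hx
    simp only [smul_eq_mul, hg, abs_neg, abs_of_pos (show 0 < q / p / x ^ 2 by positivity)]
    have : (p * (q / p / x) - q / (q / p / x)) ^ 2 = (p * x - q / x) ^ 2 := by
      field_simp
      ring
    rw [this]
    field_simp
  have hgint2 : IntegrableOn (fun x => q / x ^ 2 * g x) (Ioi 0) := by
    refine (hfullint'.sub (hgint.const_mul p)).congr_fun (fun x _ => ?_) measurableSet_Ioi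
    simp
  rw [integral_add (hgint.const_mul p) hgint2, integral_const_mul] at hfull
  rw [integral_const_mul] at hsub
  rw [eq_div_iff (by positivity), hfull]
  rw [eq_inv_mul_iff_mul_eq₀ hp.ne'] at hsub
  rw [← hsub]
  ring

/-- Completing the square produces the factor `exp (-2pq)`. The case `q = 0` is kept because the
zero frequency needs it. -/
lemma integral_exp_neg_sq_add_div_sq {p q : ℝ} (hp : 0 < p) (hq : 0 ≤ q) :
    ∫ x in Ioi (0 : ℝ), Real.exp (-(p * x) ^ 2 - q ^ 2 / x ^ 2)
      = Real.sqrt Real.pi / (2 * p) * Real.exp (-(2 * p * q)) := by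
  rcases hq.eq_or_lt with rfl | hq
  · have h := integral_gaussian_Ioi (p ^ 2)
    rw [Real.sqrt_div Real.pi_pos.le, Real.sqrt_sq hp.le] at h
    simp only [mul_pow, ne_eq, OfNat.ofNat_ne_zero, not_false_eq_true, zero_pow, zero_div,
      sub_zero, mul_zero, neg_zero, Real.exp_zero, mul_one]
    simp only [neg_mul] at h
    rw [h]
    field_simp
  · rw [← integral_exp_neg_sq_sub_div hp hq, ← integral_mul_const]
    refine setIntegral_congr_fun measurableSet_Ioi fun x hx => ?_
    have hx0 : x ≠ 0 := (mem_Ioi.1 hx).ne'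
    simp only [← Real.exp_add]
    congr 1
    field_simp
    ring

/-! ### The Poisson kernel of the half-space over the plane -/

/-- The length of the vector `(u, y)` of the half-space. -/
def upperNorm (u : ℝ) (y : Plane) : ℝ := Real.sqrt (u ^ 2 + ‖y‖ ^ 2)

/-- The Poisson kernel at height `u`. -/
def poisson (u : ℝ) (y : Plane) : ℝ := u / (2 * Real.pi) / upperNorm u y ^ 3

/-- Minus the `j`-th partial derivative of the Poisson kernel at height `u`. -/
def poissonGrad (j : Fin 2) (u : ℝ) (y : Plane) : ℝ :=
  3 * u / (2 * Real.pi) * y j / upperNorm u y ^ 5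

section Kernel

variable {u : ℝ}

lemma le_upperNorm (u : ℝ) (y : Plane) : u ≤ upperNorm u y :=
  Real.le_sqrt_of_sq_le (by nlinarith [sq_nonneg ‖y‖])

lemma upperNorm_pos (hu : 0 < u) (y : Plane) : 0 < upperNorm u y := hu.trans_le (le_upperNorm u y)

lemma upperNorm_sq (u : ℝ) (y : Plane) : upperNorm u y ^ 2 = u ^ 2 + ‖y‖ ^ 2 :=
  Real.sq_sqrt (by positivity)

lemma norm_le_upperNorm (u : ℝ) (y : Plane) : ‖y‖ ≤ upperNorm u y :=
  Real.le_sqrt_of_sq_le (by nlinarith [sq_nonneg u])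

lemma abs_apply_le_norm (y : Plane) (j : Fin 2) : |y j| ≤ ‖y‖ := by
  simpa using PiLp.norm_apply_le y j

lemma upperNorm_le_add (u : ℝ) (y z : Plane) : upperNorm u y ≤ upperNorm u z + ‖y - z‖ := by
  have h1 : ‖y‖ ≤ ‖z‖ + ‖y - z‖ := by
    have := norm_add_le z (y - z); simpa using this
  have h2 := norm_le_upperNorm u z
  have h3 := upperNorm_sq u z
  have h4 : 0 ≤ upperNorm u z := Real.sqrt_nonneg _
  refine Real.sqrt_le_iff.2 ⟨by positivity, ?_⟩
  nlinarith [norm_nonneg y, norm_nonneg z, norm_nonneg (y - z)]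

lemma continuous_upperNorm (u : ℝ) : Continuous (upperNorm u) := by
  unfold upperNorm; fun_prop

lemma poisson_pos (hu : 0 < u) (y : Plane) : 0 < poisson u y := by
  have := upperNorm_pos hu y
  have := Real.pi_pos
  unfold poisson; positivity

lemma continuous_poisson (hu : 0 < u) : Continuous (poisson u) := by
  unfold poisson
  exact continuous_const.div ((continuous_upperNorm u).pow 3)
    fun y => (pow_pos (upperNorm_pos hu y) 3).ne'

lemma continuous_poissonGrad (j : Fin 2) (hu : 0 < u) : Continuous (poissonGrad j u) := by
  unfold poissonGrad
  exact (by fun_prop : Continuous fun y : Plane => 3 * u / (2 * Real.pi) * y j).div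
    ((continuous_upperNorm u).pow 5) fun y => (pow_pos (upperNorm_pos hu y) 5).ne'

/-- The quotient by the Poisson kernel is `3 |y_j| / (u² + |y|²)`, and `2 u |y| ≤ u² + |y|²`.
Domination by the kernel itself is what lets one deficit control both velocity and dissipation. -/
lemma abs_poissonGrad_le (j : Fin 2) (hu : 0 < u) (y : Plane) :
    |poissonGrad j u y| ≤ 3 / 2 / u * poisson u y := by
  have hR := upperNorm_pos hu y
  have hpi := Real.pi_pos
  have h1 := abs_apply_le_norm y j
  have h2 : 2 * u * ‖y‖ ≤ upperNorm u y ^ 2 := by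
    rw [upperNorm_sq]; nlinarith [sq_nonneg (u - ‖y‖)]
  rw [poissonGrad, abs_div, abs_mul, abs_of_pos (pow_pos hR 5),
    abs_of_pos (show 0 < 3 * u / (2 * Real.pi) by positivity), poisson]
  have h3 : 3 * u / (2 * Real.pi) * |y j| / upperNorm u y ^ 5
      = (3 / 2 / u * (u / (2 * Real.pi) / upperNorm u y ^ 3))
        * (2 * u * |y j| / upperNorm u y ^ 2) := by
    field_simp
  rw [h3]
  refine mul_le_of_le_one_right (by positivity) ?_
  rw [div_le_one (by positivity)]
  exact (mul_le_mul_of_nonneg_left h1 (by positivity)).trans h2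

/-- `P_u(y) / u` decreases in `u`. -/
lemma poisson_height_le {w : ℝ} (hw : 0 < w) (hwu : w ≤ u) (y : Plane) :
    w / u * poisson u y ≤ poisson w y := by
  have hu : 0 < u := hw.trans_le hwu
  have hpi := Real.pi_pos
  have h1 := upperNorm_pos hw y
  have h2 : upperNorm w y ≤ upperNorm u y :=
    Real.sqrt_le_sqrt (by nlinarith)
  have h3 : w / u * poisson u y = w / (2 * Real.pi) / upperNorm u y ^ 3 := by
    unfold poisson; field_simp
  rw [h3]
  unfold poisson
  gcongr

/-- Since `‖h‖ ≤ u`, the lengths `R`, `S` at `y` and `y - h` satisfy `R ≤ 2 S`, so `R² + R S + S² ≤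
(4 + 2 + 1) S²`. -/
lemma abs_poisson_sub_le (hu : 0 < u) {h : Plane} (hh : ‖h‖ ≤ u) (y : Plane) :
    |poisson u (y - h) - poisson u y| ≤ 7 * ‖h‖ / u * poisson u y := by
  have hR := upperNorm_pos hu y
  have hR' := upperNorm_pos hu (y - h)
  have hpi := Real.pi_pos
  have huR' := le_upperNorm u (y - h)
  have h1 := upperNorm_le_add u y (y - h)
  have h2 := upperNorm_le_add u (y - h) y
  have e1 : ‖y - (y - h)‖ = ‖h‖ := by congr 1; abel
  have e2 : ‖y - h - y‖ = ‖h‖ := by rw [← norm_neg h]; congr 1; abel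
  rw [e1] at h1
  rw [e2] at h2
  set R := upperNorm u y
  set S := upperNorm u (y - h)
  have hRS : R ≤ 2 * S := by linarith
  have h0 := norm_nonneg h
  have habs : |R - S| ≤ ‖h‖ := abs_le.2 ⟨by linarith, by linarith⟩
  have key : |R ^ 3 - S ^ 3| ≤ 7 * ‖h‖ * S ^ 2 := by
    have : R ^ 3 - S ^ 3 = (R - S) * (R ^ 2 + R * S + S ^ 2) := by ring
    rw [this, abs_mul, abs_of_pos (show 0 < R ^ 2 + R * S + S ^ 2 by positivity)]
    have : R ^ 2 + R * S + S ^ 2 ≤ 7 * S ^ 2 := by nlinarith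
    calc |R - S| * (R ^ 2 + R * S + S ^ 2) ≤ ‖h‖ * (7 * S ^ 2) := by gcongr
      _ = _ := by ring
  have e3 : poisson u (y - h) - poisson u y
      = u / (2 * Real.pi) / (R ^ 3 * S ^ 3) * (R ^ 3 - S ^ 3) := by
    simp only [poisson]
    change u / (2 * Real.pi) / S ^ 3 - u / (2 * Real.pi) / R ^ 3 = _
    field_simp
  rw [e3, abs_mul, abs_of_pos (by positivity)]
  calc u / (2 * Real.pi) / (R ^ 3 * S ^ 3) * |R ^ 3 - S ^ 3|
      ≤ u / (2 * Real.pi) / (R ^ 3 * S ^ 3) * (7 * ‖h‖ * S ^ 2) := by gcongr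
    _ = 7 * ‖h‖ / S * (u / (2 * Real.pi) / R ^ 3) := by field_simp
    _ ≤ 7 * ‖h‖ / u * (u / (2 * Real.pi) / R ^ 3) := by gcongr

/-- Again `R ≤ 2 S`: the fifth powers give `31 = 16 + 8 + 4 + 2 + 1`, the shift in the numerator
gives one more, and the kernel carries a factor 3. -/
lemma abs_poissonGrad_sub_le (j : Fin 2) (hu : 0 < u) {h : Plane} (hh : ‖h‖ ≤ u) (y : Plane) :
    |poissonGrad j u (y - h) - poissonGrad j u y| ≤ 96 * ‖h‖ / u ^ 2 * poisson u y := by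
  have hR := upperNorm_pos hu y
  have hR' := upperNorm_pos hu (y - h)
  have hpi := Real.pi_pos
  have huR := le_upperNorm u y
  have huR' := le_upperNorm u (y - h)
  have h1 := upperNorm_le_add u y (y - h)
  have h2 := upperNorm_le_add u (y - h) y
  have e1 : ‖y - (y - h)‖ = ‖h‖ := by congr 1; abel
  have e2 : ‖y - h - y‖ = ‖h‖ := by rw [← norm_neg h]; congr 1; abel
  rw [e1] at h1
  rw [e2] at h2
  have hy' : |(y - h) j| ≤ upperNorm u (y - h) :=
    (abs_apply_le_norm _ j).trans (norm_le_upperNorm _ _)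
  have hhj := abs_apply_le_norm h j
  have e4 : (y - h) j = y j - h j := rfl
  have e3 : poissonGrad j u (y - h) - poissonGrad j u y = 3 * u / (2 * Real.pi) *
      ((y - h) j * ((upperNorm u y ^ 5 - upperNorm u (y - h) ^ 5)
        / (upperNorm u y ^ 5 * upperNorm u (y - h) ^ 5)) - h j / upperNorm u y ^ 5) := by
    simp only [poissonGrad, e4]
    field_simp
    ring
  rw [e3, poisson]
  set R := upperNorm u y
  set S := upperNorm u (y - h)
  have hRS : R ≤ 2 * S := by linarith
  have h0 := norm_nonneg h
  have habs : |R - S| ≤ ‖h‖ := abs_le.2 ⟨by linarith, by linarith⟩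
  have key : |R ^ 5 - S ^ 5| ≤ 31 * ‖h‖ * S ^ 4 := by
    have : R ^ 5 - S ^ 5 = (R - S) * (R ^ 4 + R ^ 3 * S + R ^ 2 * S ^ 2 + R * S ^ 3 + S ^ 4) := by
      ring
    rw [this, abs_mul, abs_of_pos
      (show 0 < R ^ 4 + R ^ 3 * S + R ^ 2 * S ^ 2 + R * S ^ 3 + S ^ 4 by positivity)]
    have : R ^ 4 + R ^ 3 * S + R ^ 2 * S ^ 2 + R * S ^ 3 + S ^ 4 ≤ 31 * S ^ 4 := by
      calc R ^ 4 + R ^ 3 * S + R ^ 2 * S ^ 2 + R * S ^ 3 + S ^ 4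
          ≤ (2 * S) ^ 4 + (2 * S) ^ 3 * S + (2 * S) ^ 2 * S ^ 2 + (2 * S) * S ^ 3 + S ^ 4 := by
            gcongr
        _ = _ := by ring
    calc |R - S| * (R ^ 4 + R ^ 3 * S + R ^ 2 * S ^ 2 + R * S ^ 3 + S ^ 4)
        ≤ ‖h‖ * (31 * S ^ 4) := by gcongr
      _ = _ := by ring
  have h5 : |(y - h) j * ((R ^ 5 - S ^ 5) / (R ^ 5 * S ^ 5)) - h j / R ^ 5|
      ≤ 32 * ‖h‖ / R ^ 5 := by
    refine (abs_sub _ _).trans ?_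
    rw [abs_mul, abs_div, abs_div, abs_of_pos (show 0 < R ^ 5 * S ^ 5 by positivity),
      abs_of_pos (show 0 < R ^ 5 by positivity)]
    calc |(y - h) j| * (|R ^ 5 - S ^ 5| / (R ^ 5 * S ^ 5)) + |h j| / R ^ 5
        ≤ S * (31 * ‖h‖ * S ^ 4 / (R ^ 5 * S ^ 5)) + ‖h‖ / R ^ 5 := by gcongr
      _ = 32 * ‖h‖ / R ^ 5 := by field_simp; ring
  rw [abs_mul, abs_of_pos (show 0 < 3 * u / (2 * Real.pi) by positivity)]
  calc 3 * u / (2 * Real.pi) * |(y - h) j * ((R ^ 5 - S ^ 5) / (R ^ 5 * S ^ 5)) - h j / R ^ 5|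
      ≤ 3 * u / (2 * Real.pi) * (32 * ‖h‖ / R ^ 5) := by gcongr
    _ = 96 * ‖h‖ / R ^ 2 * (u / (2 * Real.pi) / R ^ 3) := by field_simp; ring
    _ ≤ 96 * ‖h‖ / u ^ 2 * (u / (2 * Real.pi) / R ^ 3) := by gcongr

end Kernel

/-! ### Integrals of the Poisson kernel -/

/-- A frequency as a vector of the plane. -/
def freqVec (k : Fin 2 → ℤ) : Plane := WithLp.toLp 2 fun i => (k i : ℝ)

lemma norm_freqVec (k : Fin 2 → ℤ) : ‖freqVec k‖ = freqNorm k := by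
  rw [EuclideanSpace.norm_eq, freqNorm]
  simp [freqVec]

lemma character_eq_exp_inner (k : Fin 2 → ℤ) (x : Plane) :
    character k x = Complex.exp (Complex.I * (inner ℝ (freqVec k) x : ℝ)) := by
  rw [character]
  congr 3
  simp [freqVec, PiLp.inner_apply, mul_comm]

lemma freqNorm_nonneg (k : Fin 2 → ℤ) : 0 ≤ freqNorm k := Real.sqrt_nonneg _

lemma abs_le_freqNorm (k : Fin 2 → ℤ) (j : Fin 2) : |(k j : ℝ)| ≤ freqNorm k := by
  rw [← norm_freqVec]; exact abs_apply_le_norm (freqVec k) j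

lemma freqNorm_le (k : Fin 2 → ℤ) : freqNorm k ≤ 2 * ‖k‖ := by
  have h (i : Fin 2) : (k i : ℝ) ^ 2 ≤ ‖k‖ ^ 2 := by
    have := norm_le_pi_norm k i
    rw [Int.norm_eq_abs] at this
    rw [← sq_abs]
    gcongr
  refine Real.sqrt_le_iff.2 ⟨by positivity, ?_⟩
  rw [Fin.sum_univ_two]
  nlinarith [h 0, h 1, sq_nonneg ‖k‖]

/-- Subordination: as a superposition of Gaussians in `y`, the kernel has a Fourier transform that
reduces to a one-dimensional integral. -/
lemma poisson_eq_integral_gaussian {u : ℝ} (hu : 0 < u) (y : Plane) :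
    poisson u y = ∫ s in Ioi (0 : ℝ), u / (4 * Real.pi * Real.sqrt Real.pi) *
      (s ^ 2 * Real.exp (-(s ^ 2 * (u ^ 2 + ‖y‖ ^ 2) / 4))) := by
  have hR := upperNorm_pos hu y
  have hpi := Real.pi_pos
  have hb : 0 < (upperNorm u y / 2) ^ 2 := by positivity
  have h := integral_rpow_mul_exp_neg_mul_rpow (p := 2) (q := 2) two_pos (by norm_num) hb
  rw [integral_const_mul]
  have e1 : ∫ s in Ioi (0 : ℝ), s ^ 2 * Real.exp (-(s ^ 2 * (u ^ 2 + ‖y‖ ^ 2) / 4))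
      = ∫ x in Ioi (0 : ℝ), x ^ (2 : ℝ) * Real.exp (-(upperNorm u y / 2) ^ 2 * x ^ (2 : ℝ)) := by
    refine setIntegral_congr_fun measurableSet_Ioi fun s _ => ?_
    simp only [Real.rpow_two, div_pow, upperNorm_sq]
    congr 2
    ring
  rw [e1, h]
  have e2 : Real.Gamma ((2 + 1) / 2) = Real.sqrt Real.pi / 2 := by
    have := Real.Gamma_add_one (s := 1 / 2) (by norm_num)
    rw [Real.Gamma_one_half_eq] at this
    rw [show ((2 : ℝ) + 1) / 2 = 1 / 2 + 1 by norm_num, this]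
    ring
  have e3 : ((upperNorm u y / 2) ^ 2) ^ (-(2 + 1) / 2 : ℝ) = ((upperNorm u y / 2) ^ 3)⁻¹ := by
    rw [← Real.rpow_natCast, ← Real.rpow_mul (by positivity), ← Real.rpow_natCast,
      ← Real.rpow_neg (by positivity)]
    norm_num
  rw [e2, e3, poisson]
  have : Real.sqrt Real.pi ≠ 0 := (Real.sqrt_pos.2 hpi).ne'
  field_simp
  norm_num

lemma integral_gaussian_mul_character {s : ℝ} (hs : 0 < s) (k : Fin 2 → ℤ) :
    ∫ y : Plane, (Real.exp (-(s ^ 2 * ‖y‖ ^ 2 / 4)) : ℂ) * character k y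
      = ((4 * Real.pi / s ^ 2 * Real.exp (-(freqNorm k ^ 2 / s ^ 2)) : ℝ) : ℂ) := by
  have hb : 0 < ((s ^ 2 / 4 : ℝ) : ℂ).re := by rw [Complex.ofReal_re]; positivity
  have h := GaussianFourier.integral_cexp_neg_mul_sq_norm_add hb Complex.I (freqVec k)
  have e1 : ∀ y : Plane, (Real.exp (-(s ^ 2 * ‖y‖ ^ 2 / 4)) : ℂ) * character k y
      = Complex.exp (-((s ^ 2 / 4 : ℝ) : ℂ) * ‖y‖ ^ 2 + Complex.I * (inner ℝ (freqVec k) y : ℝ)) :=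
    fun y => by
      rw [character_eq_exp_inner, Complex.ofReal_exp, ← Complex.exp_add]
      congr 2
      push_cast
      ring
  simp only [e1]
  rw [h, norm_freqVec]
  simp only [finrank_euclideanSpace, Fintype.card_fin]
  have hs' : (s : ℂ) ≠ 0 := by exact_mod_cast hs.ne'
  push_cast
  rw [div_self two_ne_zero, Complex.cpow_one]
  congr 1
  · field_simp
  · congr 1
    rw [Complex.I_sq]
    field_simp

lemma integrable_gaussian_plane {s : ℝ} (hs : 0 < s) :
    Integrable fun y : Plane => Real.exp (-(s ^ 2 * ‖y‖ ^ 2 / 4)) := by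
  have hb : 0 < ((s ^ 2 / 4 : ℝ) : ℂ).re := by rw [Complex.ofReal_re]; positivity
  have h := (GaussianFourier.integrable_cexp_neg_mul_sq_norm_add hb 0 (0 : Plane)).norm
  refine h.congr (Filter.Eventually.of_forall fun y => ?_)
  simp only [zero_mul, add_zero, Complex.norm_exp]
  congr 1
  rw [← Complex.ofReal_pow, ← Complex.ofReal_neg, ← Complex.ofReal_mul, Complex.ofReal_re]
  ring

lemma integral_gaussian_plane {s : ℝ} (hs : 0 < s) :
    ∫ y : Plane, Real.exp (-(s ^ 2 * ‖y‖ ^ 2 / 4)) = 4 * Real.pi / s ^ 2 := by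
  have h := integral_gaussian_mul_character hs 0
  have h0 (y : Plane) : character 0 y = 1 := by simp [character]
  simp only [h0, mul_one] at h
  rw [integral_complex_ofReal] at h
  have h1 := Complex.ofReal_injective h
  simpa [freqNorm] using h1

lemma integrable_gaussian_pairs {u : ℝ} (hu : 0 < u) (k : Fin 2 → ℤ) :
    Integrable (Function.uncurry fun (s : ℝ) (y : Plane) =>
      ((u / (4 * Real.pi * Real.sqrt Real.pi) *
      (s ^ 2 * Real.exp (-(s ^ 2 * (u ^ 2 + ‖y‖ ^ 2) / 4))) : ℝ) : ℂ) * character k y)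
      ((volume.restrict (Ioi 0)).prod volume) := by
  have hpi := Real.pi_pos
  have hck := continuous_character k
  have hmeas : Continuous (Function.uncurry fun (s : ℝ) (y : Plane) =>
      ((u / (4 * Real.pi * Real.sqrt Real.pi) *
      (s ^ 2 * Real.exp (-(s ^ 2 * (u ^ 2 + ‖y‖ ^ 2) / 4))) : ℝ) : ℂ) * character k y) := by
    simp only [Function.uncurry_def]
    fun_prop
  rw [integrable_prod_iff hmeas.aestronglyMeasurable]
  have hn (s : ℝ) (y : Plane) : ‖((u / (4 * Real.pi * Real.sqrt Real.pi) *
      (s ^ 2 * Real.exp (-(s ^ 2 * (u ^ 2 + ‖y‖ ^ 2) / 4))) : ℝ) : ℂ) * character k y‖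
      = u / (4 * Real.pi * Real.sqrt Real.pi) * s ^ 2 * Real.exp (-(s ^ 2 * u ^ 2 / 4))
        * Real.exp (-(s ^ 2 * ‖y‖ ^ 2 / 4)) := by
    rw [norm_mul, norm_character, mul_one, Complex.norm_real, Real.norm_of_nonneg (by positivity),
      show -(s ^ 2 * (u ^ 2 + ‖y‖ ^ 2) / 4) = -(s ^ 2 * u ^ 2 / 4) + -(s ^ 2 * ‖y‖ ^ 2 / 4) by ring,
      Real.exp_add]
    ring
  constructor
  · filter_upwards [ae_restrict_mem measurableSet_Ioi] with s hs
    refine Integrable.mono' ((integrable_gaussian_plane hs).const_mul (u / (4 * Real.pi *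
      Real.sqrt Real.pi) * s ^ 2 * Real.exp (-(s ^ 2 * u ^ 2 / 4)))) ?_
      (Filter.Eventually.of_forall fun y => (hn s y).le)
    exact (hmeas.comp (Continuous.prodMk_right s)).aestronglyMeasurable
  · simp only [Function.uncurry_apply_pair, hn, integral_const_mul]
    have h1 : IntegrableOn (fun s : ℝ => u / Real.sqrt Real.pi * Real.exp (-(u ^ 2 / 4) * s ^ 2))
        (Ioi 0) := ((integrable_exp_neg_mul_sq (by positivity)).const_mul _).integrableOn
    refine h1.congr_fun (fun s hs => ?_) measurableSet_Ioi
    have hs0 : 0 < s := hs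
    simp only
    rw [integral_gaussian_plane hs0, show -(u ^ 2 / 4) * s ^ 2 = -(s ^ 2 * u ^ 2 / 4) by ring]
    field_simp

lemma integrable_poisson_mul_character {u : ℝ} (hu : 0 < u) (k : Fin 2 → ℤ) :
    Integrable fun y : Plane => (poisson u y : ℂ) * character k y := by
  refine (integrable_gaussian_pairs hu k).integral_prod_right.congr
    (Filter.Eventually.of_forall fun y => ?_)
  simp only [Function.uncurry_apply_pair]
  rw [integral_mul_const, integral_complex_ofReal, ← poisson_eq_integral_gaussian hu]

lemma integrable_poisson {u : ℝ} (hu : 0 < u) : Integrable (poisson u) := by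
  have h := (integrable_poisson_mul_character hu 0).norm
  refine h.congr (Filter.Eventually.of_forall fun y => ?_)
  simp only
  rw [norm_mul, norm_character, mul_one, Complex.norm_real,
    Real.norm_of_nonneg (poisson_pos hu y).le]

/-- The Fourier transform of the Poisson kernel. -/
lemma integral_poisson_mul_character {u : ℝ} (hu : 0 < u) (k : Fin 2 → ℤ) :
    ∫ y : Plane, (poisson u y : ℂ) * character k y
      = ((Real.exp (-(u * freqNorm k)) : ℝ) : ℂ) := by
  have hpi := Real.pi_pos
  have h1 : ∀ y : Plane, (poisson u y : ℂ) * character k y =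
      ∫ s in Ioi (0 : ℝ), ((u / (4 * Real.pi * Real.sqrt Real.pi) *
        (s ^ 2 * Real.exp (-(s ^ 2 * (u ^ 2 + ‖y‖ ^ 2) / 4))) : ℝ) : ℂ) * character k y := fun y => by
    rw [integral_mul_const, integral_complex_ofReal, ← poisson_eq_integral_gaussian hu]
  simp only [h1]
  rw [← integral_integral_swap (integrable_gaussian_pairs hu k)]
  have h2 : ∀ s ∈ Ioi (0 : ℝ), ∫ y : Plane, ((u / (4 * Real.pi * Real.sqrt Real.pi) *
        (s ^ 2 * Real.exp (-(s ^ 2 * (u ^ 2 + ‖y‖ ^ 2) / 4))) : ℝ) : ℂ) * character k y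
      = ((u / Real.sqrt Real.pi *
        Real.exp (-(u / 2 * s) ^ 2 - freqNorm k ^ 2 / s ^ 2) : ℝ) : ℂ) := fun s hs => by
    have hs0 : 0 < s := hs
    have h3 : ∀ y : Plane, ((u / (4 * Real.pi * Real.sqrt Real.pi) *
        (s ^ 2 * Real.exp (-(s ^ 2 * (u ^ 2 + ‖y‖ ^ 2) / 4))) : ℝ) : ℂ) * character k y
        = ((u / (4 * Real.pi * Real.sqrt Real.pi) * s ^ 2 * Real.exp (-(u / 2 * s) ^ 2) : ℝ) : ℂ)
          * ((Real.exp (-(s ^ 2 * ‖y‖ ^ 2 / 4)) : ℂ) * character k y) := fun y => by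
      rw [show -(s ^ 2 * (u ^ 2 + ‖y‖ ^ 2) / 4) = -(u / 2 * s) ^ 2 + -(s ^ 2 * ‖y‖ ^ 2 / 4) by ring,
        Real.exp_add]
      push_cast
      ring
    simp only [h3]
    rw [integral_const_mul, integral_gaussian_mul_character hs0, ← Complex.ofReal_mul,
      sub_eq_add_neg, Real.exp_add]
    congr 1
    field_simp
  -- The remaining integral is the Cauchy–Schlömilch one with `p = u / 2` and `q = |k|`.
  rw [setIntegral_congr_fun measurableSet_Ioi h2, integral_complex_ofReal, integral_const_mul,
    integral_exp_neg_sq_add_div_sq (by positivity) (freqNorm_nonneg k)]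
  congr 1
  have : Real.sqrt Real.pi ≠ 0 := (Real.sqrt_pos.2 hpi).ne'
  field_simp

lemma integral_poisson {u : ℝ} (hu : 0 < u) : ∫ y : Plane, poisson u y = 1 := by
  have h := integral_poisson_mul_character hu 0
  have h0 (y : Plane) : character 0 y = 1 := by simp [character]
  simp only [h0, mul_one] at h
  rw [integral_complex_ofReal] at h
  have h1 := Complex.ofReal_injective h
  simpa [freqNorm] using h1

lemma integrable_poissonGrad (j : Fin 2) {u : ℝ} (hu : 0 < u) : Integrable (poissonGrad j u) :=
  Integrable.mono' ((integrable_poisson hu).const_mul (3 / 2 / u))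
    (continuous_poissonGrad j hu).aestronglyMeasurable
    (Filter.Eventually.of_forall fun y => abs_poissonGrad_le j hu y)

lemma integrable_mul_character {K : Plane → ℝ} (hK : Integrable K) (k : Fin 2 → ℤ) :
    Integrable fun y => (K y : ℂ) * character k y :=
  hK.ofReal.mul_bdd (c := 1) (continuous_character k).aestronglyMeasurable
    (Filter.Eventually.of_forall fun y => (norm_character k y).le)

lemma hasLineDerivAt_poisson (j : Fin 2) {u : ℝ} (hu : 0 < u) (y : Plane) :
    HasLineDerivAt ℝ (poisson u) (-poissonGrad j u y) y (EuclideanSpace.single j 1) := by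
  have hR := upperNorm_pos hu y
  -- Differentiating through the squared norm, a polynomial in `τ`, avoids a separate case `y = 0`.
  have hn (τ : ℝ) : ‖y + τ • EuclideanSpace.single j (1 : ℝ)‖ ^ 2
      = ‖y‖ ^ 2 + 2 * τ * y j + τ ^ 2 := by
    rw [norm_add_sq_real, real_inner_smul_right, norm_smul]
    have : inner ℝ y (EuclideanSpace.single j (1 : ℝ)) = y j := by
      simp [EuclideanSpace.inner_single_right]
    rw [this]
    simp
    ring
  have h1 : HasDerivAt (fun τ : ℝ => u ^ 2 + ‖y + τ • EuclideanSpace.single j (1 : ℝ)‖ ^ 2)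
      (2 * y j) 0 := by
    simp only [hn]
    have h2 : HasDerivAt (fun τ : ℝ => ‖y‖ ^ 2 + 2 * τ * y j + τ ^ 2)
        (0 + 2 * 1 * y j + 2 * 0 ^ (2 - 1) * 1) 0 := by
      refine HasDerivAt.add (HasDerivAt.add (hasDerivAt_const _ _) ?_) ?_
      · exact ((hasDerivAt_id (0 : ℝ)).const_mul 2).mul_const (y j)
      · simpa using! (hasDerivAt_id (0 : ℝ)).pow 2
    have h3 := h2.const_add (u ^ 2)
    convert! h3 using 1
    simp
  have h0 : u ^ 2 + ‖y + (0 : ℝ) • EuclideanSpace.single j (1 : ℝ)‖ ^ 2 = upperNorm u y ^ 2 := by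
    rw [upperNorm_sq]; simp
  have h4 := h1.sqrt (by rw [h0]; positivity)
  have hs : Real.sqrt (u ^ 2 + ‖y + (0 : ℝ) • EuclideanSpace.single j (1 : ℝ)‖ ^ 2)
      = upperNorm u y := by simp [upperNorm]
  have h5 := ((h4.pow 3).inv (by simp only [Pi.pow_apply]; rw [hs]; positivity)).const_mul
    (u / (2 * Real.pi))
  unfold HasLineDerivAt
  convert! h5 using 1
  simp only [Pi.pow_apply, hs]
  rw [poissonGrad]
  have := Real.pi_pos
  field_simp
  ring

/-- The Fourier transform of the gradient of the Poisson kernel. -/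
lemma integral_poissonGrad_mul_character (j : Fin 2) {u : ℝ} (hu : 0 < u) (k : Fin 2 → ℤ) :
    ∫ y : Plane, (poissonGrad j u y : ℂ) * character k y
      = Complex.I * k j * ((Real.exp (-(u * freqNorm k)) : ℝ) : ℂ) := by
  -- `poissonGrad` is minus the derivative of the kernel, so integration by parts puts the
  -- derivative on the character with a plus sign.
  have h := integral_bilinear_hasLineDerivAt_right_eq_neg_left_of_integrable
    (μ := (volume : Measure Plane)) (f := fun y => (poisson u y : ℂ))
    (f' := fun y => ((-poissonGrad j u y : ℝ) : ℂ)) (g := character k)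
    (g' := fun y => Complex.I * k j * character k y) (v := EuclideanSpace.single j 1)
    (B := ContinuousLinearMap.mul ℝ ℂ)
    (by simpa using! integrable_mul_character (integrable_poissonGrad j hu).neg k)
    (by
      have := (integrable_mul_character (integrable_poisson hu) k).const_mul (Complex.I * k j)
      refine this.congr (Filter.Eventually.of_forall fun y => ?_)
      simp only [ContinuousLinearMap.mul_apply']
      ring)
    (by simpa using! integrable_mul_character (integrable_poisson hu) k)
    (fun y _ => HasDerivAt.ofReal_comp (hasLineDerivAt_poisson j hu y))
    (fun y _ => hasDerivAt_character k j y)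
  simp only [ContinuousLinearMap.mul_apply'] at h
  have e1 : ∫ y : Plane, (poisson u y : ℂ) * (Complex.I * k j * character k y)
      = Complex.I * k j * ∫ y : Plane, (poisson u y : ℂ) * character k y := by
    rw [← integral_const_mul]
    congr 1
    funext y
    ring
  rw [e1, integral_poisson_mul_character hu] at h
  rw [h, ← integral_neg]
  congr 1
  funext y
  push_cast
  ring

/-! ### A moment of the Poisson kernel -/

lemma upperNorm_one_rpow (y : Plane) (r : ℝ) : upperNorm 1 y ^ r = (1 + ‖y‖ ^ 2) ^ (r / 2) := by
  rw [upperNorm, Real.sqrt_eq_rpow, ← Real.rpow_mul (by positivity), one_pow]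
  congr 1
  ring

/-- The moment `∫ P₁(y) (1 + |y|²)^{1/4} dy`. -/
def poissonMoment : ℝ := ∫ y : Plane, poisson 1 y * upperNorm 1 y ^ (1 / 2 : ℝ)

/-- The integrand is a multiple of `(1 + |y|²)^{-5/4}`, and `5/2` exceeds the dimension 2. The order
1/2 is the largest `α` in use, so one moment serves every exponent. -/
lemma integrable_poisson_one_moment :
    Integrable fun y : Plane => poisson 1 y * upperNorm 1 y ^ (1 / 2 : ℝ) := by
  have h := (integrable_rpow_neg_one_add_norm_sq (E := Plane) (μ := volume) (r := 5 / 2)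
    (by simp; norm_num)).const_mul (1 / (2 * Real.pi))
  refine h.congr (Filter.Eventually.of_forall fun y => ?_)
  have hR := upperNorm_pos one_pos y
  simp only
  rw [← upperNorm_one_rpow, poisson, ← Real.rpow_natCast, div_mul_eq_mul_div, div_eq_mul_inv _ (_ ^ _),
    ← Real.rpow_neg hR.le, mul_assoc, ← Real.rpow_add hR]
  norm_num
  ring

lemma upperNorm_smul {u : ℝ} (hu : 0 < u) (y : Plane) :
    upperNorm u y = u * upperNorm 1 (u⁻¹ • y) := by
  rw [upperNorm, upperNorm, norm_smul, Real.norm_of_nonneg (by positivity)]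
  rw [show u ^ 2 + ‖y‖ ^ 2 = u ^ 2 * (1 ^ 2 + (u⁻¹ * ‖y‖) ^ 2) by field_simp,
    Real.sqrt_mul (sq_nonneg u), Real.sqrt_sq hu.le]

lemma poisson_mul_upperNorm_smul {u : ℝ} (hu : 0 < u) (y : Plane) :
    poisson u y * upperNorm u y ^ (1 / 2 : ℝ) = u ^ (1 / 2 : ℝ) * (u ^ 2)⁻¹ *
      (poisson 1 (u⁻¹ • y) * upperNorm 1 (u⁻¹ • y) ^ (1 / 2 : ℝ)) := by
  have hR := upperNorm_pos one_pos (u⁻¹ • y)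
  rw [poisson, poisson, upperNorm_smul hu, Real.mul_rpow hu.le hR.le]
  have := Real.pi_pos
  field_simp

lemma integrable_poisson_moment {u : ℝ} (hu : 0 < u) :
    Integrable fun y : Plane => poisson u y * upperNorm u y ^ (1 / 2 : ℝ) := by
  simp only [poisson_mul_upperNorm_smul hu]
  exact (integrable_poisson_one_moment.comp_smul (inv_ne_zero hu.ne')).const_mul _

lemma integral_poisson_moment {u : ℝ} (hu : 0 < u) :
    ∫ y : Plane, poisson u y * upperNorm u y ^ (1 / 2 : ℝ) = u ^ (1 / 2 : ℝ) * poissonMoment := by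
  simp only [poisson_mul_upperNorm_smul hu]
  rw [integral_const_mul, Measure.integral_comp_smul volume
    (fun y => poisson 1 y * upperNorm 1 y ^ (1 / 2 : ℝ))]
  simp only [finrank_euclideanSpace, Fintype.card_fin, smul_eq_mul]
  rw [abs_of_nonneg (by positivity), poissonMoment]
  field_simp

lemma one_le_poissonMoment : 1 ≤ poissonMoment := by
  refine (integral_poisson one_pos).symm.trans_le ?_
  refine integral_mono (integrable_poisson one_pos) integrable_poisson_one_moment fun y => ?_
  exact le_mul_of_one_le_right (poisson_pos one_pos y).le
    (Real.one_le_rpow (le_upperNorm 1 y) (by norm_num))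

/-- For `ξ ≤ u` and `α ≤ 1/2`, the mean of `(ξ² + |y|²)^{α/2}` is at most a multiple of `u^α`. -/
lemma poisson_mul_rpow_le {u ξ α : ℝ} (hu : 0 < u) (hξ : 0 < ξ) (hξu : ξ ≤ u) (hα : 0 ≤ α)
    (hα2 : α ≤ 1 / 2) (y : Plane) : poisson u y * upperNorm ξ y ^ α
      ≤ u ^ (α - 1 / 2) * (poisson u y * upperNorm u y ^ (1 / 2 : ℝ)) := by
  have hP := poisson_pos hu y
  have h1 : upperNorm ξ y ≤ upperNorm u y := Real.sqrt_le_sqrt (by nlinarith)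
  have h2 := upperNorm_pos hξ y
  have h3 := upperNorm_pos hu y
  -- The exponent `α - 1/2` is nonpositive and `upperNorm u y ≥ u`, so order `α` is traded for order
  -- `1/2` at the correct power of `u`.
  have h4 : upperNorm ξ y ^ α ≤ u ^ (α - 1 / 2) * upperNorm u y ^ (1 / 2 : ℝ) := by
    calc upperNorm ξ y ^ α ≤ upperNorm u y ^ α := Real.rpow_le_rpow h2.le h1 hα
      _ = upperNorm u y ^ (α - 1 / 2) * upperNorm u y ^ (1 / 2 : ℝ) := by
        rw [← Real.rpow_add h3]; ring_nf
      _ ≤ _ := by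
        refine mul_le_mul_of_nonneg_right ?_ (by positivity)
        exact Real.rpow_le_rpow_of_nonpos hu (le_upperNorm u y) (by linarith)
  calc poisson u y * upperNorm ξ y ^ α
      ≤ poisson u y * (u ^ (α - 1 / 2) * upperNorm u y ^ (1 / 2 : ℝ)) := by gcongr
    _ = _ := by ring

lemma integral_poisson_mul_rpow_le {u ξ α : ℝ} (hu : 0 < u) (hξ : 0 < ξ) (hξu : ξ ≤ u)
    (hα : 0 ≤ α) (hα2 : α ≤ 1 / 2) : Integrable (fun y : Plane => poisson u y * upperNorm ξ y ^ α) ∧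
    ∫ y : Plane, poisson u y * upperNorm ξ y ^ α ≤ poissonMoment * u ^ α := by
  have hb := fun y => poisson_mul_rpow_le hu hξ hξu hα hα2 y
  have hint := (integrable_poisson_moment hu).const_mul (u ^ (α - 1 / 2))
  have hi : Integrable (fun y : Plane => poisson u y * upperNorm ξ y ^ α) := by
    refine Integrable.mono' hint ?_ (Filter.Eventually.of_forall fun y => ?_)
    · exact ((continuous_poisson hu).mul ((continuous_upperNorm ξ).rpow_const
        fun y => Or.inr hα)).aestronglyMeasurable
    · rw [Real.norm_of_nonneg]
      · exact hb y
      · have := poisson_pos hu y; have := upperNorm_pos hξ y; positivity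
  refine ⟨hi, (integral_mono hi hint hb).trans_eq ?_⟩
  rw [integral_const_mul, integral_poisson_moment hu, ← mul_assoc, ← Real.rpow_add hu]
  ring_nf

/-! ### The diffusion symbol as a Bernstein function -/

lemma integrableOn_rpow_mul_exp {s x : ℝ} (hs : 0 < s) (hx : 0 < x) :
    IntegrableOn (fun u : ℝ => u ^ (s - 1) * Real.exp (-(x * u))) (Ioi 0) := by
  have h := integrableOn_rpow_mul_exp_neg_mul_rpow (p := 1) (s := s - 1) (b := x) (by linarith)
    one_pos hx
  refine h.congr_fun (fun u _ => ?_) measurableSet_Ioi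
  simp

lemma integral_rpow_mul_exp {s x : ℝ} (hs : 0 < s) (hx : 0 < x) :
    ∫ u in Ioi (0 : ℝ), u ^ (s - 1) * Real.exp (-(x * u)) = x ^ (-s) * Real.Gamma s := by
  rw [Real.integral_rpow_mul_exp_neg_mul_Ioi hs hx, Real.rpow_neg hx.le, one_div,
    Real.inv_rpow hx.le]

lemma lintegral_rpow_mul_exp {s x : ℝ} (hs : 0 < s) (hx : 0 < x) :
    ∫⁻ u in Ioi (0 : ℝ), ENNReal.ofReal (u ^ (s - 1) * Real.exp (-(x * u)))
      = ENNReal.ofReal (x ^ (-s) * Real.Gamma s) := by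
  rw [← integral_rpow_mul_exp hs hx,
    ofReal_integral_eq_lintegral_ofReal (integrableOn_rpow_mul_exp hs hx)]
  filter_upwards [ae_restrict_mem measurableSet_Ioi] with u hu
  have : 0 < u := hu
  positivity

/-- `(κ + r)^{1-s} - κ^{1-s}` is an integral of `x^{-s}` over `[κ, κ + r]`, and each `x^{-s}` is a
Gamma integral; Tonelli exchanges the two. The weight `u^{s-2}` is not integrable at 0, so the two
exponentials cannot be split. -/
lemma lintegral_bernstein_pos {κ r s : ℝ} (hκ : 0 < κ) (hr : 0 ≤ r) (hs : 0 < s) (hs1 : s < 1) :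
    ∫⁻ u in Ioi (0 : ℝ), ENNReal.ofReal ((1 - Real.exp (-(u * r))) *
      (u ^ (s - 2) * Real.exp (-(κ * u))))
      = ENNReal.ofReal (Real.Gamma s * ((κ + r) ^ (1 - s) - κ ^ (1 - s)) / (1 - s)) := by
  have h1 : ∀ u ∈ Ioi (0 : ℝ), ENNReal.ofReal ((1 - Real.exp (-(u * r))) *
      (u ^ (s - 2) * Real.exp (-(κ * u))))
      = ∫⁻ x in Ioc κ (κ + r), ENNReal.ofReal (u ^ (s - 1) * Real.exp (-(x * u))) := fun u hu => by
    have hu0 : 0 < u := hu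
    have hc : Continuous fun x : ℝ => u ^ (s - 1) * Real.exp (-(x * u)) := by fun_prop
    rw [← ofReal_integral_eq_lintegral_ofReal hc.integrableOn_Ioc
      (Filter.Eventually.of_forall fun x => by positivity),
      ← intervalIntegral.integral_of_le (by linarith)]
    congr 1
    have hd : ∀ x ∈ uIcc κ (κ + r), HasDerivAt (fun x => -(u ^ (s - 2) * Real.exp (-(x * u))))
        (u ^ (s - 1) * Real.exp (-(x * u))) x := fun x _ => by
      have h2 := ((((hasDerivAt_id x).mul_const u).neg).exp.const_mul (u ^ (s - 2))).neg
      convert! h2 using 1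
      rw [show s - 1 = s - 2 + 1 by ring, Real.rpow_add hu0, Real.rpow_one]
      simp
      ring
    rw [intervalIntegral.integral_eq_sub_of_hasDerivAt hd (hc.intervalIntegrable _ _),
      show -((κ + r) * u) = -(u * r) + -(κ * u) by ring, Real.exp_add]
    ring
  rw [setLIntegral_congr_fun measurableSet_Ioi h1, lintegral_lintegral_swap]
  · have h3 : ∀ x ∈ Ioc κ (κ + r), ∫⁻ u in Ioi (0 : ℝ),
        ENNReal.ofReal (u ^ (s - 1) * Real.exp (-(x * u)))
        = ENNReal.ofReal (x ^ (-s) * Real.Gamma s) := fun x hx =>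
      lintegral_rpow_mul_exp hs (hκ.trans hx.1)
    rw [setLIntegral_congr_fun measurableSet_Ioc h3]
    have hi : IntervalIntegrable (fun x : ℝ => x ^ (-s)) volume κ (κ + r) :=
      intervalIntegral.intervalIntegrable_rpow' (by linarith)
    rw [← ofReal_integral_eq_lintegral_ofReal
      (((intervalIntegrable_iff_integrableOn_Ioc_of_le (by linarith)).1 hi).mul_const _)]
    · rw [integral_mul_const, ← intervalIntegral.integral_of_le (by linarith),
        integral_rpow (Or.inl (by linarith)), show -s + 1 = 1 - s by ring]
      congr 1
      ring
    · filter_upwards [ae_restrict_mem measurableSet_Ioc] with x hx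
      have : 0 < x := hκ.trans hx.1
      have := Real.Gamma_pos_of_pos hs
      positivity
  · refine Measurable.aemeasurable ?_
    simp only [Function.uncurry_def]
    fun_prop

lemma lintegral_bernstein_neg {κ r s : ℝ} (hκ : 0 < κ) (hr : 0 ≤ r) (hs : 0 < s) :
    ∫⁻ u in Ioi (0 : ℝ), ENNReal.ofReal ((1 - Real.exp (-(u * r))) *
      (u ^ (s - 1) * Real.exp (-(κ * u))))
      = ENNReal.ofReal (Real.Gamma s * (κ ^ (-s) - (κ + r) ^ (-s))) := by
  have h1 := integrableOn_rpow_mul_exp hs hκ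
  have h2 := integrableOn_rpow_mul_exp hs (show 0 < κ + r by linarith)
  have heq : ∀ u : ℝ, (1 - Real.exp (-(u * r))) * (u ^ (s - 1) * Real.exp (-(κ * u)))
      = u ^ (s - 1) * Real.exp (-(κ * u)) - u ^ (s - 1) * Real.exp (-((κ + r) * u)) := fun u => by
    rw [show -((κ + r) * u) = -(u * r) + -(κ * u) by ring, Real.exp_add]
    ring
  rw [← ofReal_integral_eq_lintegral_ofReal]
  · simp only [heq]
    rw [integral_sub h1 h2, integral_rpow_mul_exp hs hκ,
      integral_rpow_mul_exp hs (show 0 < κ + r by linarith)]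
    congr 1
    ring
  · simp only [heq]
    exact h1.sub h2
  · filter_upwards [ae_restrict_mem measurableSet_Ioi] with u hu
    have hu0 : 0 < u := hu
    have : Real.exp (-(u * r)) ≤ 1 := Real.exp_le_one_iff.2 (by nlinarith)
    have : 0 ≤ 1 - Real.exp (-(u * r)) := by linarith
    simp only [Pi.zero_apply]
    positivity

/-! ### The logarithmic symbol as an integral of powers over the exponent. -/

section LogPower

variable {a κ : ℝ}

lemma integrableOn_rpow_mul_rpow_neg (ha : 0 < a) {R : ℝ} (hR : 1 < R) :
    IntegrableOn (fun s : ℝ => s ^ (a - 1) * R ^ (-s)) (Ioi 0) := by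
  refine (integrableOn_rpow_mul_exp ha (Real.log_pos hR)).congr_fun (fun s _ => ?_)
    measurableSet_Ioi
  simp only [Real.rpow_def_of_pos (show 0 < R by linarith)]
  ring_nf

lemma integral_rpow_mul_rpow_neg (ha : 0 < a) {R : ℝ} (hR : 1 < R) :
    ∫ s in Ioi (0 : ℝ), s ^ (a - 1) * R ^ (-s) = Real.log R ^ (-a) * Real.Gamma a := by
  rw [← integral_rpow_mul_exp ha (Real.log_pos hR)]
  refine setIntegral_congr_fun measurableSet_Ioi (fun s _ => ?_)
  simp only [Real.rpow_def_of_pos (show 0 < R by linarith)]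
  ring_nf

lemma measurePreserving_add_one_Ioi :
    MeasurePreserving (fun s : ℝ => s + 1) (volume.restrict (Ioi 0)) (volume.restrict (Ioi 1)) := by
  have h := (measurePreserving_add_right (volume : Measure ℝ) 1).restrict_preimage
    (measurableSet_Ioi (a := (1 : ℝ)))
  convert h using 2
  ext s
  simp

lemma measurableEmbedding_add_one : MeasurableEmbedding (fun s : ℝ => s + 1) :=
  measurableEmbedding_addRight 1

lemma integrableOn_shift_rpow (ha : 0 < a) {R : ℝ} (hR : 1 < R) :
    IntegrableOn (fun s : ℝ => (s + 1) ^ (a - 1) * R ^ (-s)) (Ioi 0) := by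
  have h : IntegrableOn (fun s : ℝ => s ^ (a - 1) * R ^ (1 - s)) (Ioi 1) := by
    refine IntegrableOn.congr_fun (((integrableOn_rpow_mul_rpow_neg ha hR).mono_set
      (Ioi_subset_Ioi zero_le_one)).const_mul R) (fun s _ => ?_) measurableSet_Ioi
    simp only [sub_eq_add_neg, Real.rpow_add (show 0 < R by linarith), Real.rpow_one]
    ring
  have h2 := (measurePreserving_add_one_Ioi.integrable_comp_emb measurableEmbedding_add_one).2 h
  refine h2.congr (Filter.Eventually.of_forall fun s => ?_)
  simp only [Function.comp]
  ring_nf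

/-- Subtracting the contribution of `r = 0`, `Γ(a) R log^{-a} R - κ Γ(a) log^{-a} R` as an integral
of powers of `R`. -/
lemma integral_power_decomposition (ha : 0 < a) {R : ℝ} (hR : 1 < R) (b : ℝ) :
    (R - b) * (Real.log R ^ (-a) * Real.Gamma a)
      = (∫ s in Ioi (0 : ℝ), (Iio 1).indicator (fun s => s ^ (a - 1) * R ^ (1 - s)) s)
        + ∫ s in Ioi (0 : ℝ), ((s + 1) ^ (a - 1) - b * s ^ (a - 1)) * R ^ (-s) := by
  have hR0 : 0 < R := by linarith
  have h0 := integrableOn_rpow_mul_rpow_neg ha hR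
  have h1 := integrableOn_shift_rpow ha hR
  have e1 : ∀ s : ℝ, ((s + 1) ^ (a - 1) - b * s ^ (a - 1)) * R ^ (-s)
      = (s + 1) ^ (a - 1) * R ^ (-s) - b * (s ^ (a - 1) * R ^ (-s)) := fun s => by ring
  simp only [e1]
  rw [integral_sub h1 (h0.const_mul b), integral_const_mul, integral_rpow_mul_rpow_neg ha hR,
    setIntegral_indicator measurableSet_Iio]
  -- The range `s > 1` of the integral for `R log^{-a} R` is shifted down by one, to be combined
  -- with the powers `R^{-s}`.
  have e2 : ∫ s in Ioi (0 : ℝ), (s + 1) ^ (a - 1) * R ^ (-s)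
      = ∫ s in Ioi (1 : ℝ), s ^ (a - 1) * R ^ (1 - s) := by
    rw [← measurePreserving_add_one_Ioi.integral_comp measurableEmbedding_add_one]
    congr 1
    funext s
    ring_nf
  have e3 : Ioi (0 : ℝ) ∩ Iio 1 = Ioo 0 1 := Ioi_inter_Iio
  have h2 : IntegrableOn (fun s : ℝ => s ^ (a - 1) * R ^ (1 - s)) (Ioi 0) := by
    refine IntegrableOn.congr_fun (h0.const_mul R) (fun s _ => ?_) measurableSet_Ioi
    simp only [sub_eq_add_neg, Real.rpow_add hR0, Real.rpow_one]
    ring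
  have e4 : ∫ s in Ioi (0 : ℝ), s ^ (a - 1) * R ^ (1 - s)
      = R * (Real.log R ^ (-a) * Real.Gamma a) := by
    rw [← integral_rpow_mul_rpow_neg ha hR, ← integral_const_mul]
    refine setIntegral_congr_fun measurableSet_Ioi (fun s _ => ?_)
    simp only [sub_eq_add_neg, Real.rpow_add hR0, Real.rpow_one]
    ring
  have e5 := setIntegral_union (s := Ioc (0 : ℝ) 1) (t := Ioi 1) (Ioc_disjoint_Ioi le_rfl)
    measurableSet_Ioi (h2.mono_set Ioc_subset_Ioi_self)
    (h2.mono_set (Ioi_subset_Ioi zero_le_one))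
  rw [Ioc_union_Ioi_eq_Ioi zero_le_one, e4, integral_Ioc_eq_integral_Ioo] at e5
  rw [e2, e3, ← add_sub_assoc, ← e5]
  ring

/-- The density, in the exponent `s`, of the diffusion symbol. -/
def symbolDensity (a κ r s : ℝ) : ℝ :=
  (Iio 1).indicator (fun s => s ^ (a - 1) * ((κ + r) ^ (1 - s) - κ ^ (1 - s))) s
    + (κ * s ^ (a - 1) - (s + 1) ^ (a - 1)) * (κ ^ (-s) - (κ + r) ^ (-s))

/-- `s^{a-1}` is nonincreasing for `a ≤ 1`, and `κ ≥ 1`. This sign makes the Lévy density a positive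
one. -/
lemma weight_nonneg (ha1 : a ≤ 1) (hκ : 1 ≤ κ) {s : ℝ} (hs : 0 < s) :
    0 ≤ κ * s ^ (a - 1) - (s + 1) ^ (a - 1) := by
  have h1 : (s + 1) ^ (a - 1) ≤ s ^ (a - 1) :=
    Real.rpow_le_rpow_of_nonpos hs (by linarith) (by linarith)
  have h2 : 0 ≤ s ^ (a - 1) := by positivity
  nlinarith

lemma symbolDensity_nonneg (ha1 : a ≤ 1) (hκ : 1 ≤ κ) {r s : ℝ} (hr : 0 ≤ r) (hs : 0 < s) :
    0 ≤ symbolDensity a κ r s := by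
  refine add_nonneg (indicator_apply_nonneg fun h1 => ?_)
    (mul_nonneg (weight_nonneg ha1 hκ hs) ?_)
  · have h2 : κ ^ (1 - s) ≤ (κ + r) ^ (1 - s) :=
      Real.rpow_le_rpow (by linarith) (by linarith) (by linarith [mem_Iio.1 h1])
    have : 0 ≤ s ^ (a - 1) := by positivity
    exact mul_nonneg this (by linarith)
  · have : (κ + r) ^ (-s) ≤ κ ^ (-s) :=
      Real.rpow_le_rpow_of_nonpos (by linarith) (by linarith) (by linarith)
    linarith

/-- The decomposition is used at `R = κ + r` and at `R = κ`, both with `b = κ`. Its left side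
vanishes at `R = κ`, so subtracting leaves the symbol, written in differences of powers that vanish
at `r = 0`. -/
lemma integral_symbolDensity (ha : 0 < a) (hκ : 1 < κ) {r : ℝ} (hr : 0 ≤ r) :
    IntegrableOn (symbolDensity a κ r) (Ioi 0) ∧
    ∫ s in Ioi (0 : ℝ), symbolDensity a κ r s
      = Real.Gamma a * (r / Real.log (κ + r) ^ a) := by
  have hR : 1 < κ + r := by linarith
  have hint (R : ℝ) (hR : 1 < R) :
      IntegrableOn ((Iio 1).indicator (fun s => s ^ (a - 1) * R ^ (1 - s))) (Ioi 0) ∧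
      IntegrableOn (fun s => ((s + 1) ^ (a - 1) - κ * s ^ (a - 1)) * R ^ (-s)) (Ioi 0) := by
    constructor
    · refine IntegrableOn.indicator ?_ measurableSet_Iio
      refine IntegrableOn.congr_fun ((integrableOn_rpow_mul_rpow_neg ha hR).const_mul R)
        (fun s _ => ?_) measurableSet_Ioi
      simp only [sub_eq_add_neg, Real.rpow_add (show 0 < R by linarith), Real.rpow_one]
      ring
    · refine ((integrableOn_shift_rpow ha hR).sub
        ((integrableOn_rpow_mul_rpow_neg ha hR).const_mul κ)).congr_fun (fun s _ => ?_)
        measurableSet_Ioi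
      simp only [Pi.sub_apply]
      ring
  have heq : symbolDensity a κ r = fun s =>
      ((Iio 1).indicator (fun s => s ^ (a - 1) * (κ + r) ^ (1 - s)) s
        + ((s + 1) ^ (a - 1) - κ * s ^ (a - 1)) * (κ + r) ^ (-s))
      - ((Iio 1).indicator (fun s => s ^ (a - 1) * κ ^ (1 - s)) s
        + ((s + 1) ^ (a - 1) - κ * s ^ (a - 1)) * κ ^ (-s)) := by
    funext s
    by_cases h : s < 1 <;> simp [symbolDensity, h] <;> ring
  obtain ⟨i1, i2⟩ := hint _ hR
  obtain ⟨i3, i4⟩ := hint _ hκ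
  rw [heq]
  refine ⟨(i1.add i2).sub (i3.add i4), ?_⟩
  refine (integral_sub (i1.add i2) (i3.add i4)).trans ?_
  simp only [Pi.add_apply]
  rw [integral_add i1 i2, integral_add i3 i4, ← integral_power_decomposition ha hR,
    ← integral_power_decomposition ha hκ, Real.rpow_neg (Real.log_pos hR).le]
  ring

end LogPower

/-! ### The Lévy measure of the diffusion symbol. -/

/-- The reciprocal of the Gamma function on the positive half-line, extended by zero. -/
def gammaInv : ℝ → ℝ := (Ioi 0).indicator fun s => (Real.Gamma s)⁻¹

lemma measurable_gammaInv : Measurable gammaInv := by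
  have hc : ContinuousOn (fun s => (Real.Gamma s)⁻¹) (Ioi 0) := by
    refine ContinuousOn.inv₀ (fun s hs => ?_) fun s hs => (Real.Gamma_pos_of_pos hs).ne'
    refine (Real.differentiableAt_Gamma fun m => ?_).continuousAt.continuousWithinAt
    have h1 : 0 < s := hs
    have h2 : (0 : ℝ) ≤ m := m.cast_nonneg
    linarith
  unfold gammaInv
  classical
  rw [← piecewise_eq_indicator]
  exact hc.measurable_piecewise continuousOn_const measurableSet_Ioi

lemma gammaInv_of_pos {s : ℝ} (hs : 0 < s) : gammaInv s = (Real.Gamma s)⁻¹ :=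
  indicator_of_mem (mem_Ioi.2 hs) _

/-- The density in `(s, u)` of the Lévy measure of the diffusion symbol. -/
def levyKernel (a κ s u : ℝ) : ℝ :=
  (Real.Gamma a)⁻¹ * (((Iio 1).indicator (fun s => s ^ (a - 1) * (1 - s)) s * u ^ (s - 2)
    + (κ * s ^ (a - 1) - (s + 1) ^ (a - 1)) * u ^ (s - 1)) * gammaInv s) * Real.exp (-(κ * u))

lemma measurable_levyKernel (a κ : ℝ) : Measurable (Function.uncurry (levyKernel a κ)) := by
  have h1 : Measurable ((Iio (1 : ℝ)).indicator fun s : ℝ => s ^ (a - 1) * (1 - s)) :=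
    Measurable.indicator (by fun_prop) measurableSet_Iio
  have h2 := measurable_gammaInv
  simp only [Function.uncurry_def, levyKernel]
  fun_prop

/-- The Lévy measure of the diffusion symbol with respect to the Poisson semigroup. -/
def levyMeasure (a κ : ℝ) : Measure ℝ :=
  (volume.restrict (Ioi 0)).withDensity
    fun u => ∫⁻ s in Ioi (0 : ℝ), ENNReal.ofReal (levyKernel a κ s u)

lemma measurable_levyDensity (a κ : ℝ) :
    Measurable fun u => ∫⁻ s in Ioi (0 : ℝ), ENNReal.ofReal (levyKernel a κ s u) :=
  (measurable_levyKernel a κ).ennreal_ofReal.lintegral_prod_left'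

lemma ae_levyMeasure (a κ : ℝ) : ∀ᵐ u ∂levyMeasure a κ, 0 < u :=
  (withDensity_absolutelyContinuous _ _).ae_le (ae_restrict_mem measurableSet_Ioi)

lemma lintegral_levyMeasure (a κ : ℝ) {F : ℝ → ℝ} (hF : Measurable F) (hF0 : ∀ u, 0 < u → 0 ≤ F u) :
    ∫⁻ u, ENNReal.ofReal (F u) ∂levyMeasure a κ
      = ∫⁻ s in Ioi (0 : ℝ), ∫⁻ u in Ioi (0 : ℝ), ENNReal.ofReal (F u * levyKernel a κ s u) := by
  rw [levyMeasure, lintegral_withDensity_eq_lintegral_mul _ (measurable_levyDensity a κ)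
    hF.ennreal_ofReal]
  have h1 : ∀ u ∈ Ioi (0 : ℝ), ((fun u => ∫⁻ s in Ioi (0 : ℝ), ENNReal.ofReal (levyKernel a κ s u)) *
      fun u => ENNReal.ofReal (F u)) u
      = ∫⁻ s in Ioi (0 : ℝ), ENNReal.ofReal (F u * levyKernel a κ s u) := fun u hu => by
    simp only [Pi.mul_apply]
    rw [mul_comm, ← lintegral_const_mul]
    · simp only [ENNReal.ofReal_mul (hF0 u hu)]
    · exact ((measurable_levyKernel a κ).comp
        (measurable_id.prodMk measurable_const)).ennreal_ofReal
  rw [setLIntegral_congr_fun measurableSet_Ioi h1, lintegral_lintegral_swap]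
  refine (Measurable.ennreal_ofReal ?_).aemeasurable
  have h2 : Measurable fun p : ℝ × ℝ => levyKernel a κ p.2 p.1 :=
    (measurable_levyKernel a κ).comp measurable_swap
  fun_prop

section LevyKernel

variable {a κ : ℝ}

/-- The Lévy–Khintchine representation of the diffusion symbol. -/
lemma lintegral_one_sub_exp_levyMeasure (ha : 0 < a) (ha1 : a ≤ 1) (hκ : 1 < κ) {r : ℝ}
    (hr : 0 ≤ r) : ∫⁻ u, ENNReal.ofReal (1 - Real.exp (-(u * r))) ∂levyMeasure a κ
      = ENNReal.ofReal (r / Real.log (κ + r) ^ a) := by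
  have hκ0 : 0 < κ := by linarith
  have hΓ := Real.Gamma_pos_of_pos ha
  have hnn : ∀ u : ℝ, 0 < u → 0 ≤ 1 - Real.exp (-(u * r)) := fun u hu => by
    have : Real.exp (-(u * r)) ≤ 1 := Real.exp_le_one_iff.2 (by nlinarith)
    linarith
  rw [lintegral_levyMeasure a κ (by fun_prop) hnn]
  have key : ∀ s ∈ Ioi (0 : ℝ), s ≠ 1 → ∫⁻ u in Ioi (0 : ℝ),
      ENNReal.ofReal ((1 - Real.exp (-(u * r))) * levyKernel a κ s u)
      = ENNReal.ofReal ((Real.Gamma a)⁻¹ * symbolDensity a κ r s) := fun s hs hs1 => by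
    have hs0 : 0 < s := hs
    have hΓs := Real.Gamma_pos_of_pos hs0
    have hw := weight_nonneg ha1 hκ.le hs0
    set B := (Real.Gamma a)⁻¹ * (Real.Gamma s)⁻¹ * (κ * s ^ (a - 1) - (s + 1) ^ (a - 1)) with hB
    have hB0 : 0 ≤ B := by positivity
    have hn := lintegral_bernstein_neg hκ0 hr hs0
    have hmB : Measurable fun u : ℝ => ENNReal.ofReal ((1 - Real.exp (-(u * r))) *
        (u ^ (s - 1) * Real.exp (-(κ * u)))) := by fun_prop
    by_cases h1 : s < 1
    · set A := (Real.Gamma a)⁻¹ * (Real.Gamma s)⁻¹ * (s ^ (a - 1) * (1 - s)) with hA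
      have hs1' : 0 < 1 - s := by linarith
      have hA0 : 0 ≤ A := by positivity
      have hp := lintegral_bernstein_pos hκ0 hr hs0 h1
      have hmA : Measurable fun u : ℝ => ENNReal.ofReal ((1 - Real.exp (-(u * r))) *
        (u ^ (s - 2) * Real.exp (-(κ * u)))) := by fun_prop
      have e1 : ∀ u ∈ Ioi (0 : ℝ),
          ENNReal.ofReal ((1 - Real.exp (-(u * r))) * levyKernel a κ s u)
          = ENNReal.ofReal A * ENNReal.ofReal ((1 - Real.exp (-(u * r))) *
              (u ^ (s - 2) * Real.exp (-(κ * u))))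
            + ENNReal.ofReal B * ENNReal.ofReal ((1 - Real.exp (-(u * r))) *
              (u ^ (s - 1) * Real.exp (-(κ * u)))) := fun u hu => by
        have hu0 : 0 < u := hu
        have h2 := hnn u hu
        rw [← ENNReal.ofReal_mul hA0, ← ENNReal.ofReal_mul hB0,
          ← ENNReal.ofReal_add (by positivity) (by positivity)]
        congr 1
        rw [levyKernel, gammaInv_of_pos hs0, indicator_of_mem (mem_Iio.2 h1), hA, hB]
        ring
      have h3 : 0 ≤ (κ + r) ^ (1 - s) - κ ^ (1 - s) := by
        have : κ ^ (1 - s) ≤ (κ + r) ^ (1 - s) :=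
          Real.rpow_le_rpow (by linarith) (by linarith) (by linarith)
        linarith
      have h4 : 0 ≤ κ ^ (-s) - (κ + r) ^ (-s) := by
        have : (κ + r) ^ (-s) ≤ κ ^ (-s) :=
          Real.rpow_le_rpow_of_nonpos (by linarith) (by linarith) (by linarith)
        linarith
      rw [setLIntegral_congr_fun measurableSet_Ioi e1,
        lintegral_add_left (hmA.const_mul _), lintegral_const_mul _ hmA, lintegral_const_mul _ hmB,
        hp, hn, ← ENNReal.ofReal_mul hA0, ← ENNReal.ofReal_mul hB0,
        ← ENNReal.ofReal_add (by positivity) (by positivity)]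
      congr 1
      rw [symbolDensity, indicator_of_mem (mem_Iio.2 h1), hA, hB]
      field_simp
    · have h1' : s ∉ Iio (1 : ℝ) := h1
      have e1 : ∀ u ∈ Ioi (0 : ℝ),
          ENNReal.ofReal ((1 - Real.exp (-(u * r))) * levyKernel a κ s u)
          = ENNReal.ofReal B * ENNReal.ofReal ((1 - Real.exp (-(u * r))) *
              (u ^ (s - 1) * Real.exp (-(κ * u)))) := fun u hu => by
        rw [← ENNReal.ofReal_mul hB0]
        congr 1
        rw [levyKernel, gammaInv_of_pos hs0, indicator_of_notMem h1', hB]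
        ring
      rw [setLIntegral_congr_fun measurableSet_Ioi e1, lintegral_const_mul _ hmB, hn,
        ← ENNReal.ofReal_mul hB0]
      congr 1
      rw [symbolDensity, indicator_of_notMem h1', hB]
      field_simp
      ring
  obtain ⟨hi, he⟩ := integral_symbolDensity ha hκ hr
  have hae : ∀ᵐ s ∂(volume.restrict (Ioi (0 : ℝ))), ∫⁻ u in Ioi (0 : ℝ),
      ENNReal.ofReal ((1 - Real.exp (-(u * r))) * levyKernel a κ s u)
      = ENNReal.ofReal ((Real.Gamma a)⁻¹ * symbolDensity a κ r s) := by
    filter_upwards [ae_restrict_mem measurableSet_Ioi,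
      ae_restrict_of_ae (Measure.ae_ne volume (1 : ℝ))] with s hs hs1
    exact key s hs hs1
  rw [lintegral_congr_ae hae, ← ofReal_integral_eq_lintegral_ofReal (hi.const_mul _)]
  · rw [integral_const_mul, he, inv_mul_cancel_left₀ hΓ.ne']
  · filter_upwards [ae_restrict_mem measurableSet_Ioi] with s hs
    have := symbolDensity_nonneg ha1 hκ.le hr (mem_Ioi.1 hs)
    simp only [Pi.zero_apply]
    positivity

/-- Convexity between `Γ(1) = Γ(2) = 1`. -/
lemma Gamma_add_one_le_one {s : ℝ} (hs : 0 ≤ s) (hs1 : s ≤ 1) : Real.Gamma (s + 1) ≤ 1 := by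
  have h := Real.convexOn_Gamma.2 (show (1 : ℝ) ∈ Ioi 0 by simp) (show (2 : ℝ) ∈ Ioi 0 by simp)
    (show 0 ≤ 1 - s by linarith) hs (by ring)
  simp only [smul_eq_mul, Real.Gamma_one, Real.Gamma_two] at h
  rw [show (1 - s) * 1 + s * 2 = s + 1 by ring] at h
  linarith

lemma lintegral_rpow_Ioc {s u : ℝ} (hs : 0 < s) (hu : 0 < u) :
    ∫⁻ w in Ioc 0 u, ENNReal.ofReal (w ^ (s - 1)) = ENNReal.ofReal (u ^ s / s) := by
  have hi : IntervalIntegrable (fun x : ℝ => x ^ (s - 1)) volume 0 u :=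
    intervalIntegral.intervalIntegrable_rpow' (by linarith)
  rw [← ofReal_integral_eq_lintegral_ofReal
    ((intervalIntegrable_iff_integrableOn_Ioc_of_le hu.le).1 hi),
    ← intervalIntegral.integral_of_le hu.le, integral_rpow (Or.inl (by linarith))]
  · rw [sub_add_cancel, Real.zero_rpow hs.ne', sub_zero]
  · filter_upwards [ae_restrict_mem measurableSet_Ioc] with w hw
    have : 0 < w := hw.1
    positivity

/-- The first moment of the Lévy measure near zero is bounded below by a negative power of the
logarithm. -/
lemma levyMeasure_moment_lower (ha : 0 < a) (ha1 : a ≤ 1) (hκ : Real.exp 1 ≤ κ) {u : ℝ}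
    (hu : 0 < u) :
    ENNReal.ofReal ((Real.Gamma a)⁻¹ / (8 * a) * Real.exp (-(κ * u)) *
      Real.log (κ + u⁻¹) ^ (-a)) ≤ ∫⁻ w, ENNReal.ofReal ((Ioc 0 u).indicator id w)
        ∂levyMeasure a κ := by
  have hκ1 : 1 < κ := lt_of_lt_of_le (by simp) hκ
  have hΓ := Real.Gamma_pos_of_pos ha
  have hl : 1 ≤ Real.log (κ + u⁻¹) := by
    rw [Real.le_log_iff_exp_le (by positivity)]
    have : 0 < u⁻¹ := by positivity
    linarith
  set l := Real.log (κ + u⁻¹) with hldef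
  have hl0 : 0 < l := by linarith
  have hul : Real.exp (-l) ≤ u := by
    rw [hldef, Real.exp_neg, Real.exp_log (by positivity)]
    exact inv_le_of_inv_le₀ hu (by linarith)
  rw [lintegral_levyMeasure a κ (Measurable.indicator measurable_id measurableSet_Ioc)
    fun w hw => indicator_nonneg (fun x hx => hx.1.le) w]
  -- Only exponents `s ≤ 1/(2l)` are kept: there `u ≥ e^{-l}` forces `u^s ≥ e^{-1/2}`, and the
  -- integral of `s^{a-1}` over this range is of order `l^{-a}`.
  have hsub : Ioc 0 (1 / (2 * l)) ⊆ Ioi (0 : ℝ) := Ioc_subset_Ioi_self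
  have hsl : 1 / (2 * l) ≤ 1 / 2 := by
    rw [div_le_div_iff₀ (by positivity) (by norm_num)]; linarith
  refine le_trans ?_ (lintegral_mono_set hsub)
  have hlow : ∀ s ∈ Ioc 0 (1 / (2 * l)),
      ENNReal.ofReal ((Real.Gamma a)⁻¹ / 4 * Real.exp (-(κ * u)) * s ^ (a - 1))
      ≤ ∫⁻ w in Ioi (0 : ℝ), ENNReal.ofReal ((Ioc 0 u).indicator id w * levyKernel a κ s w) := by
    intro s hs
    have hs0 : 0 < s := hs.1
    have hs12 : s ≤ 1 / 2 := hs.2.trans hsl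
    have hΓs := Real.Gamma_pos_of_pos hs0
    have hw := weight_nonneg ha1 hκ1.le hs0
    set E := (Real.Gamma a)⁻¹ * (s ^ (a - 1) * (1 - s)) * (Real.Gamma s)⁻¹ * Real.exp (-(κ * u))
      with hE
    have hs1 : 0 < 1 - s := by linarith
    have hE0 : 0 ≤ E := by positivity
    have step : ENNReal.ofReal E * ∫⁻ w in Ioc 0 u, ENNReal.ofReal (w ^ (s - 1))
        ≤ ∫⁻ w in Ioi (0 : ℝ), ENNReal.ofReal ((Ioc 0 u).indicator id w * levyKernel a κ s w) := by
      rw [← lintegral_const_mul _ (by fun_prop)]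
      refine le_trans ?_ (lintegral_mono_set fun w (hw' : w ∈ Ioc 0 u) => hw'.1)
      refine setLIntegral_mono' measurableSet_Ioc fun w hw' => ?_
      have hw0 : 0 < w := hw'.1
      rw [← ENNReal.ofReal_mul hE0, indicator_of_mem hw', id]
      refine ENNReal.ofReal_le_ofReal ?_
      rw [levyKernel, gammaInv_of_pos hs0,
        indicator_of_mem (show s ∈ Iio (1 : ℝ) by simp; linarith)]
      have e1 : w ^ (s - 1) = w * w ^ (s - 2) := by
        rw [show s - 1 = 1 + (s - 2) by ring, Real.rpow_add hw0, Real.rpow_one]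
      have e2 : Real.exp (-(κ * u)) ≤ Real.exp (-(κ * w)) :=
        Real.exp_le_exp.2 (by nlinarith [hw'.2])
      calc E * w ^ (s - 1) = w * ((Real.Gamma a)⁻¹ * ((s ^ (a - 1) * (1 - s) * w ^ (s - 2))
            * (Real.Gamma s)⁻¹) * Real.exp (-(κ * u))) := by rw [e1, hE]; ring
        _ ≤ w * ((Real.Gamma a)⁻¹ * ((s ^ (a - 1) * (1 - s) * w ^ (s - 2)
            + (κ * s ^ (a - 1) - (s + 1) ^ (a - 1)) * w ^ (s - 1))
            * (Real.Gamma s)⁻¹) * Real.exp (-(κ * w))) := by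
          gcongr
          exact le_add_of_nonneg_right (by positivity)
    refine le_trans ?_ step
    rw [lintegral_rpow_Ioc hs0 hu, ← ENNReal.ofReal_mul hE0]
    refine ENNReal.ofReal_le_ofReal ?_
    -- The factor `1/s` from integrating `w^{s-1}` compensates `1/Γ(s)`, which vanishes like `s` at
    -- 0.
    have hG : s * Real.Gamma s ≤ 1 := by
      rw [← Real.Gamma_add_one hs0.ne']
      exact Gamma_add_one_le_one hs0.le (by linarith)
    have hus : 1 / 2 ≤ u ^ s := by
      have h1 : Real.exp (-(1 / 2)) ≤ u ^ s := by
        refine le_trans ?_ (Real.rpow_le_rpow (Real.exp_pos _).le hul hs0.le)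
        rw [← Real.exp_mul]
        refine Real.exp_le_exp.2 ?_
        have := hs.2
        rw [le_div_iff₀ (by positivity)] at this
        nlinarith
      have h2 := Real.add_one_le_exp (-(1 / 2 : ℝ))
      linarith
    have hinv : 1 ≤ (s * Real.Gamma s)⁻¹ := (one_le_inv₀ (by positivity)).2 hG
    calc (Real.Gamma a)⁻¹ / 4 * Real.exp (-(κ * u)) * s ^ (a - 1)
        = (Real.Gamma a)⁻¹ * (s ^ (a - 1) * (1 / 2)) * 1 * Real.exp (-(κ * u)) * (1 / 2) := by ring
      _ ≤ (Real.Gamma a)⁻¹ * (s ^ (a - 1) * (1 - s)) * (s * Real.Gamma s)⁻¹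
          * Real.exp (-(κ * u)) * u ^ s := by gcongr; linarith
      _ = E * (u ^ s / s) := by rw [hE]; field_simp
  refine le_trans ?_ (setLIntegral_mono' measurableSet_Ioc hlow)
  have hC : 0 ≤ (Real.Gamma a)⁻¹ / 4 * Real.exp (-(κ * u)) := by positivity
  simp only [ENNReal.ofReal_mul hC]
  rw [lintegral_const_mul _ (by fun_prop), lintegral_rpow_Ioc ha (by positivity),
    ← ENNReal.ofReal_mul hC]
  refine ENNReal.ofReal_le_ofReal ?_
  have h2a : (1 / 2 : ℝ) ≤ (1 / 2) ^ a := by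
    have := Real.rpow_le_rpow_of_exponent_ge (show (0 : ℝ) < 1 / 2 by norm_num) (by norm_num) ha1
    rwa [Real.rpow_one] at this
  have h3 : (1 / (2 * l)) ^ a = (1 / 2) ^ a * l ^ (-a) := by
    rw [Real.rpow_neg hl0.le, ← Real.inv_rpow hl0.le, ← Real.mul_rpow (by norm_num) (by positivity)]
    congr 1
    field_simp
  rw [h3]
  calc (Real.Gamma a)⁻¹ / (8 * a) * Real.exp (-(κ * u)) * l ^ (-a)
      = (Real.Gamma a)⁻¹ / 4 * Real.exp (-(κ * u)) * ((1 / 2) * l ^ (-a) / a) := by field_simp; norm_num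
    _ ≤ _ := by gcongr

end LevyKernel

end LogSQG

end

noncomputable section

namespace LogSQG

open MeasureTheory Set Filter
open scoped Pointwise Topology

/-! ### Multipliers as averages of Poisson integrals -/

/-- `U` is known only as a pointwise sum, so its integrability comes from `‖U‖ ≤ ∑ ‖F i‖` and
Tonelli. -/
lemma integrable_and_hasSum_integral {ι α : Type*} [Countable ι] [MeasurableSpace α] {μ : Measure α}
    {F : ι → α → ℂ} {U : α → ℂ} (hF : ∀ i, Integrable (F i) μ)
    (hs : Summable fun i => ∫ a, ‖F i a‖ ∂μ) (hU : ∀ᵐ a ∂μ, HasSum (fun i => F i a) (U a)) :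
    Integrable U μ ∧ HasSum (fun i => ∫ a, F i a ∂μ) (∫ a, U a ∂μ) := by
  constructor
  · refine ⟨?_, ?_⟩
    · refine aestronglyMeasurable_of_tendsto_ae (atTop : Filter (Finset ι))
        (f := fun s a => ∑ i ∈ s, F i a) (fun s => ?_) (hU.mono fun a ha => ha)
      exact Finset.aestronglyMeasurable_fun_sum s fun i _ => (hF i).1
    · have h1 : ∫⁻ a, ‖U a‖ₑ ∂μ ≤ ∫⁻ a, ∑' i, ‖F i a‖ₑ ∂μ := by
        refine lintegral_mono_ae (hU.mono fun a ha => ?_)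
        have ht : Tendsto (fun s : Finset ι => ‖∑ i ∈ s, F i a‖ₑ) atTop (𝓝 ‖U a‖ₑ) :=
          (continuous_enorm.tendsto _).comp ha
        refine le_of_tendsto ht (Eventually.of_forall fun s => ?_)
        exact (enorm_sum_le _ _).trans (ENNReal.sum_le_tsum s)
      refine lt_of_le_of_lt h1 ?_
      rw [lintegral_tsum fun i => (hF i).1.enorm]
      have h2 (i : ι) : ∫⁻ a, ‖F i a‖ₑ ∂μ = ENNReal.ofReal (∫ a, ‖F i a‖ ∂μ) :=
        (ofReal_integral_norm_eq_lintegral_enorm (hF i)).symm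
      simp only [h2]
      rw [← ENNReal.ofReal_tsum_of_nonneg (fun i => integral_nonneg fun a => norm_nonneg _) hs]
      exact ENNReal.ofReal_lt_top
  · have h := hasSum_integral_of_summable_integral_norm hF hs
    rwa [integral_congr_ae (hU.mono fun a ha => ha.tsum_eq)] at h

/-- Convolution of a periodic function with an integrable kernel, as a Fourier series. -/
lemma hasSum_convolution {g : Plane → ℝ} (hp : IsPeriodic g) (hs : ContDiff ℝ (⊤ : ℕ∞) g)
    {K : Plane → ℝ} (hK : Integrable K) (x : Plane) :
    HasSum (fun k => (∫ y, (K y : ℂ) * character k y) * (torusFourierCoeff g k * character k x))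
      ((∫ y, K y * g (x + y) : ℝ) : ℂ) := by
  have hF (k : Fin 2 → ℤ) : Integrable fun y : Plane =>
      (K y : ℂ) * character k y * (torusFourierCoeff g k * character k x) :=
    (integrable_mul_character hK k).mul_const _
  have hn (k : Fin 2 → ℤ) : ∫ y : Plane,
      ‖(K y : ℂ) * character k y * (torusFourierCoeff g k * character k x)‖
      = (∫ y : Plane, ‖K y‖) * ‖torusFourierCoeff g k‖ := by
    rw [← integral_mul_const]
    simp [norm_character]
  have h := (integrable_and_hasSum_integral (U := fun y => ((K y * g (x + y) : ℝ) : ℂ)) hF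
    (by simpa only [hn] using (summable_norm_coeff hp hs).mul_left _)
    (Eventually.of_forall fun y => ?_)).2
  · rw [integral_complex_ofReal] at h
    simpa only [integral_mul_const] using h
  · have h1 := (hasSum_fourier hp hs (x + y)).mul_left (K y : ℂ)
    rw [← Complex.ofReal_mul] at h1
    refine h1.congr_fun fun k => ?_
    rw [character_add]
    ring

/-- The Poisson integral of `g` at height `u`. -/
def poissonInt (g : Plane → ℝ) (u : ℝ) (x : Plane) : ℝ := ∫ y, poisson u y * g (x + y)

/-- The `j`-th partial derivative of the Poisson integral of `g` at height `u`. -/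
def poissonIntDeriv (j : Fin 2) (g : Plane → ℝ) (u : ℝ) (x : Plane) : ℝ :=
  ∫ y, poissonGrad j u y * g (x + y)

/-- When a symbol is an average of simpler symbols, the operator is the same average of the simpler
operators. Both nonlocal operators of the equation are reduced to the Poisson semigroup this way. -/
lemma multiplier_eq_integral {g : Plane → ℝ} {μ : Measure ℝ} {σ : (Fin 2 → ℤ) → ℝ → ℂ} {U : ℝ → ℝ} {x : Plane}
    (hσ : ∀ k, Integrable (σ k) μ)
    (hsum : Summable fun k => (∫ u, ‖σ k u‖ ∂μ) * ‖torusFourierCoeff g k‖)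
    (hU : ∀ᵐ u ∂μ, HasSum (fun k => σ k u * (torusFourierCoeff g k * character k x)) (U u : ℂ)) :
    Integrable U μ ∧ multiplier (fun k => ∫ u, σ k u ∂μ) g x = ∫ u, U u ∂μ := by
  have h := integrable_and_hasSum_integral
    (F := fun k u => σ k u * (torusFourierCoeff g k * character k x))
    (fun k => (hσ k).mul_const _) (by
      convert hsum using 2 with k
      rw [← integral_mul_const]
      simp [norm_character]) hU
  refine ⟨by simpa using! h.1.re, ?_⟩
  have h2 := h.2
  simp only [integral_mul_const] at h2
  rw [multiplier]
  simp only [mul_assoc]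
  rw [h2.tsum_eq, integral_complex_ofReal, Complex.ofReal_re]

lemma hasSum_poissonInt {g : Plane → ℝ} (hp : IsPeriodic g) (hs : ContDiff ℝ (⊤ : ℕ∞) g) {u : ℝ} (hu : 0 < u) (x : Plane) :
    HasSum (fun k => ((1 - Real.exp (-(u * freqNorm k)) : ℝ) : ℂ)
      * (torusFourierCoeff g k * character k x)) ((g x - poissonInt g u x : ℝ) : ℂ) := by
  have h := (hasSum_fourier hp hs x).sub (hasSum_convolution hp hs (integrable_poisson hu) x)
  rw [← Complex.ofReal_sub] at h
  refine h.congr_fun fun k => ?_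
  rw [integral_poisson_mul_character hu]
  push_cast
  ring

lemma one_le_log_add {κ r : ℝ} (hκ : Real.exp 1 ≤ κ) (hr : 0 ≤ r) : 1 ≤ Real.log (κ + r) := by
  have := Real.exp_pos 1
  rw [Real.le_log_iff_exp_le (by linarith)]
  linarith

lemma integral_one_sub_exp_levyMeasure {a κ : ℝ} (ha : 0 < a) (ha1 : a ≤ 1) (hκ : 1 < κ) {r : ℝ}
    (hr : 0 ≤ r) : Integrable (fun u => 1 - Real.exp (-(u * r))) (levyMeasure a κ) ∧
    ∫ u, (1 - Real.exp (-(u * r))) ∂levyMeasure a κ = r / Real.log (κ + r) ^ a := by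
  have hnn : ∀ᵐ u ∂levyMeasure a κ, 0 ≤ 1 - Real.exp (-(u * r)) := by
    filter_upwards [ae_levyMeasure a κ] with u hu
    have : Real.exp (-(u * r)) ≤ 1 := Real.exp_le_one_iff.2 (by nlinarith)
    linarith
  have hl := lintegral_one_sub_exp_levyMeasure ha ha1 hκ hr
  have hm : AEStronglyMeasurable (fun u => 1 - Real.exp (-(u * r))) (levyMeasure a κ) :=
    (by fun_prop : Continuous fun u => 1 - Real.exp (-(u * r))).aestronglyMeasurable
  have hpos : 0 ≤ r / Real.log (κ + r) ^ a :=
    div_nonneg hr (Real.rpow_nonneg (Real.log_nonneg (by linarith)) _)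
  refine ⟨⟨hm, ?_⟩, ?_⟩
  · rw [hasFiniteIntegral_iff_ofReal hnn, hl]
    exact ENNReal.ofReal_lt_top
  · rw [integral_eq_lintegral_of_nonneg_ae hnn hm, hl, ENNReal.toReal_ofReal hpos]

/-- The diffusion operator is an average of differences with Poisson integrals. -/
lemma diffusion_eq_integral {a κ : ℝ} (ha : 0 < a) (ha1 : a ≤ 1) (hκ : Real.exp 1 ≤ κ)
    {g : Plane → ℝ} (hp : IsPeriodic g) (hs : ContDiff ℝ (⊤ : ℕ∞) g) (x : Plane) :
    Integrable (fun u => g x - poissonInt g u x) (levyMeasure a κ) ∧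
    diffusion a κ g x = ∫ u, (g x - poissonInt g u x) ∂levyMeasure a κ := by
  have hκ1 : 1 < κ := lt_of_lt_of_le (by simp) hκ
  have hm (k : Fin 2 → ℤ) := integral_one_sub_exp_levyMeasure ha ha1 hκ1 (freqNorm_nonneg k)
  have hnorm (k : Fin 2 → ℤ) :
      ∫ u, ‖((1 - Real.exp (-(u * freqNorm k)) : ℝ) : ℂ)‖ ∂levyMeasure a κ
      = freqNorm k / Real.log (κ + freqNorm k) ^ a := by
    rw [← (hm k).2]
    refine integral_congr_ae ?_
    filter_upwards [ae_levyMeasure a κ] with u hu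
    have h1 := freqNorm_nonneg k
    have : Real.exp (-(u * freqNorm k)) ≤ 1 := Real.exp_le_one_iff.2 (by nlinarith)
    rw [Complex.norm_real, Real.norm_of_nonneg (by linarith)]
  have h := multiplier_eq_integral (g := g) (x := x) (μ := levyMeasure a κ)
    (σ := fun k u => ((1 - Real.exp (-(u * freqNorm k)) : ℝ) : ℂ))
    (U := fun u => g x - poissonInt g u x)
    (fun k => (hm k).1.ofReal) (by
      simp only [hnorm]
      refine Summable.of_nonneg_of_le (fun k => ?_) (fun k => ?_)
        ((summable_norm_mul_coeff hp hs).mul_left 2)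
      · have := freqNorm_nonneg k
        have := one_le_log_add hκ this
        positivity
      · have h1 := freqNorm_nonneg k
        have h2 : 1 ≤ Real.log (κ + freqNorm k) ^ a :=
          Real.one_le_rpow (one_le_log_add hκ h1) ha.le
        rw [← mul_assoc]
        refine mul_le_mul_of_nonneg_right ?_ (norm_nonneg _)
        exact (div_le_self h1 h2).trans (freqNorm_le k)) (by
      filter_upwards [ae_levyMeasure a κ] with u hu
      exact hasSum_poissonInt hp hs hu x)
  refine ⟨h.1, ?_⟩
  rw [← h.2, diffusion]
  congr 1
  funext k
  rw [integral_complex_ofReal, (hm k).2]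

lemma integrableOn_exp_neg_mul {r : ℝ} (hr : 0 < r) :
    IntegrableOn (fun u : ℝ => Real.exp (-(u * r))) (Ioi 0) := by
  refine (integrableOn_rpow_mul_exp one_pos hr).congr_fun (fun u _ => ?_) measurableSet_Ioi
  simp [mul_comm]

lemma integral_exp_neg_mul {r : ℝ} (hr : 0 < r) :
    ∫ u in Ioi (0 : ℝ), Real.exp (-(u * r)) = r⁻¹ := by
  have h := integral_rpow_mul_exp one_pos hr
  rw [Real.Gamma_one, mul_one, Real.rpow_neg_one] at h
  rw [← h]
  refine setIntegral_congr_fun measurableSet_Ioi fun u _ => ?_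
  simp [mul_comm]

/-- The Riesz transform is the integral over all heights of the gradient of the Poisson integral. -/
lemma riesz_eq_integral (j : Fin 2) {g : Plane → ℝ} (hp : IsPeriodic g)
    (hs : ContDiff ℝ (⊤ : ℕ∞) g) (x : Plane) :
    IntegrableOn (fun u => poissonIntDeriv j g u x) (Ioi 0) ∧
    riesz j g x = ∫ u in Ioi (0 : ℝ), poissonIntDeriv j g u x := by
  -- At the zero frequency `exp (-u |k|)` is not integrable in `u`, but the factor `k_j` vanishes,
  -- in agreement with the value `0 / 0 = 0` of the symbol.
  have hzero (k : Fin 2 → ℤ) (hk : freqNorm k = 0) : (k j : ℝ) = 0 := by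
    have := abs_le_freqNorm k j
    rw [hk] at this
    exact abs_nonpos_iff.1 this
  have hint (k : Fin 2 → ℤ) : IntegrableOn (fun u : ℝ => (k j : ℝ) * Real.exp (-(u * freqNorm k)))
      (Ioi 0) ∧ ∫ u in Ioi (0 : ℝ), (k j : ℝ) * Real.exp (-(u * freqNorm k))
        = (k j : ℝ) / freqNorm k := by
    rcases (freqNorm_nonneg k).eq_or_lt with h0 | h0
    · simp [hzero k h0.symm]
    · exact ⟨(integrableOn_exp_neg_mul h0).const_mul _, by
        rw [integral_const_mul, integral_exp_neg_mul h0, div_eq_mul_inv]⟩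
  have hnorm (k : Fin 2 → ℤ) : ∫ u in Ioi (0 : ℝ),
      ‖Complex.I * (((k j : ℝ) * Real.exp (-(u * freqNorm k)) : ℝ) : ℂ)‖ ≤ 1 := by
    have : ∀ u : ℝ, ‖Complex.I * (((k j : ℝ) * Real.exp (-(u * freqNorm k)) : ℝ) : ℂ)‖
        = |(k j : ℝ)| * Real.exp (-(u * freqNorm k)) := fun u => by
      rw [norm_mul, Complex.norm_I, one_mul, Complex.norm_real, norm_mul, Real.norm_eq_abs,
        Real.norm_of_nonneg (Real.exp_pos _).le]
    simp only [this]
    rcases (freqNorm_nonneg k).eq_or_lt with h0 | h0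
    · simp [hzero k h0.symm]
    · rw [integral_const_mul, integral_exp_neg_mul h0, ← div_eq_mul_inv]
      exact div_le_one_of_le₀ (abs_le_freqNorm k j) h0.le
  have h := multiplier_eq_integral (g := g) (x := x) (μ := volume.restrict (Ioi (0 : ℝ)))
    (σ := fun k u => Complex.I * (((k j : ℝ) * Real.exp (-(u * freqNorm k)) : ℝ) : ℂ))
    (U := fun u => poissonIntDeriv j g u x)
    (fun k => (hint k).1.ofReal.const_mul _) (by
      refine Summable.of_nonneg_of_le (fun k => ?_) (fun k => ?_) (summable_norm_coeff hp hs)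
      · exact mul_nonneg (integral_nonneg fun _ => norm_nonneg _) (norm_nonneg _)
      · exact mul_le_of_le_one_left (norm_nonneg _) (hnorm k)) (by
      filter_upwards [ae_restrict_mem measurableSet_Ioi] with u hu
      refine (hasSum_convolution hp hs (integrable_poissonGrad j hu) x).congr_fun fun k => ?_
      rw [integral_poissonGrad_mul_character j hu]
      push_cast
      ring)
  refine ⟨h.1, ?_⟩
  rw [← h.2, riesz]
  congr 1
  funext k
  rw [integral_const_mul, integral_complex_ofReal, (hint k).2]

/-! ### The slowly varying weight -/

/-- The weight `log (κ + 1/ρ)`. -/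
def logWeight (κ ρ : ℝ) : ℝ := Real.log (κ + ρ⁻¹)

section LogWeight

variable {a κ : ℝ}

lemma one_le_logWeight (hκ : Real.exp 1 ≤ κ) {ρ : ℝ} (hρ : 0 < ρ) : 1 ≤ logWeight κ ρ :=
  one_le_log_add hκ (by positivity)

lemma logWeight_anti (hκ : Real.exp 1 ≤ κ) {u ρ : ℝ} (hu : 0 < u) (h : u ≤ ρ) :
    logWeight κ ρ ≤ logWeight κ u := by
  have := Real.exp_pos 1
  have hρ : 0 < ρ := hu.trans_le h
  have h1 : ρ⁻¹ ≤ u⁻¹ := inv_anti₀ hu h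
  have h2 : 0 < ρ⁻¹ := by positivity
  exact Real.log_le_log (by linarith) (by linarith)

/-- Slow variation: `log (κ + 1/u) ≤ log (κ + 1/ρ) + log (ρ/u)` and `log x ≤ 2 (√x - 1)`. The loss
`√(ρ/u)` is integrable in `u` at 0, and it is linear in `1/τ` for a scale shrinking like `τ²`. -/
lemma logWeight_rpow_le (ha : 0 < a) (ha1 : a ≤ 1) (hκ : Real.exp 1 ≤ κ) {u ρ : ℝ} (hu : 0 < u)
    (h : u ≤ ρ) : logWeight κ u ^ a ≤ 2 * Real.sqrt (ρ / u) * logWeight κ ρ ^ a := by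
  have hρ : 0 < ρ := hu.trans_le h
  have hκ0 : 0 < κ := (Real.exp_pos 1).trans_le hκ
  have h1 : 1 ≤ ρ / u := (one_le_div hu).2 h
  have hs : 1 ≤ Real.sqrt (ρ / u) := Real.one_le_sqrt.2 h1
  have hl := one_le_logWeight hκ hρ
  have hlu := one_le_logWeight hκ hu
  have h2 : logWeight κ u ≤ logWeight κ ρ + Real.log (ρ / u) := by
    rw [logWeight, logWeight, ← Real.log_mul (by positivity) (by positivity)]
    refine Real.log_le_log (by positivity) ?_
    have : u⁻¹ = ρ⁻¹ * (ρ / u) := by field_simp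
    rw [add_mul, ← this]
    nlinarith
  have h3 : Real.log (ρ / u) ≤ 2 * (Real.sqrt (ρ / u) - 1) := by
    have h4 := Real.log_le_sub_one_of_pos (show 0 < Real.sqrt (ρ / u) by linarith)
    rw [Real.log_sqrt (by linarith)] at h4
    linarith
  have h5 : logWeight κ u ≤ 2 * Real.sqrt (ρ / u) * logWeight κ ρ := by nlinarith
  calc logWeight κ u ^ a ≤ (2 * Real.sqrt (ρ / u) * logWeight κ ρ) ^ a :=
        Real.rpow_le_rpow (by linarith) h5 ha.le
    _ = (2 * Real.sqrt (ρ / u)) ^ a * logWeight κ ρ ^ a :=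
        Real.mul_rpow (by positivity) (by linarith)
    _ ≤ (2 * Real.sqrt (ρ / u)) ^ (1 : ℝ) * logWeight κ ρ ^ a := by
        refine mul_le_mul_of_nonneg_right ?_ (Real.rpow_nonneg (by linarith) _)
        exact Real.rpow_le_rpow_of_exponent_le (by linarith) ha1
    _ = _ := by rw [Real.rpow_one]

end LogWeight

/-! ### The constants -/

section Constants

variable {a κ : ℝ}

/-- The constant in the lower bound for the first moment of the Lévy measure. -/
def levyConst (a : ℝ) : ℝ := (Real.Gamma a)⁻¹ / (8 * a)

lemma levyConst_pos (ha : 0 < a) : 0 < levyConst a := by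
  have := Real.Gamma_pos_of_pos ha
  unfold levyConst; positivity

/-- The height, in units of `ρ`, at which the Poisson integral has lost half of the increment. -/
def heightRatio : ℝ := (14 * poissonMoment) ^ 2

lemma one_le_heightRatio : 1 ≤ heightRatio := by
  have := one_le_poissonMoment
  unfold heightRatio
  nlinarith

/-- The constant in the lower bound for the dissipation. -/
def dissConst (a κ : ℝ) : ℝ :=
  levyConst a * Real.exp (-(κ * (heightRatio * 6))) / (2 * heightRatio)

lemma dissConst_pos (ha : 0 < a) : 0 < dissConst a κ := by
  have := levyConst_pos ha
  have := one_le_heightRatio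
  have : 0 < heightRatio := by linarith
  unfold dissConst; positivity

/-- The constant in the upper bound for the increment of the velocity. -/
def velConst (a κ : ℝ) : ℝ :=
  6 * Real.exp (κ * 6) / levyConst a + 192 * poissonMoment / dissConst a κ

lemma velConst_pos (ha : 0 < a) : 0 < velConst a κ := by
  have := levyConst_pos ha
  have := dissConst_pos (κ := κ) ha
  have h := one_le_poissonMoment
  have : 0 < poissonMoment := by linarith
  unfold velConst
  positivity

end Constants

/-! ### Estimates at a point where the modulus of continuity is touched -/

/-- The increment of `θ` over `h` touches the modulus `A (ξ² + |h|²)^{α/2}` at `x`. -/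
structure Touches (θ : Plane → ℝ) (A ξ α : ℝ) (x h : Plane) : Prop where
  periodic : IsPeriodic θ
  smooth : ContDiff ℝ (⊤ : ℕ∞) θ
  A_pos : 0 < A
  xi_pos : 0 < ξ
  alpha_pos : 0 < α
  alpha_le : α ≤ 1 / 2
  modulus : ∀ z y, θ (z + y) - θ z ≤ A * upperNorm ξ y ^ α
  touch : θ (x + h) - θ x = A * upperNorm ξ h ^ α

lemma integrable_mul_periodic {g : Plane → ℝ} (hp : IsPeriodic g) (hc : Continuous g)
    {K : Plane → ℝ} (hK : Integrable K) (x : Plane) : Integrable fun y => K y * g (x + y) := by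
  obtain ⟨C, hC⟩ := hp.bounded hc
  exact hK.mul_bdd (c := C) (by fun_prop : Continuous fun y => g (x + y)).aestronglyMeasurable
    (Eventually.of_forall fun y => hC _)

lemma integral_poissonGrad (j : Fin 2) {u : ℝ} (hu : 0 < u) :
    ∫ y : Plane, poissonGrad j u y = 0 := by
  have h := integral_poissonGrad_mul_character j hu 0
  have h0 (y : Plane) : character 0 y = 1 := by simp [character]
  simp only [h0, mul_one] at h
  rw [integral_complex_ofReal] at h
  simpa using h

/-- The deficit `g(x) - P_u g(x)`, where `g` is the increment of `θ` over `h`. -/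
def deficit (θ : Plane → ℝ) (x h : Plane) (u : ℝ) : ℝ :=
  (θ (x + h) - poissonInt θ u (x + h)) - (θ x - poissonInt θ u x)

/-! ### The deficit and kernel increments at a touching point. -/

namespace Touches

variable {θ : Plane → ℝ} {A ξ α : ℝ} {x h : Plane}

lemma abs_le (H : Touches θ A ξ α x h) (z y : Plane) :
    |θ (z + y) - θ z| ≤ A * upperNorm ξ y ^ α := by
  refine _root_.abs_le.2 ⟨?_, H.modulus z y⟩
  have h1 := H.modulus (z + y) (-y)
  rw [add_neg_cancel_right, upperNorm, norm_neg, ← upperNorm] at h1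
  linarith

lemma integrable (H : Touches θ A ξ α x h) {K : Plane → ℝ} (hK : Integrable K) (z : Plane) :
    Integrable fun y => K y * θ (z + y) :=
  integrable_mul_periodic H.periodic H.smooth.continuous hK z

/-- No increment over `h` exceeds the one at `x`, since there the modulus is attained. All signs in
the dissipation come from this. -/
lemma gap_nonneg (H : Touches θ A ξ α x h) (y : Plane) :
    0 ≤ (θ (x + h) - θ x) - (θ (x + h + y) - θ (x + y)) := by
  have h1 := H.modulus (x + y) h
  rw [add_right_comm] at h1
  rw [H.touch]
  linarith

lemma kernel_gap (H : Touches θ A ξ α x h) {K : Plane → ℝ} (hK : Integrable K) :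
    Integrable (fun y => K y * ((θ (x + h) - θ x) - (θ (x + h + y) - θ (x + y)))) ∧
    ∫ y, K y * ((θ (x + h) - θ x) - (θ (x + h + y) - θ (x + y)))
      = (∫ y, K y) * (θ (x + h) - θ x)
        - ((∫ y, K y * θ (x + h + y)) - ∫ y, K y * θ (x + y)) := by
  have h1 := H.integrable hK (x + h)
  have h2 := H.integrable hK x
  have h3 := hK.mul_const (θ (x + h) - θ x)
  have e : (fun y => K y * ((θ (x + h) - θ x) - (θ (x + h + y) - θ (x + y))))
      = fun y => K y * (θ (x + h) - θ x) - (K y * θ (x + h + y) - K y * θ (x + y)) := by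
    funext y; ring
  have h4 : Integrable fun y => K y * θ (x + h + y) - K y * θ (x + y) := h1.sub h2
  rw [e]
  refine ⟨h3.sub h4, ?_⟩
  rw [integral_sub h3 h4, integral_mul_const, ← integral_sub h1 h2]

lemma deficit_eq (H : Touches θ A ξ α x h) {u : ℝ} (hu : 0 < u) : deficit θ x h u
    = ∫ y, poisson u y * ((θ (x + h) - θ x) - (θ (x + h + y) - θ (x + y))) := by
  rw [(H.kernel_gap (integrable_poisson hu)).2, integral_poisson hu, deficit, poissonInt, poissonInt]
  ring

lemma deficit_nonneg (H : Touches θ A ξ α x h) {u : ℝ} (hu : 0 < u) : 0 ≤ deficit θ x h u := by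
  rw [H.deficit_eq hu]
  exact integral_nonneg fun y => mul_nonneg (poisson_pos hu y).le (H.gap_nonneg y)

/-- The kernel comparison `P_w ≥ (w/u) P_u` acts on a nonnegative gap; thus a deficit at one height
persists at all smaller heights, with at most linear loss. -/
lemma deficit_mono (H : Touches θ A ξ α x h) {w u : ℝ} (hw : 0 < w) (hwu : w ≤ u) :
    w / u * deficit θ x h u ≤ deficit θ x h w := by
  have hu := hw.trans_le hwu
  rw [H.deficit_eq hu, H.deficit_eq hw, ← integral_const_mul]
  refine integral_mono ((H.kernel_gap (integrable_poisson hu)).1.const_mul _)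
    (H.kernel_gap (integrable_poisson hw)).1 fun y => ?_
  simp only
  rw [← mul_assoc]
  exact mul_le_mul_of_nonneg_right (poisson_height_le hw hwu y) (H.gap_nonneg y)

/-- The gradient kernel has mean zero, so the constant increment at `x` may be inserted; the
integrand is then kernel times gap, and the kernel is dominated by `P_u`. -/
lemma abs_poissonIntDeriv_sub_le (H : Touches θ A ξ α x h) (j : Fin 2) {u : ℝ} (hu : 0 < u) :
    |poissonIntDeriv j θ u (x + h) - poissonIntDeriv j θ u x| ≤ 3 / 2 / u * deficit θ x h u := by
  have hk := H.kernel_gap (integrable_poissonGrad j hu)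
  have e : poissonIntDeriv j θ u (x + h) - poissonIntDeriv j θ u x
      = -∫ y, poissonGrad j u y * ((θ (x + h) - θ x) - (θ (x + h + y) - θ (x + y))) := by
    rw [hk.2, integral_poissonGrad j hu, poissonIntDeriv, poissonIntDeriv]
    ring
  rw [e, abs_neg, H.deficit_eq hu, ← integral_const_mul]
  refine (abs_integral_le_integral_abs).trans (integral_mono hk.1.abs
    ((H.kernel_gap (integrable_poisson hu)).1.const_mul _) fun y => ?_)
  simp only
  rw [abs_mul, abs_of_nonneg (H.gap_nonneg y), ← mul_assoc]
  exact mul_le_mul_of_nonneg_right (abs_poissonGrad_le j hu y) (H.gap_nonneg y)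

/-- The shift by `h` is moved from `θ` to the kernel. As `K(· - h) - K` has mean zero, `θ x` can be
subtracted, and the modulus together with the Poisson moment gives `u^α`. -/
lemma abs_kernel_sub_le (H : Touches θ A ξ α x h) {K : Plane → ℝ} (hK : Integrable K) {u D : ℝ}
    (hu : 0 < u) (hξu : ξ ≤ u) (hD : 0 ≤ D)
    (hKD : ∀ y, |K (y - h) - K y| ≤ D * poisson u y) :
    |(∫ y, K y * θ (x + h + y)) - ∫ y, K y * θ (x + y)| ≤ D * (A * (poissonMoment * u ^ α)) := by
  have hKs : Integrable fun y => K (y - h) := hK.comp_sub_right h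
  have e1 : ∫ y, K y * θ (x + h + y) = ∫ y, K (y - h) * θ (x + y) := by
    rw [← integral_add_right_eq_self (fun y => K (y - h) * θ (x + y)) h]
    congr 1
    funext y
    rw [add_sub_cancel_right, add_assoc, add_comm h y]
  have e2 : (∫ y, K y * θ (x + h + y)) - ∫ y, K y * θ (x + y)
      = ∫ y, (K (y - h) - K y) * (θ (x + y) - θ x) := by
    have i1 := H.integrable hKs x
    have i2 := H.integrable hK x
    have e3 : (fun y => (K (y - h) - K y) * (θ (x + y) - θ x)) = fun y =>
        (K (y - h) * θ (x + y) - K y * θ (x + y)) - (K (y - h) - K y) * θ x := by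
      funext y; ring
    have i3 : Integrable fun y => K (y - h) * θ (x + y) - K y * θ (x + y) := i1.sub i2
    have i4 : Integrable fun y => (K (y - h) - K y) * θ x := (hKs.sub hK).mul_const _
    rw [e1, e3, integral_sub i3 i4, integral_sub i1 i2,
      integral_mul_const, integral_sub hKs hK, integral_sub_right_eq_self]
    ring
  have hm := integral_poisson_mul_rpow_le hu H.xi_pos hξu H.alpha_pos.le H.alpha_le
  have hA := H.A_pos
  rw [e2]
  calc |∫ y, (K (y - h) - K y) * (θ (x + y) - θ x)|
      ≤ ∫ y, D * (A * (poisson u y * upperNorm ξ y ^ α)) := by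
        rw [← Real.norm_eq_abs]
        refine norm_integral_le_of_norm_le ((hm.1.const_mul A).const_mul D)
          (Eventually.of_forall fun y => ?_)
        rw [Real.norm_eq_abs, abs_mul]
        have hP := poisson_pos hu y
        calc |K (y - h) - K y| * |θ (x + y) - θ x|
            ≤ (D * poisson u y) * (A * upperNorm ξ y ^ α) := by
              gcongr
              · exact hKD y
              · exact H.abs_le x y
          _ = _ := by ring
    _ = D * (A * ∫ y, poisson u y * upperNorm ξ y ^ α) := by
        rw [integral_const_mul, integral_const_mul]
    _ ≤ _ := by gcongr; exact hm.2

lemma abs_poissonInt_sub_le (H : Touches θ A ξ α x h) {u : ℝ} (hu : upperNorm ξ h ≤ u) :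
    |poissonInt θ u (x + h) - poissonInt θ u x|
      ≤ 7 * ‖h‖ / u * (A * (poissonMoment * u ^ α)) := by
  have hu0 : 0 < u := (upperNorm_pos H.xi_pos h).trans_le hu
  exact H.abs_kernel_sub_le (integrable_poisson hu0) hu0 ((le_upperNorm ξ h).trans hu)
    (by positivity) (abs_poisson_sub_le hu0 ((norm_le_upperNorm ξ h).trans hu))

lemma abs_poissonIntDeriv_sub_le_far (H : Touches θ A ξ α x h) (j : Fin 2) {u : ℝ}
    (hu : upperNorm ξ h ≤ u) :
    |poissonIntDeriv j θ u (x + h) - poissonIntDeriv j θ u x|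
      ≤ 96 * ‖h‖ / u ^ 2 * (A * (poissonMoment * u ^ α)) := by
  have hu0 : 0 < u := (upperNorm_pos H.xi_pos h).trans_le hu
  exact H.abs_kernel_sub_le (integrable_poissonGrad j hu0) hu0 ((le_upperNorm ξ h).trans hu)
    (by positivity) (abs_poissonGrad_sub_le j hu0 ((norm_le_upperNorm ξ h).trans hu))

/-! ### Dissipation and velocity increments at a touching point. -/

section Diffusion

variable {a κ : ℝ}

lemma diffusion_sub_eq (H : Touches θ A ξ α x h) (ha : 0 < a) (ha1 : a ≤ 1)
    (hκ : Real.exp 1 ≤ κ) : Integrable (deficit θ x h) (levyMeasure a κ) ∧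
    diffusion a κ θ (x + h) - diffusion a κ θ x = ∫ u, deficit θ x h u ∂levyMeasure a κ := by
  have h1 := diffusion_eq_integral ha ha1 hκ H.periodic H.smooth (x + h)
  have h2 := diffusion_eq_integral ha ha1 hκ H.periodic H.smooth x
  refine ⟨h1.1.sub h2.1, ?_⟩
  rw [h1.2, h2.2, ← integral_sub h1.1 h2.1]
  rfl

/-- In the Lévy integral of the deficit, heights above `u` are discarded and those below are bounded
by `(w/u)` times the deficit at `u`; the truncated first moment remains. -/
lemma deficit_le_diffusion (H : Touches θ A ξ α x h) (ha : 0 < a) (ha1 : a ≤ 1)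
    (hκ : Real.exp 1 ≤ κ) {u : ℝ} (hu : 0 < u) :
    levyConst a * Real.exp (-(κ * u)) * logWeight κ u ^ (-a) * (deficit θ x h u / u)
      ≤ diffusion a κ θ (x + h) - diffusion a κ θ x := by
  obtain ⟨hi, he⟩ := H.diffusion_sub_eq ha ha1 hκ
  have hnn : ∀ᵐ w ∂levyMeasure a κ, 0 ≤ deficit θ x h w := by
    filter_upwards [ae_levyMeasure a κ] with w hw using H.deficit_nonneg hw
  rw [he]
  rw [← ENNReal.ofReal_le_ofReal_iff (integral_nonneg_of_ae hnn),
    ofReal_integral_eq_lintegral_ofReal hi hnn]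
  have hdu : 0 ≤ deficit θ x h u / u := div_nonneg (H.deficit_nonneg hu) hu.le
  calc ENNReal.ofReal (levyConst a * Real.exp (-(κ * u)) * logWeight κ u ^ (-a)
        * (deficit θ x h u / u))
      = ENNReal.ofReal (deficit θ x h u / u) * ENNReal.ofReal (levyConst a
        * Real.exp (-(κ * u)) * logWeight κ u ^ (-a)) := by
        rw [← ENNReal.ofReal_mul hdu, mul_comm]
    _ ≤ ENNReal.ofReal (deficit θ x h u / u)
        * ∫⁻ w, ENNReal.ofReal ((Ioc 0 u).indicator id w) ∂levyMeasure a κ := by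
        gcongr
        exact levyMeasure_moment_lower ha ha1 hκ hu
    _ = ∫⁻ w, ENNReal.ofReal (deficit θ x h u / u)
        * ENNReal.ofReal ((Ioc 0 u).indicator id w) ∂levyMeasure a κ := by
        rw [lintegral_const_mul]
        exact (Measurable.indicator measurable_id measurableSet_Ioc).ennreal_ofReal
    _ ≤ _ := by
        refine lintegral_mono_ae ?_
        filter_upwards [ae_levyMeasure a κ] with w hw
        rw [← ENNReal.ofReal_mul hdu]
        refine ENNReal.ofReal_le_ofReal ?_
        by_cases hwu : w ≤ u
        · rw [indicator_of_mem (show w ∈ Ioc 0 u from ⟨hw, hwu⟩), id]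
          calc deficit θ x h u / u * w = w / u * deficit θ x h u := by ring
            _ ≤ _ := H.deficit_mono hw hwu
        · rw [indicator_of_notMem (fun h' => hwu h'.2), mul_zero]
          exact H.deficit_nonneg hw

/-- At height `u = B ρ` the Poisson integral retains an increment of at most `7 m B^{α-1} A ρ^α`,
where `m` is the moment. For `α ≤ 1/2` and `B = (14 m)²` the factor is at most `7 m B^{-1/2} = 1/2`.
-/
lemma half_le_deficit (H : Touches θ A ξ α x h) :
    A * upperNorm ξ h ^ α / 2 ≤ deficit θ x h (heightRatio * upperNorm ξ h) := by
  have hρ := upperNorm_pos H.xi_pos h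
  have hB := one_le_heightRatio
  have hB0 : 0 < heightRatio := by linarith
  have hm := one_le_poissonMoment
  have hA := H.A_pos
  have hb := H.abs_poissonInt_sub_le (u := heightRatio * upperNorm ξ h)
    (le_mul_of_one_le_left hρ.le hB)
  have h1 : 7 * ‖h‖ / (heightRatio * upperNorm ξ h)
      * (A * (poissonMoment * (heightRatio * upperNorm ξ h) ^ α)) ≤ A * upperNorm ξ h ^ α / 2 := by
    rw [Real.mul_rpow hB0.le hρ.le]
    have h2 : heightRatio ^ α ≤ 14 * poissonMoment := by
      calc heightRatio ^ α ≤ heightRatio ^ (1 / 2 : ℝ) :=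
            Real.rpow_le_rpow_of_exponent_le hB H.alpha_le
        _ = 14 * poissonMoment := by
            rw [← Real.sqrt_eq_rpow, heightRatio, Real.sqrt_sq (by positivity)]
    have h3 : 7 * ‖h‖ / (heightRatio * upperNorm ξ h) ≤ 7 / heightRatio := by
      rw [div_le_div_iff₀ (by positivity) hB0]
      have := norm_le_upperNorm ξ h
      nlinarith
    calc 7 * ‖h‖ / (heightRatio * upperNorm ξ h)
          * (A * (poissonMoment * (heightRatio ^ α * upperNorm ξ h ^ α)))
        ≤ 7 / heightRatio * (A * (poissonMoment * ((14 * poissonMoment) * upperNorm ξ h ^ α))) := by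
          gcongr
      _ = A * upperNorm ξ h ^ α / 2 := by
          rw [heightRatio]; field_simp; norm_num
  have h4 := (_root_.abs_le.1 (hb.trans h1)).2
  have h5 := H.touch
  rw [deficit]
  linarith

lemma diffusion_sub_nonneg (H : Touches θ A ξ α x h) (ha : 0 < a) (ha1 : a ≤ 1)
    (hκ : Real.exp 1 ≤ κ) : 0 ≤ diffusion a κ θ (x + h) - diffusion a κ θ x := by
  rw [(H.diffusion_sub_eq ha ha1 hκ).2]
  refine integral_nonneg_of_ae ?_
  filter_upwards [ae_levyMeasure a κ] with w hw using H.deficit_nonneg hw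

/-- Lower bound for the dissipation. -/
lemma dissipation_lower (H : Touches θ A ξ α x h) (ha : 0 < a) (ha1 : a ≤ 1)
    (hκ : Real.exp 1 ≤ κ) (hρ6 : upperNorm ξ h ≤ 6) :
    dissConst a κ * (A * upperNorm ξ h ^ α)
      ≤ (diffusion a κ θ (x + h) - diffusion a κ θ x)
        * (upperNorm ξ h * logWeight κ (upperNorm ξ h) ^ a) := by
  have hρ := upperNorm_pos H.xi_pos h
  have hB := one_le_heightRatio
  have hB0 : 0 < heightRatio := by linarith
  have hA := H.A_pos
  have hc := levyConst_pos ha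
  have hκ0 : 0 < κ := (Real.exp_pos 1).trans_le hκ
  have hd := H.deficit_le_diffusion ha ha1 hκ (u := heightRatio * upperNorm ξ h) (by positivity)
  have hh := H.half_le_deficit
  set ρ := upperNorm ξ h
  have hl := one_le_logWeight hκ hρ
  have hl0 : 0 < logWeight κ ρ := by linarith
  have hlB := one_le_logWeight hκ (show 0 < heightRatio * ρ by positivity)
  have h1 : logWeight κ ρ ^ (-a) ≤ logWeight κ (heightRatio * ρ) ^ (-a) :=
    Real.rpow_le_rpow_of_nonpos (by linarith)
      (logWeight_anti hκ hρ (le_mul_of_one_le_left hρ.le hB)) (by linarith)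
  have h2 : Real.exp (-(κ * (heightRatio * 6))) ≤ Real.exp (-(κ * (heightRatio * ρ))) := by
    refine Real.exp_le_exp.2 (neg_le_neg ?_)
    gcongr
  have h3 : levyConst a * Real.exp (-(κ * (heightRatio * 6))) * logWeight κ ρ ^ (-a)
      * (A * ρ ^ α / 2 / (heightRatio * ρ)) ≤ diffusion a κ θ (x + h) - diffusion a κ θ x := by
    refine le_trans ?_ hd
    gcongr
  calc dissConst a κ * (A * ρ ^ α)
      = levyConst a * Real.exp (-(κ * (heightRatio * 6))) * logWeight κ ρ ^ (-a)
      * (A * ρ ^ α / 2 / (heightRatio * ρ)) * (ρ * logWeight κ ρ ^ a) := by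
        rw [Real.rpow_neg hl0.le, dissConst]
        field_simp
    _ ≤ _ := mul_le_mul_of_nonneg_right h3 (by positivity)

/-- The deficit over `u` is bounded by `Λ` times the weight at `u`, and slow variation replaces that
weight by the one at `ρ`. -/
lemma near_bound (H : Touches θ A ξ α x h) (ha : 0 < a) (ha1 : a ≤ 1)
    (hκ : Real.exp 1 ≤ κ) (hρ6 : upperNorm ξ h ≤ 6) (j : Fin 2) {u : ℝ} (hu : 0 < u)
    (huρ : u ≤ upperNorm ξ h) :
    |poissonIntDeriv j θ u (x + h) - poissonIntDeriv j θ u x|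
      ≤ 3 * Real.exp (κ * 6) / levyConst a * (diffusion a κ θ (x + h) - diffusion a κ θ x)
        * logWeight κ (upperNorm ξ h) ^ a * Real.sqrt (upperNorm ξ h) * u ^ (-(1 / 2) : ℝ) := by
  have hρ := upperNorm_pos H.xi_pos h
  have hc := levyConst_pos ha
  have hκ0 : 0 < κ := (Real.exp_pos 1).trans_le hκ
  have hd := H.deficit_le_diffusion ha ha1 hκ hu
  have hΛ := H.diffusion_sub_nonneg ha ha1 hκ
  have hl := one_le_logWeight hκ hu
  have hlw := logWeight_rpow_le ha ha1 hκ hu huρ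
  set Λ := diffusion a κ θ (x + h) - diffusion a κ θ x
  set ρ := upperNorm ξ h
  have hl0 : 0 < logWeight κ u := by linarith
  have hdef := H.deficit_nonneg hu
  have h1 : deficit θ x h u / u ≤ Λ * Real.exp (κ * 6) / levyConst a * logWeight κ u ^ a := by
    have h2 : deficit θ x h u / u = (levyConst a * Real.exp (-(κ * u)) * logWeight κ u ^ (-a)
        * (deficit θ x h u / u)) * (Real.exp (κ * u) / levyConst a * logWeight κ u ^ a) := by
      rw [Real.rpow_neg hl0.le, Real.exp_neg]
      field_simp
    rw [h2]
    calc (levyConst a * Real.exp (-(κ * u)) * logWeight κ u ^ (-a)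
        * (deficit θ x h u / u)) * (Real.exp (κ * u) / levyConst a * logWeight κ u ^ a)
        ≤ Λ * (Real.exp (κ * 6) / levyConst a * logWeight κ u ^ a) := by
          gcongr
          linarith
      _ = _ := by ring
  have hsq : Real.sqrt (ρ / u) = Real.sqrt ρ * u ^ (-(1 / 2) : ℝ) := by
    rw [Real.sqrt_div hρ.le, Real.rpow_neg hu.le, ← Real.sqrt_eq_rpow, div_eq_mul_inv]
  calc |poissonIntDeriv j θ u (x + h) - poissonIntDeriv j θ u x|
      ≤ 3 / 2 / u * deficit θ x h u := H.abs_poissonIntDeriv_sub_le j hu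
    _ = 3 / 2 * (deficit θ x h u / u) := by ring
    _ ≤ 3 / 2 * (Λ * Real.exp (κ * 6) / levyConst a
        * (2 * Real.sqrt (ρ / u) * logWeight κ ρ ^ a)) := by
        refine mul_le_mul_of_nonneg_left (h1.trans ?_) (by norm_num)
        exact mul_le_mul_of_nonneg_left hlw (by positivity)
    _ = _ := by rw [hsq]; ring

lemma far_bound (H : Touches θ A ξ α x h) (j : Fin 2) {u : ℝ} (hu : upperNorm ξ h ≤ u) :
    |poissonIntDeriv j θ u (x + h) - poissonIntDeriv j θ u x|
      ≤ 96 * ‖h‖ * A * poissonMoment * u ^ (α - 2) := by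
  have hu0 : 0 < u := (upperNorm_pos H.xi_pos h).trans_le hu
  refine (H.abs_poissonIntDeriv_sub_le_far j hu).trans_eq ?_
  rw [Real.rpow_sub hu0, Real.rpow_two]
  ring

/-- Upper bound for the increment of the Riesz transforms in terms of the dissipation. -/
lemma abs_riesz_sub_le (H : Touches θ A ξ α x h) (ha : 0 < a) (ha1 : a ≤ 1)
    (hκ : Real.exp 1 ≤ κ) (hρ6 : upperNorm ξ h ≤ 6) (j : Fin 2) :
    |riesz j θ (x + h) - riesz j θ x|
      ≤ velConst a κ * ((diffusion a κ θ (x + h) - diffusion a κ θ x)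
        * (upperNorm ξ h * logWeight κ (upperNorm ξ h) ^ a)) := by
  have hρ := upperNorm_pos H.xi_pos h
  have hc := levyConst_pos ha
  have hc1 := dissConst_pos (κ := κ) ha
  have hΛ := H.diffusion_sub_nonneg ha ha1 hκ
  have hdiss := H.dissipation_lower ha ha1 hκ hρ6
  have hnear := fun u hu huρ => H.near_bound ha ha1 hκ hρ6 j (u := u) hu huρ
  have hfar := fun u hu => H.far_bound j (u := u) hu
  have hl := one_le_logWeight hκ hρ
  have hhρ := norm_le_upperNorm ξ h
  obtain ⟨i1, e1⟩ := riesz_eq_integral j H.periodic H.smooth (x + h)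
  obtain ⟨i2, e2⟩ := riesz_eq_integral j H.periodic H.smooth x
  have hA := H.A_pos
  have hm := one_le_poissonMoment
  have hm0 : 0 < poissonMoment := by linarith
  have hα := H.alpha_le
  set Λ := diffusion a κ θ (x + h) - diffusion a κ θ x
  set ρ := upperNorm ξ h
  set U : ℝ → ℝ := fun u => poissonIntDeriv j θ u (x + h) - poissonIntDeriv j θ u x with hU
  have iU : IntegrableOn U (Ioi 0) := i1.sub i2
  -- The heights are split at `ρ`: the dissipation controls the lower ones, the modulus the upper
  -- ones.
  have hsplit : riesz j θ (x + h) - riesz j θ x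
      = (∫ u in Ioc 0 ρ, U u) + ∫ u in Ioi ρ, U u := by
    rw [e1, e2, ← integral_sub i1 i2, ← setIntegral_union (Ioc_disjoint_Ioi le_rfl) measurableSet_Ioi
      (iU.mono_set Ioc_subset_Ioi_self) (iU.mono_set (Ioi_subset_Ioi hρ.le)),
      Ioc_union_Ioi_eq_Ioi hρ.le]
  have hI1 : |∫ u in Ioc 0 ρ, U u| ≤ 6 * Real.exp (κ * 6) / levyConst a
      * (Λ * (ρ * logWeight κ ρ ^ a)) := by
    have hint : IntervalIntegrable (fun u : ℝ => u ^ (-(1 / 2) : ℝ)) volume 0 ρ :=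
      intervalIntegral.intervalIntegrable_rpow' (by norm_num)
    have hint' := (intervalIntegrable_iff_integrableOn_Ioc_of_le hρ.le).1 hint
    have hval : ∫ u in Ioc 0 ρ, u ^ (-(1 / 2) : ℝ) = 2 * Real.sqrt ρ := by
      rw [← intervalIntegral.integral_of_le hρ.le, integral_rpow (Or.inl (by norm_num)),
        Real.sqrt_eq_rpow, Real.zero_rpow (by norm_num)]
      norm_num
      ring
    rw [← Real.norm_eq_abs]
    refine (norm_integral_le_of_norm_le (hint'.const_mul (3 * Real.exp (κ * 6) / levyConst a * Λ
      * logWeight κ ρ ^ a * Real.sqrt ρ)) ?_).trans_eq ?_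
    · filter_upwards [ae_restrict_mem measurableSet_Ioc] with u hu
      exact hnear u hu.1 hu.2
    · rw [integral_const_mul, hval]
      calc _ = 6 * Real.exp (κ * 6) / levyConst a * (Λ * (Real.sqrt ρ * Real.sqrt ρ
            * logWeight κ ρ ^ a)) := by ring
        _ = _ := by rw [Real.mul_self_sqrt hρ.le]
  -- The upper heights contribute a multiple of `A ρ^α`, which the lower bound for the dissipation
  -- converts back into `Λ`. The 192 is 96 times the bound 2 for `1 / (1 - α)`.
  have hI2 : |∫ u in Ioi ρ, U u| ≤ 192 * poissonMoment / dissConst a κ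
      * (Λ * (ρ * logWeight κ ρ ^ a)) := by
    have hint := integrableOn_Ioi_rpow_of_lt (show α - 2 < -1 by linarith) hρ
    have hval := integral_Ioi_rpow_of_lt (show α - 2 < -1 by linarith) hρ
    have h1 : |∫ u in Ioi ρ, U u|
        ≤ 96 * ‖h‖ * A * poissonMoment * (-ρ ^ (α - 2 + 1) / (α - 2 + 1)) := by
      rw [← Real.norm_eq_abs, ← hval, ← integral_const_mul]
      refine norm_integral_le_of_norm_le (hint.const_mul _) ?_
      filter_upwards [ae_restrict_mem measurableSet_Ioi] with u hu
      exact hfar u (mem_Ioi.1 hu).le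
    have h2 : -ρ ^ (α - 2 + 1) / (α - 2 + 1) ≤ 2 * ρ ^ (α - 1) := by
      rw [show α - 2 + 1 = -(1 - α) by ring, neg_div_neg_eq, div_le_iff₀ (by linarith),
        show -(1 - α) = α - 1 by ring]
      have : 0 < ρ ^ (α - 1) := by positivity
      nlinarith
    have h3 : ρ * ρ ^ (α - 1) = ρ ^ α := by
      rw [← Real.rpow_one_add' hρ.le (by linarith [H.alpha_pos])]
      ring_nf
    calc |∫ u in Ioi ρ, U u|
        ≤ 96 * ‖h‖ * A * poissonMoment * (2 * ρ ^ (α - 1)) := h1.trans (by gcongr)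
      _ ≤ 96 * ρ * A * poissonMoment * (2 * ρ ^ (α - 1)) := by gcongr
      _ = 192 * poissonMoment / dissConst a κ * (dissConst a κ * (A * (ρ * ρ ^ (α - 1)))) := by
          field_simp
          ring
      _ ≤ _ := by rw [h3]; gcongr
  rw [hsplit, velConst, add_mul]
  exact (abs_add_le _ _).trans (add_le_add hI1 hI2)

end Diffusion

end Touches

/-! ### Derivatives at the touching point -/

/-- Since `ξ > 0` the modulus is smooth even at `h = 0`. -/
lemma hasDerivAt_upperNorm_line (A ξ α : ℝ) (hξ : 0 < ξ) (h v : Plane) :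
    HasDerivAt (fun τ : ℝ => A * upperNorm ξ (h + τ • v) ^ α)
      (A * α * upperNorm ξ h ^ (α - 2) * inner ℝ h v) 0 := by
  have hρ := upperNorm_pos hξ h
  have hn (τ : ℝ) : upperNorm ξ (h + τ • v) ^ α
      = (ξ ^ 2 + (‖h‖ ^ 2 + 2 * τ * inner ℝ h v + τ ^ 2 * ‖v‖ ^ 2)) ^ (α / 2) := by
    rw [upperNorm, Real.sqrt_eq_rpow, ← Real.rpow_mul (by positivity), norm_add_sq_real,
      real_inner_smul_right, norm_smul, mul_pow, Real.norm_eq_abs, sq_abs]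
    ring_nf
  simp only [hn]
  have h1 : HasDerivAt (fun τ : ℝ => ξ ^ 2 + (‖h‖ ^ 2 + 2 * τ * inner ℝ h v + τ ^ 2 * ‖v‖ ^ 2))
      (2 * inner ℝ h v) 0 := by
    have h2 : HasDerivAt (fun τ : ℝ => 2 * τ * inner ℝ h v) (2 * inner ℝ h v) 0 := by
      simpa using ((hasDerivAt_id (0 : ℝ)).const_mul 2).mul_const (inner ℝ h v)
    have h3 : HasDerivAt (fun τ : ℝ => τ ^ 2 * ‖v‖ ^ 2) 0 0 := by
      simpa using! ((hasDerivAt_id (0 : ℝ)).pow 2).mul_const (‖v‖ ^ 2)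
    simpa using! ((h2.const_add (‖h‖ ^ 2)).add h3).const_add (ξ ^ 2)
  have h0 : ξ ^ 2 + (‖h‖ ^ 2 + 2 * (0 : ℝ) * inner ℝ h v + 0 ^ 2 * ‖v‖ ^ 2)
      = upperNorm ξ h ^ 2 := by
    rw [upperNorm_sq]; ring
  have h4 := (h1.rpow_const (p := α / 2) (Or.inl (by rw [h0]; positivity))).const_mul A
  convert! h4 using 1
  rw [h0, ← Real.rpow_natCast, ← Real.rpow_mul hρ.le]
  push_cast
  rw [show 2 * (α / 2 - 1) = α - 2 by ring]
  ring

lemma hasDerivWithinAt_upperNorm_time {ξ : ℝ → ℝ} {ξ' A α t : ℝ} {s : Set ℝ} (hξ : 0 < ξ t)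
    (hd : HasDerivWithinAt ξ ξ' s t) (h : Plane) :
    HasDerivWithinAt (fun τ => A * upperNorm (ξ τ) h ^ α)
      (A * α * upperNorm (ξ t) h ^ (α - 2) * (ξ t * ξ')) s t := by
  have hρ := upperNorm_pos hξ h
  have hn (τ : ℝ) : upperNorm (ξ τ) h ^ α = (ξ τ ^ 2 + ‖h‖ ^ 2) ^ (α / 2) := by
    rw [upperNorm, Real.sqrt_eq_rpow, ← Real.rpow_mul (by positivity)]
    ring_nf
  simp only [hn]
  have h1 : HasDerivWithinAt (fun τ => ξ τ ^ 2 + ‖h‖ ^ 2) (2 * ξ t * ξ') s t := by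
    simpa using! (hd.pow 2).add_const (‖h‖ ^ 2)
  have h4 := (h1.rpow_const (p := α / 2)
    (Or.inl (by have := upperNorm_sq (ξ t) h; rw [← this]; positivity))).const_mul A
  convert! h4 using 1
  rw [← upperNorm_sq, ← Real.rpow_natCast, ← Real.rpow_mul hρ.le]
  push_cast
  rw [show 2 * (α / 2 - 1) = α - 2 by ring]
  ring

/-- A one-sided derivative at a maximum from the left is nonnegative. -/
lemma deriv_nonneg_of_left_max {F : ℝ → ℝ} {d t T : ℝ} (ht : 0 < t) (htT : t ≤ T)
    (hF : HasDerivWithinAt F d (Icc 0 T) t) (hle : ∀ s ∈ Icc 0 t, F s ≤ F t) : 0 ≤ d := by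
  have h1 : HasDerivWithinAt F d (Ioo 0 t) t :=
    hF.mono fun s hs => ⟨hs.1.le, hs.2.le.trans htT⟩
  have h2 := (hasDerivWithinAt_iff_tendsto_slope' (by simp)).1 h1
  have : (𝓝[Ioo 0 t] t).NeBot := by
    rw [nhdsWithin_Ioo_eq_nhdsLT ht]; infer_instance
  refine ge_of_tendsto h2 ?_
  filter_upwards [self_mem_nhdsWithin] with s hs
  rw [slope_def_field]
  exact div_nonneg_of_nonpos (by linarith [hle s ⟨hs.1.le, hs.2.le⟩]) (by linarith [hs.2])

namespace Touches

variable {θ : Plane → ℝ} {A ξ α : ℝ} {x h : Plane}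

/-- First-order condition in the increment, the base point being fixed. -/
lemma fderiv_add_apply (H : Touches θ A ξ α x h) (v : Plane) :
    fderiv ℝ θ (x + h) v = A * α * upperNorm ξ h ^ (α - 2) * inner ℝ h v := by
  have h1 : HasDerivAt (fun τ : ℝ => θ (x + h + τ • v)) (fderiv ℝ θ (x + h) v) 0 :=
    ((H.smooth.differentiable (by simp)) (x + h)).hasFDerivAt.hasLineDerivAt v
  have h2 := h1.sub (hasDerivAt_upperNorm_line A ξ α H.xi_pos h v)
  have hmax : IsLocalMax ((fun τ : ℝ => θ (x + h + τ • v))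
      - fun τ : ℝ => A * upperNorm ξ (h + τ • v) ^ α) 0 := by
    refine Eventually.of_forall fun τ => ?_
    have h3 := H.modulus x (h + τ • v)
    have h4 := H.touch
    simp only [Pi.sub_apply, zero_smul, add_zero]
    rw [← add_assoc] at h3
    linarith
  have := hmax.hasDerivAt_eq_zero h2
  linarith

/-- First-order condition in the base point, the increment being fixed. -/
lemma fderiv_eq (H : Touches θ A ξ α x h) : fderiv ℝ θ x = fderiv ℝ θ (x + h) := by
  have hdif := H.smooth.differentiable (by simp)
  have h1 : HasFDerivAt (fun z => θ (z + h)) (fderiv ℝ θ (x + h)) x :=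
    (hasFDerivAt_comp_add_right h).2 (hdif (x + h)).hasFDerivAt
  have h2 := h1.sub (hdif x).hasFDerivAt
  have hmax : IsLocalMax ((fun z => θ (z + h)) - θ) x := by
    refine Eventually.of_forall fun z => ?_
    have h3 := H.modulus z h
    have h4 := H.touch
    simp only [Pi.sub_apply]
    linarith
  have := hmax.hasFDerivAt_eq_zero h2
  exact (sub_eq_zero.1 this).symm

/-- The transport term at the touching point is controlled by the dissipation. -/
lemma transport_le {a κ : ℝ} (H : Touches θ A ξ α x h) (ha : 0 < a) (ha1 : a ≤ 1)
    (hκ : Real.exp 1 ≤ κ) (hρ6 : upperNorm ξ h ≤ 6) :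
    |fderiv ℝ θ (x + h) (rieszPerp θ (x + h)) - fderiv ℝ θ x (rieszPerp θ x)|
      ≤ 2 * velConst a κ * α * (A * upperNorm ξ h ^ α * logWeight κ (upperNorm ξ h) ^ a)
        * (diffusion a κ θ (x + h) - diffusion a κ θ x) := by
  have hρ := upperNorm_pos H.xi_pos h
  have hA := H.A_pos
  have hα := H.alpha_pos
  have hh := norm_le_upperNorm ξ h
  have r0 := H.abs_riesz_sub_le ha ha1 hκ hρ6 0
  have r1 := H.abs_riesz_sub_le ha ha1 hκ hρ6 1
  -- With equal gradients at both points, the transport difference is one gradient applied to the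
  -- velocity increment.
  rw [H.fderiv_eq, ← map_sub, H.fderiv_add_apply]
  have hin : inner ℝ h (rieszPerp θ (x + h) - rieszPerp θ x)
      = h 0 * (riesz 1 θ (x + h) - riesz 1 θ x) - h 1 * (riesz 0 θ (x + h) - riesz 0 θ x) := by
    simp [PiLp.inner_apply, Fin.sum_univ_two, rieszPerp]
    ring
  rw [hin, abs_mul, abs_of_pos (show 0 < A * α * upperNorm ξ h ^ (α - 2) by positivity)]
  set ρ := upperNorm ξ h
  set Λ := diffusion a κ θ (x + h) - diffusion a κ θ x
  have h0 := (abs_apply_le_norm h 0).trans hh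
  have h1 := (abs_apply_le_norm h 1).trans hh
  have e : ρ ^ (α - 2) * (ρ * ρ) = ρ ^ α := by
    rw [Real.rpow_sub hρ, Real.rpow_two]; field_simp
  have hb : |h 0 * (riesz 1 θ (x + h) - riesz 1 θ x) - h 1 * (riesz 0 θ (x + h) - riesz 0 θ x)|
      ≤ ρ * (velConst a κ * (Λ * (ρ * logWeight κ ρ ^ a)))
        + ρ * (velConst a κ * (Λ * (ρ * logWeight κ ρ ^ a))) := by
    refine (abs_sub _ _).trans ?_
    rw [abs_mul, abs_mul]
    gcongr
  calc A * α * ρ ^ (α - 2) * _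
      ≤ A * α * ρ ^ (α - 2) * (ρ * (velConst a κ * (Λ * (ρ * logWeight κ ρ ^ a)))
        + ρ * (velConst a κ * (Λ * (ρ * logWeight κ ρ ^ a)))) := by gcongr
    _ = 2 * velConst a κ * α * (A * (ρ ^ (α - 2) * (ρ * ρ)) * logWeight κ ρ ^ a) * Λ := by ring
    _ = _ := by rw [e]

end Touches

/-! ### The moving modulus of continuity -/

lemma exists_reduced_increment (h : Plane) :
    ∃ n, (∀ i, (h + latticeVec n) i ∈ Icc (-Real.pi) Real.pi) ∧ ‖h + latticeVec n‖ ≤ ‖h‖ := by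
  obtain ⟨n, hn⟩ := exists_latticeVec_mem (-Real.pi) h
  have hn' (i : Fin 2) : (h + latticeVec n) i ∈ Icc (-Real.pi) Real.pi :=
    ⟨(hn i).1, by linarith [(hn i).2]⟩
  refine ⟨n, hn', ?_⟩
  rw [EuclideanSpace.norm_eq, EuclideanSpace.norm_eq]
  refine Real.sqrt_le_sqrt (Finset.sum_le_sum fun i _ => ?_)
  rw [Real.norm_eq_abs, Real.norm_eq_abs]
  refine pow_le_pow_left₀ (abs_nonneg _) ?_ 2
  have hpi := Real.pi_pos
  rcases eq_or_ne (n i) 0 with h0 | h0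
  · simp [latticeVec_apply, h0]
  · have h1 : |(h + latticeVec n) i| ≤ Real.pi := abs_le.2 (hn' i)
    have h2 : (1 : ℝ) ≤ |(n i : ℝ)| := by exact_mod_cast Int.one_le_abs h0
    have h3 : 2 * Real.pi * |(n i : ℝ)| ≤ |(h + latticeVec n) i| + |h i| := by
      have e : 2 * Real.pi * (n i : ℝ) = (h + latticeVec n) i - h i := by
        simp [latticeVec_apply]
      rw [← abs_of_pos (show 0 < 2 * Real.pi by positivity), ← abs_mul, e]
      exact abs_sub _ _
    nlinarith

/-- `2² + 2 π² < 36`. -/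
lemma upperNorm_le_six {ξ : ℝ} (hξ0 : 0 ≤ ξ) (hξ : ξ ≤ 2) {h : Plane}
    (hh : ∀ i, h i ∈ Icc (-Real.pi) Real.pi) : upperNorm ξ h ≤ 6 := by
  have hpi := Real.pi_lt_four
  refine Real.sqrt_le_iff.2 ⟨by norm_num, ?_⟩
  rw [EuclideanSpace.norm_eq, Real.sq_sqrt (by positivity), Fin.sum_univ_two, Real.norm_eq_abs,
    Real.norm_eq_abs, sq_abs, sq_abs]
  have h3 := Real.pi_lt_d2
  have hi (i : Fin 2) : h i ^ 2 ≤ Real.pi ^ 2 := sq_le_sq' (hh i).1 (hh i).2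
  nlinarith [hi 0, hi 1, Real.pi_pos]

namespace IsSmoothSolution

variable {a κ T : ℝ} {f : Plane → ℝ} {θ : ℝ → Plane → ℝ}

lemma contDiff (hθ : IsSmoothSolution a κ f T θ) {t : ℝ} (ht : t ∈ Icc 0 T) :
    ContDiff ℝ (⊤ : ℕ∞) (θ t) := by
  have h1 : ContDiffOn ℝ (⊤ : ℕ∞) (fun x : Plane => ((t, x) : ℝ × Plane)) univ := by fun_prop
  have h2 := hθ.smooth.comp h1 fun x _ => ⟨ht, mem_univ _⟩
  exact contDiffOn_univ.1 h2

lemma continuousOn_time (hθ : IsSmoothSolution a κ f T θ) (x : Plane) :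
    ContinuousOn (fun t => θ t x) (Icc 0 T) :=
  fun t ht => (hθ.equation t ht x).continuousWithinAt

/-- Hypotheses under which the modulus `A (ξ(t)² + |h|²)^{α/2}` is never touched. -/
structure Barrier (a κ T M A α : ℝ) (ξ ξ' : ℝ → ℝ) : Prop where
  A_pos : 0 < A
  alpha_pos : 0 < α
  alpha_le : α ≤ 1 / 2
  xi_pos : ∀ t ∈ Icc 0 T, 0 < ξ t
  xi_le : ∀ t ∈ Icc 0 T, ξ t ≤ 2
  hasDeriv : ∀ t ∈ Icc 0 T, HasDerivAt ξ (-ξ' t) t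
  deriv_nonneg : ∀ t ∈ Icc 0 T, 0 ≤ ξ' t
  initial : 2 * M < A * ξ 0 ^ α
  force : ∀ ρ, 0 < ρ → ρ ≤ 6 → 8 * M * (ρ ^ (1 - α) * logWeight κ ρ ^ a) ≤ dissConst a κ * A
  transport : ∀ ρ, 0 < ρ → ρ ≤ 6 →
    2 * velConst a κ * α * (A * ρ ^ α * logWeight κ ρ ^ a) ≤ 1 / 4
  shrink : ∀ t ∈ Icc 0 T, α * ξ' t * logWeight κ (ξ t) ^ a ≤ dissConst a κ / 4

/-- A modulus satisfying the hypotheses of a barrier cannot be touched at a positive time. -/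
lemma Barrier.not_touch {M A α : ℝ} {ξ ξ' : ℝ → ℝ} (hB : Barrier a κ T M A α ξ ξ')
    (hθ : IsSmoothSolution a κ f T θ) (hf : IsForcing f) (ha : 0 < a) (ha1 : a ≤ 1)
    (hκ : Real.exp 1 ≤ κ) (hM : supNorm f ≤ M) {t : ℝ} (ht0 : 0 < t) (htT : t ≤ T) {x h : Plane}
    (H : Touches (θ t) A (ξ t) α x h) (hρ6 : upperNorm (ξ t) h ≤ 6)
    (hpast : ∀ s ∈ Icc 0 t, θ s (x + h) - θ s x ≤ A * upperNorm (ξ s) h ^ α) : False := by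
  have ht : t ∈ Icc 0 T := ⟨ht0.le, htT⟩
  have hA := hB.A_pos
  have hα := hB.alpha_pos
  have hξ := hB.xi_pos t ht
  have hρ := upperNorm_pos hξ h
  have hdiss := H.dissipation_lower ha ha1 hκ hρ6
  have htr := H.transport_le ha ha1 hκ hρ6
  have hc1 := dissConst_pos (κ := κ) ha
  have hξρ : ξ t ≤ upperNorm (ξ t) h := le_upperNorm _ _
  have hl := one_le_logWeight hκ hρ
  have hlξ := logWeight_anti hκ hξ hξρ
  have hforce := hB.force _ hρ hρ6
  have htrans := hB.transport _ hρ hρ6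
  have hshrink := hB.shrink t ht
  have hξ' := hB.deriv_nonneg t ht
  have hΛ0 := H.diffusion_sub_nonneg ha ha1 hκ
  -- The increment minus the modulus is nonpositive on `[0,t]` and vanishes at `t`. Only times
  -- before `t` are used, which covers `t = T`.
  have hdt := deriv_nonneg_of_left_max ht0 htT
    (((hθ.equation t ht (x + h)).sub (hθ.equation t ht x)).sub
      (hasDerivWithinAt_upperNorm_time (A := A) (α := α) hξ
        (hB.hasDeriv t ht).hasDerivWithinAt h)) (fun s hs => by
      have h1 := hpast s hs
      have h2 := H.touch
      simp only [Pi.sub_apply]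
      linarith)
  have hf1 := hf.periodic.abs_le_supNorm hf.smooth.continuous (x + h)
  have hf2 := hf.periodic.abs_le_supNorm hf.smooth.continuous x
  set ρ := upperNorm (ξ t) h
  set Λ := diffusion a κ (θ t) (x + h) - diffusion a κ (θ t) x with hΛ
  set L := logWeight κ ρ ^ a with hL
  have hL1 : 0 < L := Real.rpow_pos_of_pos (by linarith) _
  have hG : 0 < A * ρ ^ α := by positivity
  have hΛpos : 0 < Λ := by
    by_contra hcon
    have : Λ * (ρ * L) ≤ 0 := mul_nonpos_of_nonpos_of_nonneg (not_lt.1 hcon) (by positivity)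
    have : 0 < dissConst a κ * (A * ρ ^ α) := by positivity
    linarith
  have e1 : ρ ^ (1 - α) * ρ ^ α = ρ := by
    rw [← Real.rpow_add hρ]; simp
  -- Forcing, transport and the motion of the scale each cost at most `Λ / 4`, so the time
  -- derivative is at most `-Λ / 4`, a contradiction.
  have hfM : 2 * M ≤ Λ / 4 := by
    have h1 : 8 * M * (ρ ^ (1 - α) * L) * ρ ^ α ≤ Λ * (ρ * L) := by
      calc _ ≤ dissConst a κ * A * ρ ^ α := mul_le_mul_of_nonneg_right hforce (by positivity)
        _ = dissConst a κ * (A * ρ ^ α) := by ring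
        _ ≤ _ := hdiss
    have h2 : 8 * M * (ρ ^ (1 - α) * L) * ρ ^ α = 8 * M * (ρ * L) := by
      calc _ = 8 * M * (ρ ^ (1 - α) * ρ ^ α * L) := by ring
        _ = _ := by rw [e1]
    rw [h2] at h1
    have := le_of_mul_le_mul_right h1 (by positivity)
    linarith
  have htr' : |fderiv ℝ (θ t) (x + h) (rieszPerp (θ t) (x + h))
      - fderiv ℝ (θ t) x (rieszPerp (θ t) x)| ≤ Λ / 4 := by
    refine htr.trans ?_
    have := mul_le_mul_of_nonneg_right htrans hΛpos.le
    linarith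
  have hsh : A * α * ρ ^ (α - 2) * (ξ t * ξ' t) ≤ Λ / 4 := by
    have e2 : ρ ^ (α - 2) * ρ = ρ ^ α / ρ := by
      rw [Real.rpow_sub hρ, Real.rpow_two]; field_simp
    have h1 : A * α * ρ ^ (α - 2) * (ξ t * ξ' t) ≤ A * α * (ρ ^ α / ρ) * ξ' t := by
      calc A * α * ρ ^ (α - 2) * (ξ t * ξ' t) ≤ A * α * ρ ^ (α - 2) * (ρ * ξ' t) := by gcongr
        _ = A * α * (ρ ^ (α - 2) * ρ) * ξ' t := by ring
        _ = _ := by rw [e2]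
    -- `ξ(t) ≤ ρ`, so the weight at the scale dominates the weight at `ρ`.
    have h2 : α * ξ' t * L ≤ dissConst a κ / 4 := by
      refine le_trans (mul_le_mul_of_nonneg_left ?_ (by positivity)) hshrink
      exact Real.rpow_le_rpow (by linarith) hlξ ha.le
    have h3 : A * α * (ρ ^ α / ρ) * ξ' t * (ρ * L) ≤ Λ / 4 * (ρ * L) := by
      calc A * α * (ρ ^ α / ρ) * ξ' t * (ρ * L) = A * ρ ^ α * (α * ξ' t * L) := by field_simp
        _ ≤ A * ρ ^ α * (dissConst a κ / 4) := by gcongr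
        _ = dissConst a κ * (A * ρ ^ α) / 4 := by ring
        _ ≤ Λ * (ρ * L) / 4 := by gcongr
        _ = _ := by ring
    exact h1.trans (le_of_mul_le_mul_right h3 (by positivity))
  have k1 := _root_.abs_le.1 hf1
  have k2 := _root_.abs_le.1 hf2
  have k3 := _root_.abs_le.1 htr'
  simp only [mul_neg] at hdt
  linarith [k1.2, k2.1, k3.1]

/-- The increments of the solution stay strictly below the moving modulus of continuity. -/
lemma Barrier.lt_modulus {M A α : ℝ} {ξ ξ' : ℝ → ℝ} (hB : Barrier a κ T M A α ξ ξ')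
    (hθ : IsSmoothSolution a κ f T θ) (hf : IsForcing f) (ha : 0 < a) (ha1 : a ≤ 1)
    (hκ : Real.exp 1 ≤ κ) (hM : supNorm (θ 0) + supNorm f ≤ M) {t : ℝ} (ht : t ∈ Icc 0 T)
    (x h : Plane) : θ t (x + h) - θ t x < A * upperNorm (ξ t) h ^ α := by
  have hA := hB.A_pos
  have hα := hB.alpha_pos
  have h0T : (0 : ℝ) ∈ Icc 0 T := ⟨le_rfl, ht.1.trans ht.2⟩
  have hcontξ : ContinuousOn ξ (Icc 0 T) := fun s hs =>
    (hB.hasDeriv s hs).continuousAt.continuousWithinAt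
  by_contra hcon
  rw [not_lt] at hcon
  let K : Set (ℝ × Plane × Plane) := Icc 0 T ×ˢ ({x : Plane | ∀ i, x i ∈ Icc 0 (2 * Real.pi)} ×ˢ
    {h : Plane | ∀ i, h i ∈ Icc (-Real.pi) Real.pi})
  have hK : IsCompact K := isCompact_Icc.prod ((isCompact_box _ _).prod (isCompact_box _ _))
  let F : ℝ × Plane × Plane → ℝ := fun p =>
    θ p.1 (p.2.1 + p.2.2) - θ p.1 p.2.1 - A * upperNorm (ξ p.1) p.2.2 ^ α
  have hFc : ContinuousOn F K := by
    have c1 : ContinuousOn (fun p : ℝ × Plane × Plane => θ p.1 (p.2.1 + p.2.2)) K :=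
      hθ.smooth.continuousOn.comp (f := fun p : ℝ × Plane × Plane => (p.1, p.2.1 + p.2.2))
        (by fun_prop) fun p hp => ⟨hp.1, mem_univ _⟩
    have c2 : ContinuousOn (fun p : ℝ × Plane × Plane => θ p.1 p.2.1) K :=
      hθ.smooth.continuousOn.comp (f := fun p : ℝ × Plane × Plane => (p.1, p.2.1))
        (by fun_prop) fun p hp => ⟨hp.1, mem_univ _⟩
    have c3 : ContinuousOn (fun p : ℝ × Plane × Plane => ξ p.1) K :=
      hcontξ.comp (by fun_prop) fun p hp => hp.1
    have c4 : ContinuousOn (fun p : ℝ × Plane × Plane => upperNorm (ξ p.1) p.2.2) K := by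
      unfold upperNorm
      exact ((c3.pow 2).add (by fun_prop)).sqrt
    exact (c1.sub c2).sub ((c4.rpow_const fun p _ => Or.inr hα.le).const_mul A)
  let S : Set (ℝ × Plane × Plane) := K ∩ F ⁻¹' Ici 0
  have hS : IsCompact S :=
    hK.of_isClosed_subset (hFc.preimage_isClosed_of_isClosed hK.isClosed isClosed_Ici)
      inter_subset_left
  -- Any violation can be moved into the compact `K`: lattice shifts do not change the increment of
  -- `θ`, and shortening `k` only lowers the modulus.
  have hred : ∀ s ∈ Icc 0 T, ∀ y k : Plane, A * upperNorm (ξ s) k ^ α ≤ θ s (y + k) - θ s y →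
      ∃ y' k', (s, y', k') ∈ S := by
    intro s hs y k hyk
    obtain ⟨n, hn, hnorm⟩ := exists_reduced_increment k
    obtain ⟨m, hm⟩ := exists_latticeVec_mem 0 y
    refine ⟨y + latticeVec m, k + latticeVec n, ⟨hs, fun i => ?_, hn⟩, ?_⟩
    · have := hm i
      rw [zero_add] at this
      exact Ico_subset_Icc_self this
    · have hper := hθ.periodic s hs
      have e1 : θ s (y + latticeVec m + (k + latticeVec n)) = θ s (y + k) := by
        rw [show y + latticeVec m + (k + latticeVec n) = y + k + latticeVec m + latticeVec n by abel,
          periodic_latticeVec hper, periodic_latticeVec hper]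
      have hmono : upperNorm (ξ s) (k + latticeVec n) ≤ upperNorm (ξ s) k :=
        Real.sqrt_le_sqrt (by gcongr)
      have h1 : upperNorm (ξ s) (k + latticeVec n) ^ α ≤ upperNorm (ξ s) k ^ α :=
        Real.rpow_le_rpow (Real.sqrt_nonneg _) hmono hα.le
      have h2 := mul_le_mul_of_nonneg_left h1 hA.le
      simp only [mem_preimage, mem_Ici, F]
      rw [e1, periodic_latticeVec hper]
      linarith
  obtain ⟨x₀, h₀, hmem⟩ := hred t ht x h hcon
  -- Minimising time over the compact set of violations gives the first touching time.
  obtain ⟨⟨t₁, x₁, h₁⟩, hS₁, hmin⟩ := hS.exists_isMinOn ⟨_, hmem⟩ continuous_fst.continuousOn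
  have ht₁ : t₁ ∈ Icc 0 T := hS₁.1.1
  have hh₁ : ∀ i, h₁ i ∈ Icc (-Real.pi) Real.pi := hS₁.1.2.2
  have hF₁ : 0 ≤ F (t₁, x₁, h₁) := hS₁.2
  have hbefore : ∀ s ∈ Icc 0 T, s < t₁ → ∀ y k : Plane,
      θ s (y + k) - θ s y < A * upperNorm (ξ s) k ^ α := by
    intro s hs hst y k
    by_contra hc
    obtain ⟨y', k', hyk⟩ := hred s hs y k (not_lt.1 hc)
    exact absurd (hmin hyk) (not_le.2 hst)
  have ht₁pos : 0 < t₁ := by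
    refine lt_of_le_of_ne ht₁.1 fun h0 => ?_
    subst h0
    have hc0 := (hθ.contDiff h0T).continuous
    have b1 := (hθ.periodic 0 h0T).abs_le_supNorm hc0 (x₁ + h₁)
    have b2 := (hθ.periodic 0 h0T).abs_le_supNorm hc0 x₁
    have b3 : 0 ≤ supNorm f := (abs_nonneg _).trans
      (hf.periodic.abs_le_supNorm hf.smooth.continuous 0)
    have b4 := hB.initial
    have b5 : ξ 0 ^ α ≤ upperNorm (ξ 0) h₁ ^ α :=
      Real.rpow_le_rpow (hB.xi_pos 0 h0T).le (le_upperNorm _ _) hα.le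
    have b6 := mul_le_mul_of_nonneg_left b5 hA.le
    simp only [F] at hF₁
    linarith [(_root_.abs_le.1 b1).2, (_root_.abs_le.1 b2).1]
  have hat : ∀ y k : Plane, θ t₁ (y + k) - θ t₁ y ≤ A * upperNorm (ξ t₁) k ^ α := by
    intro y k
    have c1 := (hθ.continuousOn_time (y + k)).sub (hθ.continuousOn_time y)
    have c2 : ContinuousOn (fun s => A * upperNorm (ξ s) k ^ α) (Icc 0 T) := by
      unfold upperNorm
      exact ((((hcontξ.pow 2).add continuousOn_const).sqrt).rpow_const
        fun p _ => Or.inr hα.le).const_mul A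
    have hsub : Ioo 0 t₁ ⊆ Icc 0 T := fun s hs => ⟨hs.1.le, hs.2.le.trans ht₁.2⟩
    have : (𝓝[Ioo 0 t₁] t₁).NeBot := by
      rw [nhdsWithin_Ioo_eq_nhdsLT ht₁pos]; infer_instance
    refine le_of_tendsto_of_tendsto ((c1 t₁ ht₁).mono hsub) ((c2 t₁ ht₁).mono hsub) ?_
    filter_upwards [self_mem_nhdsWithin] with s hs
    exact (hbefore s (hsub hs) hs.2 y k).le
  have hf0 : 0 ≤ supNorm (θ 0) := (abs_nonneg _).trans
    ((hθ.periodic 0 h0T).abs_le_supNorm (hθ.contDiff h0T).continuous 0)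
  refine hB.not_touch hθ hf ha ha1 hκ (by linarith) ht₁pos ht₁.2 (x := x₁) (h := h₁)
    ⟨hθ.periodic t₁ ht₁, hθ.contDiff ht₁, hA, hB.xi_pos t₁ ht₁, hα, hB.alpha_le, hat, ?_⟩
    (upperNorm_le_six (hB.xi_pos t₁ ht₁).le (hB.xi_le t₁ ht₁) hh₁) ?_
  · refine le_antisymm (hat _ _) ?_
    simp only [F] at hF₁
    linarith
  · intro s hs
    rcases hs.2.eq_or_lt with rfl | hlt
    · exact hat _ _
    · exact (hbefore s ⟨hs.1, hs.2.trans ht₁.2⟩ hlt _ _).le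

end IsSmoothSolution

/-! ### The time scale -/

section Phi

variable {a κ α : ℝ}

/-- The lower bound compares `φ` with the power `a` of the logarithm; the upper bound gives
integrability, the integrand being at most a constant times `s^{-p/2}` with `p/2 ≤ 3/4`. -/
lemma exponent_bounds (ha : 0 < a) (ha2 : a < 1 / 2) (hα2 : α ≤ 1 / 2) :
    a ≤ a * ((2 - α) / (1 - α)) ∧ a * ((2 - α) / (1 - α)) ≤ 3 / 2 := by
  have h1 : 1 ≤ (2 - α) / (1 - α) := by rw [le_div_iff₀ (by linarith)]; linarith
  have h2 : (2 - α) / (1 - α) ≤ 3 := by rw [div_le_iff₀ (by linarith)]; linarith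
  constructor <;> nlinarith

lemma intervalIntegrable_phi {p x : ℝ} (hκ : Real.exp 1 ≤ κ) (hp : 0 ≤ p) (hp2 : p ≤ 3 / 2)
    (hx : 0 < x) (hx1 : x ≤ 1) :
    IntervalIntegrable (fun s => Real.log (κ + (4 * s)⁻¹) ^ p) volume 0 x := by
  rw [intervalIntegrable_iff_integrableOn_Ioc_of_le hx.le]
  have hi : IntegrableOn (fun s : ℝ => (2 * logWeight κ 4) ^ p * s ^ (-(p / 2))) (Ioc 0 x) :=
    ((intervalIntegrable_iff_integrableOn_Ioc_of_le hx.le).1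
      (intervalIntegral.intervalIntegrable_rpow' (by linarith))).const_mul _
  refine Integrable.mono' hi (Measurable.aestronglyMeasurable (by fun_prop)) ?_
  filter_upwards [ae_restrict_mem measurableSet_Ioc] with s hs
  have hs0 : 0 < s := hs.1
  have h4 := one_le_logWeight hκ (show (0 : ℝ) < 4 by norm_num)
  have hl := one_le_logWeight hκ (show (0 : ℝ) < 4 * s by positivity)
  have h1 := logWeight_rpow_le (a := 1) one_pos le_rfl hκ (show 0 < 4 * s by positivity)
    (show 4 * s ≤ 4 by linarith [hs.2])
  rw [Real.rpow_one, Real.rpow_one] at h1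
  have h2 : Real.sqrt (4 / (4 * s)) = s ^ (-(1 / 2) : ℝ) := by
    rw [show 4 / (4 * s) = s⁻¹ by field_simp, Real.sqrt_eq_rpow, Real.inv_rpow hs0.le,
      Real.rpow_neg hs0.le]
  rw [h2] at h1
  change ‖logWeight κ (4 * s) ^ p‖ ≤ _
  rw [Real.norm_of_nonneg (Real.rpow_nonneg (by linarith) _)]
  calc logWeight κ (4 * s) ^ p ≤ (2 * s ^ (-(1 / 2) : ℝ) * logWeight κ 4) ^ p :=
        Real.rpow_le_rpow (by linarith) h1 hp
    _ = (2 * logWeight κ 4) ^ p * s ^ (-(p / 2)) := by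
        rw [show 2 * s ^ (-(1 / 2) : ℝ) * logWeight κ 4 = (2 * logWeight κ 4) * s ^ (-(1 / 2) : ℝ)
          by ring, Real.mul_rpow (by positivity) (by positivity), ← Real.rpow_mul hs0.le]
        ring_nf

/-- The integrand decreases in `s`, its exponent is at least `a`, and the logarithm is at least 1.
The barrier needs nothing else about `φ`. -/
lemma phi_lower (ha : 0 < a) (ha2 : a < 1 / 2) (hκ : Real.exp 1 ≤ κ)
    (hα2 : α ≤ 1 / 2) {x : ℝ} (hx : 0 < x) (hx1 : x ≤ 1) :
    x * logWeight κ (4 * x) ^ a ≤ phi a κ α x := by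
  obtain ⟨hp1, hp2⟩ := exponent_bounds ha ha2 hα2
  set p := a * ((2 - α) / (1 - α)) with hp
  have hi := intervalIntegrable_phi hκ (ha.le.trans hp1) hp2 hx hx1
  have hlx := one_le_logWeight hκ (show 0 < 4 * x by positivity)
  calc x * logWeight κ (4 * x) ^ a = ∫ _ in (0 : ℝ)..x, logWeight κ (4 * x) ^ a := by simp
    _ ≤ ∫ s in (0 : ℝ)..x, Real.log (κ + (4 * s)⁻¹) ^ p := by
        refine intervalIntegral.integral_mono_on_of_le_Ioo hx.le (by simp) hi fun s hs => ?_
        have hs0 : 0 < 4 * s := by linarith [hs.1]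
        have h1 := logWeight_anti hκ hs0 (show 4 * s ≤ 4 * x by linarith [hs.2])
        calc logWeight κ (4 * x) ^ a ≤ logWeight κ (4 * s) ^ a :=
              Real.rpow_le_rpow (by linarith) h1 ha.le
          _ ≤ logWeight κ (4 * s) ^ p :=
              Real.rpow_le_rpow_of_exponent_le (one_le_logWeight hκ hs0) hp1
    _ = phi a κ α x := rfl

end Phi

/-! ### The shrinking scale -/

/-- Squaring removes the corner of the positive part, so the scale is differentiable across `T_*`.
-/
lemma hasDerivAt_sq_posPart (y : ℝ) : HasDerivAt (fun z : ℝ => max z 0 ^ 2) (2 * max y 0) y := by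
  rcases lt_trichotomy y 0 with h | rfl | h
  · rw [max_eq_right h.le, mul_zero]
    refine (hasDerivAt_const y (0 : ℝ)).congr_of_eventuallyEq ?_
    filter_upwards [gt_mem_nhds h] with z hz
    simp [max_eq_right hz.le]
  · rw [max_self, mul_zero, hasDerivAt_iff_isLittleO]
    simp only [max_self, ne_eq, OfNat.ofNat_ne_zero, not_false_eq_true, zero_pow, sub_zero,
      smul_zero]
    refine Asymptotics.IsBigO.trans_isLittleO (g := fun z : ℝ => z ^ 2) ?_
      (Asymptotics.isLittleO_pow_id one_lt_two)
    refine Asymptotics.IsBigO.of_bound 1 (Eventually.of_forall fun z => ?_)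
    rw [one_mul, norm_pow, norm_pow]
    refine pow_le_pow_left₀ (norm_nonneg _) ?_ 2
    rw [Real.norm_eq_abs, Real.norm_eq_abs, abs_of_nonneg (le_max_right _ _)]
    exact max_le (le_abs_self z) (abs_nonneg z)
  · rw [max_eq_left h.le]
    have h1 : HasDerivAt (fun z : ℝ => z ^ 2) (2 * y) y := by simpa using hasDerivAt_pow 2 y
    refine h1.congr_of_eventuallyEq ?_
    filter_upwards [lt_mem_nhds h] with z hz
    simp [max_eq_left hz.le]

/-- The scale `ε + ξ₀ (1 - t/T)₊²`, which has shrunk to `ε` at time `T`. -/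
def shrinkScale (ε ξ₀ T t : ℝ) : ℝ := ε + ξ₀ * max (1 - t / T) 0 ^ 2

lemma hasDerivAt_shrinkScale (ε ξ₀ T t : ℝ) :
    HasDerivAt (shrinkScale ε ξ₀ T) (-(2 * ξ₀ * max (1 - t / T) 0 / T)) t := by
  have h1 : HasDerivAt (fun t : ℝ => 1 - t / T) (-(1 / T)) t := by
    simpa using ((hasDerivAt_id t).div_const T).const_sub 1
  have h2 := (((hasDerivAt_sq_posPart (1 - t / T)).comp t h1).const_mul ξ₀).const_add ε
  convert! h2 using 1
  ring

/-! ### The choice of constants -/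

section Constants

variable {a κ α : ℝ}

/-- `ρ^{1-α} ≤ 6 √ρ`, while slow variation loses only `2 √(6/ρ)`; the powers of `ρ` cancel, with
`√6` bounded crudely by 6. -/
lemma force_bound (ha : 0 < a) (ha1 : a ≤ 1) (hκ : Real.exp 1 ≤ κ) (hα : 0 < α) (hα2 : α ≤ 1 / 2)
    {ρ : ℝ} (hρ : 0 < ρ) (hρ6 : ρ ≤ 6) :
    ρ ^ (1 - α) * logWeight κ ρ ^ a ≤ 72 * logWeight κ 6 ^ a := by
  have h1 := logWeight_rpow_le ha ha1 hκ hρ hρ6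
  have h6 := one_le_logWeight hκ (show (0 : ℝ) < 6 by norm_num)
  have hl : 0 < logWeight κ 6 ^ a := Real.rpow_pos_of_pos (by linarith) _
  have h2 : ρ ^ (1 - α) ≤ Real.sqrt ρ * 6 := by
    have e : ρ ^ (1 - α) = ρ ^ (1 / 2 : ℝ) * ρ ^ (1 / 2 - α) := by
      rw [← Real.rpow_add hρ]; ring_nf
    rw [e, Real.sqrt_eq_rpow]
    refine mul_le_mul_of_nonneg_left ?_ (by positivity)
    calc ρ ^ (1 / 2 - α) ≤ 6 ^ (1 / 2 - α) := Real.rpow_le_rpow hρ.le hρ6 (by linarith)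
      _ ≤ 6 ^ (1 : ℝ) := Real.rpow_le_rpow_of_exponent_le (by norm_num) (by linarith)
      _ = 6 := Real.rpow_one 6
  have h3 : Real.sqrt ρ * Real.sqrt (6 / ρ) ≤ 6 := by
    rw [← Real.sqrt_mul hρ.le, mul_div_cancel₀ _ hρ.ne']
    exact Real.sqrt_le_iff.2 ⟨by norm_num, by norm_num⟩
  have hr : 0 ≤ logWeight κ ρ ^ a :=
    Real.rpow_nonneg (by linarith [one_le_logWeight hκ hρ]) _
  calc ρ ^ (1 - α) * logWeight κ ρ ^ a
      ≤ (Real.sqrt ρ * 6) * (2 * Real.sqrt (6 / ρ) * logWeight κ 6 ^ a) := by gcongr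
    _ = 12 * (Real.sqrt ρ * Real.sqrt (6 / ρ)) * logWeight κ 6 ^ a := by ring
    _ ≤ 12 * 6 * logWeight κ 6 ^ a := by gcongr
    _ = _ := by ring

/-- Here the restriction on `a` enters. With `K = 6κ + 1`, `log (κ + 1/ρ) ≤ (K/ρ)^α / α`; the power
`a ≤ 1/2` costs at most `α^{-1/2}`, so a factor `√α` survives, and `ρ^α` cancels. -/
lemma transport_bound (ha : 0 < a) (ha2 : a ≤ 1 / 2) (hκ : Real.exp 1 ≤ κ) (hα : 0 < α)
    (hα1 : α ≤ 1) {ρ : ℝ} (hρ : 0 < ρ) (hρ6 : ρ ≤ 6) :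
    α * (ρ ^ α * logWeight κ ρ ^ a) ≤ (6 * κ + 1) * Real.sqrt α := by
  have hκ0 : 0 < κ := (Real.exp_pos 1).trans_le hκ
  have hκ1 : 1 ≤ κ := le_trans (by simp) hκ
  set K := 6 * κ + 1 with hK
  have hK1 : 1 ≤ K := by linarith
  have hKρ : 1 ≤ K / ρ := (one_le_div hρ).2 (by linarith)
  have hl := one_le_logWeight hκ hρ
  have h1 : logWeight κ ρ ≤ (K / ρ) ^ α / α := by
    refine le_trans ?_ (Real.log_le_rpow_div (by positivity) hα)
    refine Real.log_le_log (by positivity) ?_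
    rw [le_div_iff₀ hρ, add_mul, inv_mul_cancel₀ hρ.ne', hK]
    nlinarith
  have h2 : logWeight κ ρ ^ a ≤ (K / ρ) ^ α * α ^ (-(1 / 2) : ℝ) := by
    calc logWeight κ ρ ^ a ≤ logWeight κ ρ ^ (1 / 2 : ℝ) :=
          Real.rpow_le_rpow_of_exponent_le hl ha2
      _ ≤ ((K / ρ) ^ α / α) ^ (1 / 2 : ℝ) := Real.rpow_le_rpow (by linarith) h1 (by norm_num)
      _ = ((K / ρ) ^ α) ^ (1 / 2 : ℝ) * α ^ (-(1 / 2) : ℝ) := by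
          rw [Real.div_rpow (by positivity) hα.le, Real.rpow_neg hα.le, div_eq_mul_inv]
      _ ≤ ((K / ρ) ^ α) ^ (1 : ℝ) * α ^ (-(1 / 2) : ℝ) := by
          refine mul_le_mul_of_nonneg_right ?_ (by positivity)
          exact Real.rpow_le_rpow_of_exponent_le (Real.one_le_rpow hKρ hα.le) (by norm_num)
      _ = _ := by rw [Real.rpow_one]
  have h3 : ρ ^ α * (K / ρ) ^ α = K ^ α := by
    rw [← Real.mul_rpow hρ.le (by positivity), mul_div_cancel₀ _ hρ.ne']
  have h4 : K ^ α ≤ K := by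
    have := Real.rpow_le_rpow_of_exponent_le hK1 hα1
    rwa [Real.rpow_one] at this
  have h5 : α * α ^ (-(1 / 2) : ℝ) = Real.sqrt α := by
    rw [Real.sqrt_eq_rpow, ← Real.rpow_one_add' hα.le (by norm_num)]
    norm_num
  calc α * (ρ ^ α * logWeight κ ρ ^ a)
      ≤ α * (ρ ^ α * ((K / ρ) ^ α * α ^ (-(1 / 2) : ℝ))) := by gcongr
    _ = (ρ ^ α * (K / ρ) ^ α) * (α * α ^ (-(1 / 2) : ℝ)) := by ring
    _ ≤ K * Real.sqrt α := by rw [h3, h5]; gcongr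

lemma Tstar_pos (ha : 0 < a) (ha2 : a < 1 / 2) (hκ : Real.exp 1 ≤ κ) (hα : 0 < α)
    (hα2 : α ≤ 1 / 2) {c ξ₀ : ℝ} (hc : 0 < c) (hξ : 0 < ξ₀) (hξ1 : ξ₀ ≤ 1) :
    0 < Tstar a κ c ξ₀ α := by
  have h1 := phi_lower ha ha2 hκ hα2 hξ hξ1
  have h2 := one_le_logWeight hκ (show 0 < 4 * ξ₀ by positivity)
  have h3 : 0 < logWeight κ (4 * ξ₀) ^ a := Real.rpow_pos_of_pos (by linarith) _
  have h4 : 0 < phi a κ α ξ₀ := lt_of_lt_of_le (by positivity) h1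
  unfold Tstar
  positivity

/-- The scale shrinks slowly enough for the dissipation. -/
lemma shrink_bound (ha : 0 < a) (ha2 : a < 1 / 2) (hκ : Real.exp 1 ≤ κ) (hα : 0 < α)
    (hα2 : α ≤ 1 / 2) {c ξ₀ ε t : ℝ} (hc : 0 < c) (hξ : 0 < ξ₀) (hξ1 : ξ₀ ≤ 1) (hε : 0 < ε)
    (ht : 0 ≤ t) :
    α * (2 * ξ₀ * max (1 - t / Tstar a κ c ξ₀ α) 0 / Tstar a κ c ξ₀ α)
      * logWeight κ (shrinkScale ε ξ₀ (Tstar a κ c ξ₀ α) t) ^ a ≤ 2 * c := by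
  have hT := Tstar_pos ha ha2 hκ hα hα2 hc hξ hξ1
  have h1 := phi_lower ha ha2 hκ hα2 hξ hξ1
  have h2 := one_le_logWeight hκ (show 0 < 4 * ξ₀ by positivity)
  have h3 : 0 < logWeight κ (4 * ξ₀) ^ a := Real.rpow_pos_of_pos (by linarith) _
  have h4 : 0 < phi a κ α ξ₀ := lt_of_lt_of_le (by positivity) h1
  rcases (le_max_right (1 - t / Tstar a κ c ξ₀ α) 0).eq_or_lt with h0 | hτ
  · rw [← h0]
    simp
    positivity
  have hτ1 : max (1 - t / Tstar a κ c ξ₀ α) 0 ≤ 1 :=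
    max_le (by have : 0 ≤ t / Tstar a κ c ξ₀ α := by positivity
               linarith) zero_le_one
  rw [shrinkScale]
  set τ := max (1 - t / Tstar a κ c ξ₀ α) 0
  have hu : 0 < ξ₀ * τ ^ 2 := by positivity
  have hτ2 : τ ^ 2 ≤ 1 := pow_le_one₀ hτ.le hτ1
  -- Comparing the scales `ξ₀ τ²` and `4 ξ₀` costs `√(4/τ²) = 2/τ`, cancelled by the factor `τ` in
  -- the derivative of the scale.
  have h5 : logWeight κ (ε + ξ₀ * τ ^ 2) ^ a ≤ 4 / τ * logWeight κ (4 * ξ₀) ^ a := by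
    have hle := logWeight_anti hκ hu (show ξ₀ * τ ^ 2 ≤ ε + ξ₀ * τ ^ 2 by linarith)
    have hl := one_le_logWeight hκ (show 0 < ε + ξ₀ * τ ^ 2 by positivity)
    have h6 := logWeight_rpow_le ha (by linarith) hκ hu (show ξ₀ * τ ^ 2 ≤ 4 * ξ₀ by nlinarith)
    have h7 : Real.sqrt (4 * ξ₀ / (ξ₀ * τ ^ 2)) = 2 / τ := by
      rw [show 4 * ξ₀ / (ξ₀ * τ ^ 2) = (2 / τ) ^ 2 by field_simp; norm_num,
        Real.sqrt_sq (by positivity)]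
    rw [h7] at h6
    calc _ ≤ logWeight κ (ξ₀ * τ ^ 2) ^ a := Real.rpow_le_rpow (by linarith) hle ha.le
      _ ≤ _ := h6
      _ = _ := by ring
  have h8 : α * (2 * ξ₀ * τ / Tstar a κ c ξ₀ α) = c * ξ₀ * τ / (2 * phi a κ α ξ₀) := by
    rw [Tstar]
    field_simp
    norm_num
  rw [h8]
  calc c * ξ₀ * τ / (2 * phi a κ α ξ₀) * logWeight κ (ε + ξ₀ * τ ^ 2) ^ a
      ≤ c * ξ₀ * τ / (2 * phi a κ α ξ₀) * (4 / τ * logWeight κ (4 * ξ₀) ^ a) := by gcongr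
    _ = 2 * c * (ξ₀ * logWeight κ (4 * ξ₀) ^ a / phi a κ α ξ₀) := by field_simp; norm_num
    _ ≤ 2 * c * 1 := by gcongr; exact (div_le_one h4).2 h1
    _ = _ := mul_one _

end Constants

/-- One-sided increments suffice because the two points can be exchanged. -/
lemma eHolderNorm_le_of_increments {α C : ℝ≥0} {g : Plane → ℝ}
    (h : ∀ x y : Plane, g (x + y) - g x ≤ C * ‖y‖ ^ (α : ℝ)) : eHolderNorm α g ≤ C := by
  refine iInf₂_le C fun x y => ?_
  have h1 := h y (x - y)
  have h2 := h x (y - x)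
  rw [add_sub_cancel] at h1 h2
  rw [norm_sub_rev] at h2
  have h3 : dist (g x) (g y) ≤ C * dist x y ^ (α : ℝ) := by
    rw [Real.dist_eq, dist_eq_norm]
    exact abs_le.2 ⟨by linarith, h1⟩
  rw [edist_dist, edist_dist, ENNReal.ofReal_rpow_of_nonneg dist_nonneg (NNReal.coe_nonneg α),
    ← ENNReal.ofReal_coe_nnreal, ← ENNReal.ofReal_mul (NNReal.coe_nonneg C)]
  exact ENNReal.ofReal_le_ofReal h3

/-! ### The barrier -/

/-- The coefficient of the modulus of continuity. -/
def holderBound (a κ M ξ₀ : ℝ) : ℝ :=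
  3 * M / ξ₀ + 576 * M * logWeight κ 6 ^ a / dissConst a κ

/-- The threshold below which the exponent is small enough for the transport term. -/
def maxExponent (a κ A : ℝ) : ℝ := (1 / (8 * velConst a κ * A * (6 * κ + 1) + 8)) ^ 2

variable {a κ M ξ₀ α : ℝ}

lemma logWeight_six_rpow_pos (hκ : Real.exp 1 ≤ κ) : 0 < logWeight κ 6 ^ a :=
  Real.rpow_pos_of_pos (one_pos.trans_le (one_le_logWeight hκ (by norm_num))) _

lemma holderBound_pos (ha : 0 < a) (hκ : Real.exp 1 ≤ κ) (hM : 0 < M) (hξ : 0 < ξ₀) :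
    0 < holderBound a κ M ξ₀ := by
  have h1 := logWeight_six_rpow_pos (a := a) hκ
  have h2 := dissConst_pos (κ := κ) ha
  unfold holderBound
  positivity

/-- The summand 8 in the denominator keeps the threshold below `1/64`. -/
lemma maxExponent_mem {A : ℝ} (ha : 0 < a) (hκ : 0 < κ) (hA : 0 < A) :
    maxExponent a κ A ∈ Ioo (0 : ℝ) (1 / 2) := by
  have h1 := velConst_pos (κ := κ) ha
  have h2 : 0 < 8 * velConst a κ * A * (6 * κ + 1) := by positivity
  refine ⟨by unfold maxExponent; positivity, ?_⟩
  rw [maxExponent, div_pow, one_pow]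
  exact one_div_lt_one_div_of_lt two_pos (by nlinarith)

lemma transport_le_of_le_maxExponent {A : ℝ} (ha : 0 < a) (ha2 : a ≤ 1 / 2)
    (hκ : Real.exp 1 ≤ κ) (hA : 0 < A) (hα : 0 < α) (hle : α ≤ maxExponent a κ A) {ρ : ℝ}
    (hρ : 0 < ρ) (hρ6 : ρ ≤ 6) :
    2 * velConst a κ * α * (A * ρ ^ α * logWeight κ ρ ^ a) ≤ 1 / 4 := by
  have hκ0 : 0 < κ := (Real.exp_pos 1).trans_le hκ
  have hV := velConst_pos (κ := κ) ha
  have h1 := transport_bound ha ha2 hκ hα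
    (hle.trans ((maxExponent_mem ha hκ0 hA).2.le.trans (by norm_num))) hρ hρ6
  have h2 : Real.sqrt α ≤ 1 / (8 * velConst a κ * A * (6 * κ + 1) + 8) :=
    Real.sqrt_le_iff.2 ⟨by positivity, hle⟩
  rw [le_div_iff₀ (by positivity)] at h2
  calc 2 * velConst a κ * α * (A * ρ ^ α * logWeight κ ρ ^ a)
      = 2 * velConst a κ * A * (α * (ρ ^ α * logWeight κ ρ ^ a)) := by ring
    _ ≤ 2 * velConst a κ * A * ((6 * κ + 1) * Real.sqrt α) := by gcongr
    _ ≤ 1 / 4 := by nlinarith [Real.sqrt_nonneg α]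

/-- The shrinking modulus of continuity is a barrier. -/
lemma barrier_shrinkScale {T ε : ℝ} (ha : 0 < a) (ha2 : a < 1 / 2) (hκ : Real.exp 1 ≤ κ)
    (hM : 0 < M) (hξ : 0 < ξ₀) (hξ1 : ξ₀ ≤ 1) (hα : 0 < α)
    (hle : α ≤ maxExponent a κ (holderBound a κ M ξ₀)) (hε : 0 < ε) (hε1 : ε ≤ 1) :
    IsSmoothSolution.Barrier a κ T M (holderBound a κ M ξ₀) α
      (shrinkScale ε ξ₀ (Tstar a κ (dissConst a κ / 8) ξ₀ α))
      (fun t => 2 * ξ₀ * max (1 - t / Tstar a κ (dissConst a κ / 8) ξ₀ α) 0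
        / Tstar a κ (dissConst a κ / 8) ξ₀ α) := by
  have hκ0 : 0 < κ := (Real.exp_pos 1).trans_le hκ
  have hc := dissConst_pos (κ := κ) ha
  have hA := holderBound_pos ha hκ hM hξ
  have hα2 : α ≤ 1 / 2 := hle.trans (maxExponent_mem ha hκ0 hA).2.le
  have hl6 := logWeight_six_rpow_pos (a := a) hκ
  have hT := Tstar_pos ha ha2 hκ hα hα2 (show 0 < dissConst a κ / 8 by positivity) hξ hξ1
  -- The first summand of the coefficient serves the initial data, the second the forcing, with `576
  -- = 8 · 72`.
  have hA1 : 3 * M ≤ holderBound a κ M ξ₀ * ξ₀ := by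
    rw [holderBound, add_mul, div_mul_cancel₀ _ hξ.ne']
    have : 0 ≤ 576 * M * logWeight κ 6 ^ a / dissConst a κ * ξ₀ := by positivity
    linarith
  have hA2 : 576 * M * logWeight κ 6 ^ a ≤ dissConst a κ * holderBound a κ M ξ₀ := by
    rw [holderBound, mul_add, mul_div_cancel₀ _ hc.ne']
    have : 0 ≤ dissConst a κ * (3 * M / ξ₀) := by positivity
    linarith
  refine ⟨hA, hα, hα2, fun t _ => ?_, fun t ht => ?_, fun t _ => hasDerivAt_shrinkScale _ _ _ t,
    fun t _ => ?_, ?_, fun ρ hρ hρ6 => ?_, fun ρ hρ hρ6 =>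
      transport_le_of_le_maxExponent ha ha2.le hκ hA hα hle hρ hρ6, fun t ht => ?_⟩
  · unfold shrinkScale
    positivity
  · have h0 : 0 ≤ t / Tstar a κ (dissConst a κ / 8) ξ₀ α := div_nonneg ht.1 hT.le
    have h1 : max (1 - t / Tstar a κ (dissConst a κ / 8) ξ₀ α) 0 ^ 2 ≤ 1 :=
      pow_le_one₀ (le_max_right _ _) (max_le (by linarith) zero_le_one)
    unfold shrinkScale
    nlinarith
  · positivity
  · have h0 : shrinkScale ε ξ₀ (Tstar a κ (dissConst a κ / 8) ξ₀ α) 0 = ε + ξ₀ := by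
      simp [shrinkScale]
    rw [h0]
    -- Using `ξ₀ ≤ ξ₀^α` keeps the coefficient independent of `α`.
    have h1 : ξ₀ ≤ (ε + ξ₀) ^ α := by
      calc ξ₀ = ξ₀ ^ (1 : ℝ) := (Real.rpow_one _).symm
        _ ≤ ξ₀ ^ α := Real.rpow_le_rpow_of_exponent_ge hξ hξ1 (by linarith)
        _ ≤ _ := Real.rpow_le_rpow hξ.le (by linarith) hα.le
    nlinarith
  · have h1 := force_bound ha (by linarith) hκ hα hα2 hρ hρ6
    nlinarith
  -- `c₀ = dissConst / 8` is chosen so that `2 c₀` is exactly the allowed `dissConst / 4`.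
  · refine (shrink_bound ha ha2 hκ hα hα2 (by positivity) hξ hξ1 hε ht.1).trans (by linarith)

lemma shrinkScale_of_le {ε T t : ℝ} (hT : 0 < T) (ht : T ≤ t) : shrinkScale ε ξ₀ T t = ε := by
  have h1 : 1 - t / T ≤ 0 := by linarith [(one_le_div hT).2 ht]
  rw [shrinkScale, max_eq_right h1]
  simp

/-- The limit of a family of moduli of continuity whose scale tends to `0`. -/
lemma le_of_forall_lt_upperNorm {A y : ℝ} {h : Plane} (hα : 0 ≤ α)
    (H : ∀ ε, 0 < ε → ε ≤ 1 → y < A * upperNorm ε h ^ α) : y ≤ A * ‖h‖ ^ α := by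
  have hc : Continuous fun ε : ℝ => A * upperNorm ε h ^ α := by
    unfold upperNorm
    exact continuous_const.mul
      ((by fun_prop : Continuous fun ε : ℝ => Real.sqrt (ε ^ 2 + ‖h‖ ^ 2)).rpow_const
        fun _ => Or.inr hα)
  have h0 : A * upperNorm 0 h ^ α = A * ‖h‖ ^ α := by simp [upperNorm]
  have hlim : Tendsto (fun ε : ℝ => A * upperNorm ε h ^ α) (𝓝[>] 0) (𝓝 (A * ‖h‖ ^ α)) :=
    h0 ▸ (hc.tendsto 0).mono_left nhdsWithin_le_nhds
  refine ge_of_tendsto hlim ?_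
  filter_upwards [Ioc_mem_nhdsGT one_pos] with ε hε
  exact (H ε hε.1 hε.2).le

end LogSQG

end

/-- A priori Hölder estimate for the forced logarithmically supercritical SQG equation.
`eHolderNorm α (θ t)` is the `C^α` seminorm, `sup_{x ≠ y} |θ(t,x) - θ(t,y)| / |x - y| ^ α`. -/
theorem proposition3p2 (κ : ℝ) (hκ : Real.exp 1 ≤ κ) (a : ℝ) (ha0 : 0 < a) (ha : a < 1 / 2) :
    ∃ c₀ > (0 : ℝ), ∃ X₀ ∈ Set.Ioo (0 : ℝ) 1,
      ∀ M > (0 : ℝ), ∀ ξ₀ ∈ Set.Ioo (0 : ℝ) X₀,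
        ∃ α₀ ∈ Set.Ioo (0 : ℝ) (1 / 2), ∃ C : ℝ≥0,
          ∀ α : ℝ≥0, 0 < α → (α : ℝ) ≤ α₀ →
            ∀ (f : LogSQG.Plane → ℝ) (T : ℝ) (θ : ℝ → LogSQG.Plane → ℝ),
              LogSQG.IsForcing f →
              LogSQG.Tstar a κ c₀ ξ₀ α ≤ T →
              LogSQG.IsSmoothSolution a κ f T θ →
              LogSQG.supNorm (θ 0) + LogSQG.supNorm f ≤ M →
              ∀ t ∈ Set.Icc (LogSQG.Tstar a κ c₀ ξ₀ α) T,
                eHolderNorm α (θ t) ≤ (C : ℝ≥0∞) := by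
  have hκ0 : 0 < κ := (Real.exp_pos 1).trans_le hκ
  have hc := LogSQG.dissConst_pos (κ := κ) ha0
  -- The barrier only requires `ξ₀ ≤ 1`; `X₀ = 1/2` is a convenient choice.
  refine ⟨LogSQG.dissConst a κ / 8, by positivity, 1 / 2, ⟨by norm_num, by norm_num⟩,
    fun M hM ξ₀ hξ₀ => ?_⟩
  have hξ1 : ξ₀ ≤ 1 := hξ₀.2.le.trans (by norm_num)
  have hA := LogSQG.holderBound_pos ha0 hκ hM hξ₀.1
  refine ⟨_, LogSQG.maxExponent_mem ha0 hκ0 hA, ⟨_, hA.le⟩,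
    fun α hα hαle f T θ hf _ hθ hdata t ht => ?_⟩
  have hα0 : (0 : ℝ) < α := hα
  have hT := LogSQG.Tstar_pos ha0 ha hκ hα0
    (hαle.trans (LogSQG.maxExponent_mem ha0 hκ0 hA).2.le)
    (show 0 < LogSQG.dissConst a κ / 8 by positivity) hξ₀.1 hξ1
  -- From `T_*` on the scale equals `ε`, and `A` and `α₀` do not depend on `ε`, so `ε → 0` is free.
  refine LogSQG.eHolderNorm_le_of_increments fun x h =>
    LogSQG.le_of_forall_lt_upperNorm hα0.le fun ε hε hε1 => ?_
  have h1 := (LogSQG.barrier_shrinkScale ha0 ha hκ hM hξ₀.1 hξ1 hα0 hαle hε hε1).lt_modulus hθ hf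
    ha0 (by linarith) hκ hdata ⟨hT.le.trans ht.1, ht.2⟩ x h
  rwa [LogSQG.shrinkScale_of_le hT ht.1] at h1
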